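/- **Conventions.** A *symmetric categorical group* is a (small) symmetric monoidal groupoid $(\mathcal S,+,0)$ such that $x+(-):\mathcal S\to\mathcal S$ is an equivalence for every object $x$. Together with symmetric monoidal functors and monoidal natural transformations they form the 2-category $\mathsf{SCG}$. A functor of two variables between symmetric categorical groups is *biadditive* if it is symmetric monoidal in each variable, naturally in the other, and the two ways to expand $(x+x')(y+y')$ agree. A *2-ring* is a (small) symmetric categorical group $\mathcal R$ with a biadditive multiplication and a unit object, together with associativity and unit isomorphisms that are natural and additive in each variable and satisfy the pentagon and triangle axioms. A (right) *2-module* over $\mathcal R$ is a symmetric categorical group $\mathcal M$ with a biadditive action $\mathcal M\times\mathcal R\to\mathcal M$ and natural associativity and unit isomorphisms, additive in each variable, satisfying the pentagon and triangle axioms. A morphism of 2-modules is a symmetric monoidal functor $F$ with natural isomorphisms $F(m)\cdot x\cong F(m\cdot x)$, additive in $m$ and $x$ and compatible with the associativity and unit isomorphisms; a 2-morphism is a monoidal natural transformation compatible with these isomorphisms. In either of these 2-categories, a morphism $f:A\to B$ is *faithful* if for every object $X$ the functor $f\circ(-):\mathrm{Hom}(X,A)\to\mathrm{Hom}(X,B)$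 is faithful. An object $I$ is *injective* if for every faithful $f:A\to B$ and every $g:A\to I$ there is $h:B\to I$ with $h\circ f\cong g$. The 2-category *has enough injective objects* if every object admits a faithful morphism to an injective object. For a symmetric categorical group $\mathcal S$ let $\pi_0(\mathcal S)$ be the abelian group of isomorphism classes of objects, $\pi_1(\mathcal S)=\mathrm{Aut}(0)$, and $k_{\mathcal S}:\pi_0(\mathcal S)\to\pi_1(\mathcal S)$ the homomorphism that sends the class of $x$ to the automorphism of $0$ corresponding to the commutativity constraint $x+x\to x+x$ under $\mathrm{Aut}(0)\cong\mathrm{Aut}(x+x)$; one has $2k_{\mathcal S}=0$. For a triple $T=(A_0,A_1,a)$ of abelian groups and a homomorphism $a:A_0\to A_1$ with $2a=0$, let $K(T)$ be a symmetric categorical group with $(\pi_0,\pi_1,k)\cong T$ (it exists and is unique up to equivalence). For an abelian group $M$ let $r(M)=({}_2M,M,\mathrm{incl})$, where ${}_2M=\{m\in M: 2m=0\}$. **Theorem.** 1. The 2-category $\mathsf{SCG}$ of symmetric categorical groups has enough injective objects. 2. For every 2-ring $\mathcal R$ the 2-category of (right) 2-modules over $\mathcal R$ has enough injective objects. 3.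 A symmetric categorical group $\mathcal S$ is injective if and only if it is equivalent in $\mathsf{SCG}$ to $K(r(Q))$ for some divisible abelian group $Q$. Moreover, if $\mathcal S$ is injective, then $\pi_1(\mathcal S)$ is divisible and $\mathcal S$ is equivalent to $K(r(\pi_1(\mathcal S)))$. -/

import Mathlib

open CategoryTheory MonoidalCategory

universe w v u

/-! ## Faithful morphisms and injective objects in a 2-category -/

section TwoCategorical

variable {B : Type u} [Bicategory.{w, v} B]

/-- A 1-morphism `f : a ⟶ b` is faithful if for every object `x` the functor
`Hom(x, a) ⥤ Hom(x, b)` given by composition with `f` is faithful. -/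
def IsFaithfulMor {a b : B} (f : a ⟶ b) : Prop :=
  ∀ (x : B) (g h : x ⟶ a) (σ τ : g ⟶ h),
    Bicategory.whiskerRight σ f = Bicategory.whiskerRight τ f → σ = τ

/-- An object `i` is injective if for every faithful `f : a ⟶ b` restriction along `f` is a
surjection from the set of isomorphism classes of 1-morphisms `b ⟶ i` to the set of isomorphism
classes of 1-morphisms `a ⟶ i`. -/
def IsInjectiveObj (i : B) : Prop :=
  ∀ (a b : B) (f : a ⟶ b), IsFaithfulMor f →
    ∀ g : a ⟶ i, ∃ h : b ⟶ i, Nonempty (f ≫ h ≅ g)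

variable (B) in
/-- Every object has a faithful morphism to an injective object. -/
def HasEnoughInjectives : Prop :=
  ∀ a : B, ∃ (i : B) (f : a ⟶ i), IsInjectiveObj i ∧ IsFaithfulMor f

end TwoCategorical

/-! ## The 2-category of symmetric categorical groups -/

/-- A (small) symmetric categorical group: a symmetric monoidal groupoid in which every
endofunctor `x ⊗ -` is an equivalence. The composition law, written `+` in the literature, is
the tensor product `⊗` here, and the neutral element `0` is `𝟙_`. -/
structure SCGr where
  carrier : Type u
  [category : Category.{u} carrier]
  [monoidal : MonoidalCategory carrier]
  [symmetric : SymmetricCategory carrier]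
  [groupoid : IsGroupoid carrier]
  isEquivalence_tensorLeft : ∀ x : carrier, (tensorLeft x).IsEquivalence

namespace SCGr

instance : CoeSort SCGr.{u} (Type u) := ⟨carrier⟩

attribute [instance] category monoidal symmetric groupoid

/-- A morphism of symmetric categorical groups: a symmetric monoidal functor. As the target is a
groupoid, the structure maps `F x ⊗ F y ⟶ F (x ⊗ y)` and `𝟙_ ⟶ F 𝟙_` of a lax braided functor are
automatically isomorphisms. -/
structure Hom (S T : SCGr.{u}) where
  fn : S ⥤ T
  [braided : fn.LaxBraided]

attribute [instance] Hom.braided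

/-- A 2-morphism between morphisms of symmetric categorical groups: a monoidal natural
transformation (automatically invertible, as the target is a groupoid). -/
@[ext]
structure Hom₂ {S T : SCGr.{u}} (F G : Hom S T) where
  nt : F.fn ⟶ G.fn
  [isMonoidal : NatTrans.IsMonoidal nt]

attribute [instance] Hom₂.isMonoidal

instance : CategoryStruct SCGr.{u} where
  Hom := Hom
  id S := { fn := 𝟭 S }
  comp F G := { fn := F.fn ⋙ G.fn }

instance (S T : SCGr.{u}) : Category (S ⟶ T) where
  Hom F G := Hom₂ F G
  id F := { nt := 𝟙 F.fn }
  comp η θ := { nt := η.nt ≫ θ.nt }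

@[simp] theorem id_fn (S : SCGr.{u}) : Hom.fn (𝟙 S) = 𝟭 S := rfl

@[simp] theorem comp_fn {S T U : SCGr.{u}} (F : S ⟶ T) (G : T ⟶ U) :
    Hom.fn (F ≫ G) = Hom.fn F ⋙ Hom.fn G := rfl

@[simp] theorem id_nt {S T : SCGr.{u}} (F : S ⟶ T) : Hom₂.nt (𝟙 F) = 𝟙 (Hom.fn F) := rfl

@[simp] theorem comp_nt {S T : SCGr.{u}} {F G H : S ⟶ T} (η : F ⟶ G) (θ : G ⟶ H) :
    Hom₂.nt (η ≫ θ) = Hom₂.nt η ≫ Hom₂.nt θ := rfl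

theorem hom₂_ext {S T : SCGr.{u}} {F G : S ⟶ T} {η θ : F ⟶ G}
    (h : ∀ x : S, (Hom₂.nt η).app x = (Hom₂.nt θ).app x) : η = θ :=
  Hom₂.ext (NatTrans.ext (funext h))

/-- The 2-isomorphism given by a monoidal natural isomorphism. -/
def mkIso₂ {S T : SCGr.{u}} (F G : S ⟶ T) (e : Hom.fn F ≅ Hom.fn G)
    (he : NatTrans.IsMonoidal e.hom) : F ≅ G where
  hom := Hom₂.mk (F := F) (G := G) e.hom
  inv := Hom₂.mk (F := G) (G := F) e.inv
  hom_inv_id := Hom₂.ext e.hom_inv_id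
  inv_hom_id := Hom₂.ext e.inv_hom_id

@[simp] theorem mkIso₂_hom_nt {S T : SCGr.{u}} {F G : S ⟶ T} (e : Hom.fn F ≅ Hom.fn G)
    (he : NatTrans.IsMonoidal e.hom) : Hom₂.nt (mkIso₂ F G e he).hom = e.hom := rfl

@[simp] theorem mkIso₂_inv_nt {S T : SCGr.{u}} {F G : S ⟶ T} (e : Hom.fn F ≅ Hom.fn G)
    (he : NatTrans.IsMonoidal e.hom) : Hom₂.nt (mkIso₂ F G e he).inv = e.inv := rfl

/-- The horizontal composite of the identity of `F` with `η`. -/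
def wL {S T U : SCGr.{u}} (F : S ⟶ T) {G H : T ⟶ U} (η : G ⟶ H) : F ≫ G ⟶ F ≫ H :=
  Hom₂.mk (F := F ≫ G) (G := F ≫ H) (Functor.whiskerLeft (Hom.fn F) (Hom₂.nt η))
    (isMonoidal := NatTrans.IsMonoidal.whiskerLeft (F₁ := Hom.fn F) (Hom₂.nt η))

/-- The horizontal composite of `η` with the identity of `H`. -/
def wR {S T U : SCGr.{u}} {F G : S ⟶ T} (η : F ⟶ G) (H : T ⟶ U) : F ≫ H ⟶ G ≫ H :=
  Hom₂.mk (F := F ≫ H) (G := G ≫ H) (Functor.whiskerRight (Hom₂.nt η) (Hom.fn H))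
    (isMonoidal := NatTrans.IsMonoidal.whiskerRight (Hom₂.nt η) (G₁ := Hom.fn H))

@[simp] theorem wL_app {S T U : SCGr.{u}} (F : S ⟶ T) {G H : T ⟶ U} (η : G ⟶ H) (x : S) :
    (Hom₂.nt (wL F η)).app x = (Hom₂.nt η).app ((Hom.fn F).obj x) := rfl

@[simp] theorem wR_app {S T U : SCGr.{u}} {F G : S ⟶ T} (η : F ⟶ G) (H : T ⟶ U) (x : S) :
    (Hom₂.nt (wR η H)).app x = (Hom.fn H).map ((Hom₂.nt η).app x) := rfl

theorem isMonoidal_associator {S T U V : SCGr.{u}} (F : S ⟶ T) (G : T ⟶ U) (H : U ⟶ V) :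
    NatTrans.IsMonoidal (F₁ := Hom.fn ((F ≫ G) ≫ H)) (F₂ := Hom.fn (F ≫ G ≫ H))
      (Functor.associator (Hom.fn F) (Hom.fn G) (Hom.fn H)).hom :=
  (inferInstance :
    NatTrans.IsMonoidal (Functor.associator (Hom.fn F) (Hom.fn G) (Hom.fn H)).hom)

theorem isMonoidal_leftUnitor {S T : SCGr.{u}} (F : S ⟶ T) :
    NatTrans.IsMonoidal (F₁ := Hom.fn (𝟙 S ≫ F)) (F₂ := Hom.fn F)
      (Functor.leftUnitor (Hom.fn F)).hom :=
  (inferInstance : NatTrans.IsMonoidal (Functor.leftUnitor (Hom.fn F)).hom)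

theorem isMonoidal_rightUnitor {S T : SCGr.{u}} (F : S ⟶ T) :
    NatTrans.IsMonoidal (F₁ := Hom.fn (F ≫ 𝟙 T)) (F₂ := Hom.fn F)
      (Functor.rightUnitor (Hom.fn F)).hom :=
  (inferInstance : NatTrans.IsMonoidal (Functor.rightUnitor (Hom.fn F)).hom)

/-- The 2-category of symmetric categorical groups. -/
instance : Bicategory SCGr.{u} where
  whiskerLeft F _ _ η := wL F η
  whiskerRight η H := wR η H
  associator F G H := mkIso₂ ((F ≫ G) ≫ H) (F ≫ G ≫ H)
    (Functor.associator (Hom.fn F) (Hom.fn G) (Hom.fn H)) (isMonoidal_associator F G H)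
  leftUnitor {S _} F := mkIso₂ (𝟙 S ≫ F) F
    (Functor.leftUnitor (Hom.fn F)) (isMonoidal_leftUnitor F)
  rightUnitor {_ T} F := mkIso₂ (F ≫ 𝟙 T) F
    (Functor.rightUnitor (Hom.fn F)) (isMonoidal_rightUnitor F)
  whiskerLeft_id _ _ := by refine hom₂_ext fun _ => ?_; simp
  whiskerLeft_comp _ _ _ _ _ _ := by refine hom₂_ext fun _ => ?_; simp
  id_whiskerLeft _ := by refine hom₂_ext fun _ => ?_; simp
  comp_whiskerLeft _ _ _ _ _ := by refine hom₂_ext fun _ => ?_; simp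
  id_whiskerRight _ _ := by refine hom₂_ext fun _ => ?_; simp
  comp_whiskerRight _ _ _ := by refine hom₂_ext fun _ => ?_; simp
  whiskerRight_id _ := by refine hom₂_ext fun _ => ?_; simp
  whiskerRight_comp _ _ _ := by refine hom₂_ext fun _ => ?_; simp
  whisker_assoc _ _ _ _ _ := by refine hom₂_ext fun _ => ?_; simp
  whisker_exchange _ _ := by refine hom₂_ext fun _ => ?_; simp
  pentagon _ _ _ _ := by refine hom₂_ext fun _ => ?_; simp
  triangle _ _ := by refine hom₂_ext fun _ => ?_; simp

end SCGr

/-! ## The type of a symmetric categorical group -/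

namespace SCGr

variable (S : SCGr.{u})

/-- The set of isomorphism classes of objects. -/
def Pi0 : Type u := Quotient (isIsomorphicSetoid S)

variable {S} in
/-- The isomorphism class of an object. -/
def cls (x : S) : Pi0 S := Quotient.mk (isIsomorphicSetoid S) x

variable {S} in
theorem cls_eq_iff {x y : S} : cls x = cls y ↔ Nonempty (x ≅ y) :=
  ⟨fun h => Quotient.exact h, fun h => Quotient.sound (s := isIsomorphicSetoid S) h⟩

variable {S} in
theorem cls_surj (p : Pi0 S) : ∃ x : S, cls x = p :=
  Quotient.exists_rep p

/-- The addition of isomorphism classes, induced by `⊗`. -/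
instance : Add (Pi0 S) where
  add := Quotient.map₂ (sa := isIsomorphicSetoid S) (sb := isIsomorphicSetoid S)
    (sc := isIsomorphicSetoid S) (fun x y => x ⊗ y) (fun _ _ ⟨e⟩ _ _ ⟨f⟩ => ⟨e ⊗ᵢ f⟩)

instance : Zero (Pi0 S) := ⟨cls (𝟙_ S)⟩

variable {S} in
theorem cls_tensor (x y : S) : cls (x ⊗ y) = cls x + cls y := rfl

variable {S} in
theorem cls_unit : cls (𝟙_ S) = 0 := rfl

theorem exists_pi0_neg (p : Pi0 S) : ∃ q, q + p = 0 := by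
  obtain ⟨x, rfl⟩ := cls_surj p
  have := S.isEquivalence_tensorLeft x
  refine ⟨cls ((tensorLeft x).objPreimage (𝟙_ S)), ?_⟩
  rw [← cls_tensor, ← cls_unit, cls_eq_iff]
  exact ⟨β_ _ _ ≪≫ (tensorLeft x).objObjPreimageIso (𝟙_ S)⟩

noncomputable instance : Neg (Pi0 S) := ⟨fun p => (exists_pi0_neg S p).choose⟩

/-- The abelian group `π₀ S`. -/
noncomputable instance : AddCommGroup (Pi0 S) where
  add_assoc p q r := by
    obtain ⟨x, rfl⟩ := cls_surj p
    obtain ⟨y, rfl⟩ := cls_surj q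
    obtain ⟨z, rfl⟩ := cls_surj r
    simp only [← cls_tensor]
    exact cls_eq_iff.2 ⟨α_ x y z⟩
  zero_add p := by
    obtain ⟨x, rfl⟩ := cls_surj p
    rw [← cls_unit, ← cls_tensor]
    exact cls_eq_iff.2 ⟨λ_ x⟩
  add_zero p := by
    obtain ⟨x, rfl⟩ := cls_surj p
    rw [← cls_unit, ← cls_tensor]
    exact cls_eq_iff.2 ⟨ρ_ x⟩
  add_comm p q := by
    obtain ⟨x, rfl⟩ := cls_surj p
    obtain ⟨y, rfl⟩ := cls_surj q
    simp only [← cls_tensor]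
    exact cls_eq_iff.2 ⟨β_ x y⟩
  neg_add_cancel p := (exists_pi0_neg S p).choose_spec
  nsmul := nsmulRec
  zsmul := zsmulRec

variable {S}

/-- The map `Aut 0 → Aut x` induced by the endofunctor `x ⊗ -` and the identification of
`x ⊗ 𝟙_` with `x`; as `S` is a groupoid, automorphisms are the same as endomorphisms. -/
def translate (x : S) (a : 𝟙_ S ⟶ 𝟙_ S) : x ⟶ x :=
  (ρ_ x).inv ≫ x ◁ a ≫ (ρ_ x).hom

theorem translate_comp (x : S) (a b : 𝟙_ S ⟶ 𝟙_ S) :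
    translate x (a ≫ b) = translate x a ≫ translate x b := by
  simp [translate]

theorem translate_id (x : S) : translate x (𝟙 (𝟙_ S)) = 𝟙 x := by
  simp [translate]

theorem translate_bijective (x : S) : Function.Bijective (translate x) := by
  have := S.isEquivalence_tensorLeft x
  constructor
  · intro a b h
    simp only [translate, Iso.cancel_iso_inv_left, Iso.cancel_iso_hom_right] at h
    exact (tensorLeft x).map_injective h
  · intro f
    obtain ⟨a, ha⟩ := (tensorLeft x).map_surjective ((ρ_ x).hom ≫ f ≫ (ρ_ x).inv)
    refine ⟨a, ?_⟩
    change x ◁ a = (ρ_ x).hom ≫ f ≫ (ρ_ x).inv at ha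
    simp [translate, ha]

theorem translate_naturality {x y : S} (f : x ⟶ y) (a : 𝟙_ S ⟶ 𝟙_ S) :
    f ≫ translate y a = translate x a ≫ f := by
  simp only [translate, Category.assoc, ← rightUnitor_naturality]
  rw [whisker_exchange_assoc, rightUnitor_inv_naturality_assoc]

theorem translate_naturality_assoc {x y z : S} (f : x ⟶ y) (a : 𝟙_ S ⟶ 𝟙_ S) (h : y ⟶ z) :
    f ≫ translate y a ≫ h = translate x a ≫ f ≫ h := by
  rw [← Category.assoc, translate_naturality, Category.assoc]

theorem translate_unit (a : 𝟙_ S ⟶ 𝟙_ S) : translate (𝟙_ S) a = a := by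
  rw [translate, ← unitors_equal, leftUnitor_naturality, ← unitors_inv_equal]
  simp

theorem translate_tensor_right (x y : S) (a : 𝟙_ S ⟶ 𝟙_ S) :
    translate (x ⊗ y) a = x ◁ translate y a := by
  simp only [translate]
  monoidal

theorem translate_tensor_left (x y : S) (a : 𝟙_ S ⟶ 𝟙_ S) :
    translate (x ⊗ y) a = translate x a ▷ y := by
  have h := translate_naturality (β_ x y).hom a
  rw [translate_tensor_right, ← BraidedCategory.braiding_naturality_left] at h
  exact ((cancel_mono _).1 h).symm

theorem comp_comm_unit (a b : 𝟙_ S ⟶ 𝟙_ S) : a ≫ b = b ≫ a := by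
  have h := translate_naturality a b
  rwa [translate_unit] at h

variable (S) in
/-- The group `π₁ S` of automorphisms of the neutral object, written additively. As `S` is a
groupoid, these are all the endomorphisms of the neutral object. -/
def Pi1 : Type u := 𝟙_ S ⟶ 𝟙_ S

/-- An automorphism of the neutral object as an element of `π₁ S`. -/
def toPi1 : (𝟙_ S ⟶ 𝟙_ S) ≃ Pi1 S := Equiv.refl _

instance : Add (Pi1 S) := ⟨fun a b => toPi1 (toPi1.symm a ≫ toPi1.symm b)⟩

instance : Zero (Pi1 S) := ⟨toPi1 (𝟙 (𝟙_ S))⟩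

noncomputable instance : Neg (Pi1 S) := ⟨fun a => toPi1 (inv (toPi1.symm a))⟩

/-- The abelian group structure on `π₁ S`, given by composition. -/
noncomputable instance : AddCommGroup (Pi1 S) where
  add_assoc a b c := Category.assoc (toPi1.symm a) (toPi1.symm b) (toPi1.symm c)
  zero_add a := Category.id_comp (toPi1.symm a)
  add_zero a := Category.comp_id (toPi1.symm a)
  add_comm a b := comp_comm_unit (toPi1.symm a) (toPi1.symm b)
  neg_add_cancel a := IsIso.inv_hom_id (toPi1.symm a)
  nsmul := nsmulRec
  zsmul := zsmulRec

theorem toPi1_comp (a b : 𝟙_ S ⟶ 𝟙_ S) : toPi1 (a ≫ b) = toPi1 a + toPi1 b := rfl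

theorem toPi1_id : toPi1 (𝟙 (𝟙_ S)) = 0 := rfl

/-- The automorphism of the neutral object that corresponds to the commutativity constraint
`x ⊗ x ⟶ x ⊗ x`. -/
noncomputable def sgn (x : S) : 𝟙_ S ⟶ 𝟙_ S :=
  (translate_bijective (x ⊗ x)).2 (β_ x x).hom |>.choose

theorem translate_sgn (x : S) : translate (x ⊗ x) (sgn x) = (β_ x x).hom :=
  (translate_bijective (x ⊗ x)).2 (β_ x x).hom |>.choose_spec

theorem sgn_eq {x : S} {a : 𝟙_ S ⟶ 𝟙_ S} (h : translate (x ⊗ x) a = (β_ x x).hom) :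
    sgn x = a :=
  (translate_bijective (x ⊗ x)).1 ((translate_sgn x).trans h.symm)

theorem sgn_congr {x y : S} (e : x ≅ y) : sgn x = sgn y := by
  apply sgn_eq
  have h := translate_naturality (e.hom ⊗ₘ e.hom) (sgn y)
  rw [translate_sgn, BraidedCategory.braiding_naturality] at h
  exact ((cancel_mono _).1 h).symm

theorem sgn_comp_self (x : S) : sgn x ≫ sgn x = 𝟙 (𝟙_ S) := by
  apply (translate_bijective (x ⊗ x)).1
  rw [translate_comp, translate_sgn, translate_id, SymmetricCategory.symmetry]

theorem sgn_tensor (x y : S) : sgn (x ⊗ y) = sgn x ≫ sgn y := by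
  apply sgn_eq
  have h₁ : (β_ y (x ⊗ y)).hom = translate (y ⊗ x ⊗ y) (sgn y) ≫
      (α_ y x y).inv ≫ (β_ y x).hom ▷ y := by
    rw [BraidedCategory.braiding_tensor_right_hom, ← translate_sgn y, ← translate_tensor_right,
      translate_naturality_assoc, translate_naturality_assoc, translate_naturality_assoc]
    simp
  have h₂ : (β_ x (x ⊗ y)).hom = translate (x ⊗ x ⊗ y) (sgn x) ≫
      x ◁ (β_ x y).hom ≫ (α_ x y x).inv := by
    rw [BraidedCategory.braiding_tensor_right_hom, ← translate_sgn x, ← translate_tensor_left,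
      translate_naturality_assoc]
    simp
  have h₃ : x ◁ (β_ y x).hom ▷ y ≫ (α_ x (x ⊗ y) y).inv ≫ (x ◁ (β_ x y).hom) ▷ y =
      (α_ x (y ⊗ x) y).inv := by
    rw [associator_inv_naturality_middle_assoc, ← comp_whiskerRight,
      ← MonoidalCategory.whiskerLeft_comp, SymmetricCategory.symmetry]
    simp
  rw [BraidedCategory.braiding_tensor_left_hom, h₁, h₂]
  simp only [MonoidalCategory.whiskerLeft_comp, comp_whiskerRight, Category.assoc,
    ← translate_tensor_left, ← translate_tensor_right]
  rw [translate_naturality_assoc, translate_naturality_assoc (α_ x (x ⊗ y) y).inv,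
    translate_naturality_assoc (x ◁ (β_ y x).hom ▷ y),
    translate_naturality_assoc (x ◁ (α_ y x y).inv),
    translate_naturality_assoc (α_ x y (x ⊗ y)).hom, reassoc_of% h₃,
    ← Category.assoc, ← translate_comp, comp_comm_unit]
  have h₄ : (α_ x y (x ⊗ y)).hom ≫ x ◁ (α_ y x y).inv ≫ (α_ x (y ⊗ x) y).inv ≫
      (α_ x y x).inv ▷ y ≫ (α_ (x ⊗ y) x y).hom = 𝟙 _ := by monoidal
  rw [h₄, Category.comp_id]

/-- The homomorphism `π₀ S → π₁ S` induced by the commutativity constraints. -/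
noncomputable def kInv (S : SCGr.{u}) : Pi0 S →+ Pi1 S :=
  AddMonoidHom.mk' (Quotient.lift (fun x => toPi1 (sgn x)) fun _ _ ⟨e⟩ => by rw [sgn_congr e])
    fun p q => by
      obtain ⟨x, rfl⟩ := cls_surj p
      obtain ⟨y, rfl⟩ := cls_surj q
      exact congrArg toPi1 (sgn_tensor x y)

theorem kInv_cls (x : S) : kInv S (cls x) = toPi1 (sgn x) := rfl

end SCGr

/-- Triples `(A₀, A₁, a)` of two abelian groups and a homomorphism `a` from `A₀` to the 2-torsion
subgroup of `A₁`, that is, a homomorphism `A₀ / 2 A₀ → A₁`. -/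
structure Ty where
  A₀ : Type u
  A₁ : Type u
  [grp₀ : AddCommGroup A₀]
  [grp₁ : AddCommGroup A₁]
  a : A₀ →+ A₁
  two_nsmul_a : ∀ x, 2 • a x = 0

namespace Ty

attribute [instance] grp₀ grp₁

/-- A morphism of triples is a pair of homomorphisms that commutes with the structure maps. -/
@[ext]
structure Hom (A B : Ty.{u}) where
  f₀ : A.A₀ →+ B.A₀
  f₁ : A.A₁ →+ B.A₁
  comm : B.a.comp f₀ = f₁.comp A.a

instance : Category Ty.{u} where
  Hom := Hom
  id A := ⟨AddMonoidHom.id _, AddMonoidHom.id _, rfl⟩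
  comp {A B C} f g := ⟨g.f₀.comp f.f₀, g.f₁.comp f.f₁, by
    rw [← AddMonoidHom.comp_assoc, g.comm, AddMonoidHom.comp_assoc, f.comm,
      AddMonoidHom.comp_assoc]⟩

/-- Two group isomorphisms that commute with the structure maps give an isomorphism of triples. -/
def mkIso {A B : Ty.{u}} (e₀ : A.A₀ ≃+ B.A₀) (e₁ : A.A₁ ≃+ B.A₁)
    (h : ∀ x, B.a (e₀ x) = e₁ (A.a x)) : A ≅ B where
  hom := ⟨e₀.toAddMonoidHom, e₁.toAddMonoidHom, AddMonoidHom.ext h⟩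
  inv := ⟨e₀.symm.toAddMonoidHom, e₁.symm.toAddMonoidHom, AddMonoidHom.ext fun x => by
    simpa using (congrArg e₁.symm (h (e₀.symm x))).symm⟩
  hom_inv_id := Hom.ext (AddMonoidHom.ext e₀.symm_apply_apply)
    (AddMonoidHom.ext e₁.symm_apply_apply)
  inv_hom_id := Hom.ext (AddMonoidHom.ext e₀.apply_symm_apply)
    (AddMonoidHom.ext e₁.apply_symm_apply)

/-- The triple `r(M) = (₂M, M, id)`, where `₂M` is the subgroup of all `m` with `2 m = 0`. -/
def r (M : Type u) [AddCommGroup M] : Ty.{u} where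
  A₀ := (nsmulAddMonoidHom 2 : M →+ M).ker
  A₁ := M
  a := (nsmulAddMonoidHom 2 : M →+ M).ker.subtype
  two_nsmul_a x := x.2

end Ty

/-- The type `(π₀ S, π₁ S, k_S)` of a symmetric categorical group. -/
noncomputable def SCGr.type (S : SCGr.{u}) : Ty.{u} where
  A₀ := SCGr.Pi0 S
  A₁ := SCGr.Pi1 S
  a := SCGr.kInv S
  two_nsmul_a p := by
    obtain ⟨x, rfl⟩ := SCGr.cls_surj p
    rw [SCGr.kInv_cls, two_nsmul]
    exact congrArg SCGr.toPi1 (SCGr.sgn_comp_self x)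

/-! ## A symmetric categorical group of prescribed type -/

/-- A biadditive map `c : A × A → B` with `c x y + c y x = 0`. -/
structure BraidingForm (A B : Type u) [AddCommGroup A] [AddCommGroup B] where
  c : A →+ A →+ B
  symm : ∀ x y, c x y + c y x = 0

/-- The objects of the skeletal symmetric categorical group defined by a form `c`: the elements
of `A`. -/
structure Skel {A B : Type u} [AddCommGroup A] [AddCommGroup B] (φ : BraidingForm A B) where
  val : A

namespace Skel

variable {A B : Type u} [AddCommGroup A] [AddCommGroup B] {φ : BraidingForm A B}

/-- The morphisms of the skeletal groupoid: `B` if source and target agree, and none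
otherwise. -/
@[ext]
structure Mor (x y : Skel φ) where
  deg : B
  eq : x.val = y.val

instance : Category (Skel φ) where
  Hom := Mor
  id _ := ⟨0, rfl⟩
  comp f g := ⟨f.deg + g.deg, f.eq.trans g.eq⟩
  id_comp f := Mor.ext (zero_add f.deg)
  comp_id f := Mor.ext (add_zero f.deg)
  assoc f g h := Mor.ext (add_assoc f.deg g.deg h.deg)

/-- The element of `B` given by a morphism. -/
def deg {x y : Skel φ} (f : x ⟶ y) : B := Mor.deg f

/-- The morphism given by an element of `B`. -/
def hom {x y : Skel φ} (b : B) (h : x.val = y.val) : x ⟶ y := Mor.mk b h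

theorem eq_of_hom {x y : Skel φ} (f : x ⟶ y) : x.val = y.val := Mor.eq f

theorem hom_ext {x y : Skel φ} {f g : x ⟶ y} (h : deg f = deg g) : f = g := Mor.ext h

@[simp] theorem deg_hom {x y : Skel φ} (b : B) (h : x.val = y.val) :
    deg (hom b h : x ⟶ y) = b := rfl

@[simp] theorem deg_id (x : Skel φ) : deg (𝟙 x) = 0 := rfl

@[simp] theorem deg_comp {x y z : Skel φ} (f : x ⟶ y) (g : y ⟶ z) :
    deg (f ≫ g) = deg f + deg g := rfl

/-- The isomorphism given by an element of `B`. -/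
def iso {x y : Skel φ} (b : B) (h : x.val = y.val) : x ≅ y where
  hom := hom b h
  inv := hom (-b) h.symm
  hom_inv_id := hom_ext (by simp)
  inv_hom_id := hom_ext (by simp)

@[simp] theorem deg_iso_hom {x y : Skel φ} (b : B) (h : x.val = y.val) :
    deg (iso b h : x ≅ y).hom = b := rfl

@[simp] theorem deg_iso_inv {x y : Skel φ} (b : B) (h : x.val = y.val) :
    deg (iso b h : x ≅ y).inv = -b := rfl

instance : IsGroupoid (Skel φ) where
  all_isIso f := ⟨hom (-deg f) (eq_of_hom f).symm, hom_ext (by simp), hom_ext (by simp)⟩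

instance : MonoidalCategoryStruct (Skel φ) where
  tensorObj x y := ⟨x.val + y.val⟩
  whiskerLeft x _ _ f := hom (deg f) (congrArg (x.val + ·) (eq_of_hom f))
  whiskerRight f y := hom (deg f) (congrArg (· + y.val) (eq_of_hom f))
  tensorHom f g := hom (deg f + deg g) (congrArg₂ (· + ·) (eq_of_hom f) (eq_of_hom g))
  tensorUnit := ⟨0⟩
  associator x y z := iso 0 (add_assoc x.val y.val z.val)
  leftUnitor x := iso 0 (zero_add x.val)
  rightUnitor x := iso 0 (add_zero x.val)

@[simp] theorem val_tensor (x y : Skel φ) : (x ⊗ y).val = x.val + y.val := rfl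

@[simp] theorem val_unit : (𝟙_ (Skel φ)).val = 0 := rfl

@[simp] theorem deg_whiskerLeft (x : Skel φ) {y z : Skel φ} (f : y ⟶ z) :
    deg (x ◁ f) = deg f := rfl

@[simp] theorem deg_whiskerRight {y z : Skel φ} (f : y ⟶ z) (x : Skel φ) :
    deg (f ▷ x) = deg f := rfl

@[simp] theorem deg_tensorHom {x y z w : Skel φ} (f : x ⟶ y) (g : z ⟶ w) :
    deg (f ⊗ₘ g) = deg f + deg g := rfl

@[simp] theorem deg_associator (x y z : Skel φ) : deg (α_ x y z).hom = 0 := rfl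

@[simp] theorem deg_associator_inv (x y z : Skel φ) : deg (α_ x y z).inv = 0 :=
  neg_zero

@[simp] theorem deg_leftUnitor (x : Skel φ) : deg (λ_ x).hom = 0 := rfl

@[simp] theorem deg_rightUnitor (x : Skel φ) : deg (ρ_ x).hom = 0 := rfl

@[simp] theorem deg_rightUnitor_inv (x : Skel φ) : deg (ρ_ x).inv = 0 := neg_zero

instance : MonoidalCategory (Skel φ) where
  tensorHom_def _ _ := hom_ext (by simp)
  id_tensorHom_id _ _ := hom_ext (by simp)
  tensorHom_comp_tensorHom _ _ _ _ := hom_ext (by simp; abel)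
  whiskerLeft_id _ _ := hom_ext (by simp)
  id_whiskerRight _ _ := hom_ext (by simp)
  associator_naturality _ _ _ := hom_ext (by simp; abel)
  leftUnitor_naturality _ := hom_ext (by simp)
  rightUnitor_naturality _ := hom_ext (by simp)
  pentagon _ _ _ _ := hom_ext (by simp)
  triangle _ _ := hom_ext (by simp)

/-- The commutativity constraint `x + y ⟶ y + x` is given by `c x y`. -/
instance : BraidedCategory (Skel φ) where
  braiding x y := iso (φ.c x.val y.val) (add_comm x.val y.val)
  braiding_naturality_right _ _ _ f := hom_ext (by simp [eq_of_hom f, add_comm])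
  braiding_naturality_left f z := hom_ext (by simp [eq_of_hom f, add_comm])
  hexagon_forward _ _ _ := hom_ext (by simp)
  hexagon_reverse _ _ _ := hom_ext (by simp; abel)

@[simp] theorem deg_braiding (x y : Skel φ) : deg (β_ x y).hom = φ.c x.val y.val := rfl

instance : SymmetricCategory (Skel φ) where
  symmetry x y := hom_ext (by simp [φ.symm])

theorem isEquivalence_tensorLeft (x : Skel φ) : (tensorLeft x).IsEquivalence where
  faithful := ⟨fun {_ _ f g} h => hom_ext (by
    have h' : deg ((tensorLeft x).map f) = deg ((tensorLeft x).map g) := congrArg deg h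
    exact h')⟩
  full := ⟨fun f => ⟨hom (deg f) (add_left_cancel (eq_of_hom f)), hom_ext rfl⟩⟩
  essSurj := ⟨fun y => ⟨⟨-x.val + y.val⟩, ⟨iso 0 (add_neg_cancel_left x.val y.val)⟩⟩⟩

variable (φ) in
/-- The skeletal symmetric categorical group defined by a form. -/
def toSCGr : SCGr.{u} where
  carrier := Skel φ
  isEquivalence_tensorLeft := isEquivalence_tensorLeft

variable (φ) in
/-- Its set of isomorphism classes is `A`. -/
noncomputable def pi0Equiv : SCGr.Pi0 (toSCGr φ) ≃+ A :=
  AddEquiv.mk' (Equiv.ofBijective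
    (Quotient.lift (fun x : Skel φ => x.val) fun _ _ ⟨e⟩ => eq_of_hom e.hom)
    ⟨by
      rintro ⟨x⟩ ⟨y⟩ h
      exact SCGr.cls_eq_iff.2 ⟨(iso 0 h : x ≅ y)⟩,
    fun a => ⟨SCGr.cls (S := toSCGr φ) (⟨a⟩ : Skel φ), rfl⟩⟩) (by rintro ⟨x⟩ ⟨y⟩; rfl)

variable (φ) in
/-- Its group of automorphisms of the neutral object is `B`. -/
def pi1Equiv : SCGr.Pi1 (toSCGr φ) ≃+ B where
  toFun f := deg (φ := φ) (SCGr.toPi1.symm f)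
  invFun b := SCGr.toPi1 (S := toSCGr φ) (hom b rfl : 𝟙_ (Skel φ) ⟶ 𝟙_ (Skel φ))
  left_inv _ := rfl
  right_inv _ := rfl
  map_add' _ _ := rfl

theorem sgn_eq (x : Skel φ) :
    SCGr.sgn (S := toSCGr φ) x = (hom (φ.c x.val x.val) rfl : 𝟙_ (Skel φ) ⟶ 𝟙_ (Skel φ)) := by
  apply SCGr.sgn_eq
  refine hom_ext (φ := φ) ?_
  change deg ((ρ_ (x ⊗ x)).inv ≫ (x ⊗ x) ◁ (hom (φ.c x.val x.val) rfl) ≫ (ρ_ (x ⊗ x)).hom) = _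
  simp only [deg_comp, deg_rightUnitor_inv, deg_whiskerLeft, deg_hom, deg_rightUnitor, zero_add,
    add_zero]
  rfl

end Skel

namespace Ty

/-- Every structure map `a` is the diagonal of a symmetric biadditive map. -/
theorem exists_form (T : Ty.{u}) : ∃ φ : BraidingForm T.A₀ T.A₁, ∀ x, φ.c x x = T.a x := by
  let _ : Module (ZMod 2) T.a.range := AddCommGroup.zmodModule (n := 2) (by
    rintro ⟨_, x, rfl⟩
    exact Subtype.ext (T.two_nsmul_a x))
  let b := Module.Basis.ofVectorSpace (ZMod 2) T.a.range
  let f : T.A₀ →+ _ →₀ ZMod 2 := b.repr.toLinearMap.toAddMonoidHom.comp T.a.rangeRestrict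
  let g : (_ →₀ ZMod 2) →+ T.A₁ := T.a.range.subtype.comp b.repr.symm.toLinearMap.toAddMonoidHom
  have hsq : ∀ z : ZMod 2, z * z = z := by decide
  have htw : ∀ z : ZMod 2, z + z = 0 := by decide
  refine ⟨⟨AddMonoidHom.mk' (fun x => AddMonoidHom.mk' (fun y => g (f x * f y)) ?_) ?_, ?_⟩, ?_⟩
  · intro y z
    rw [map_add, mul_add, map_add]
  · intro x y
    ext z
    change g (f (x + y) * f z) = g (f x * f z) + g (f y * f z)
    rw [map_add, add_mul, map_add]
  · intro x y
    change g (f x * f y) + g (f y * f x) = 0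
    rw [← map_add, mul_comm (f y), show f x * f y + f x * f y = 0 from ?_, map_zero]
    ext i
    exact htw _
  · intro x
    change g (f x * f x) = T.a x
    rw [show f x * f x = f x from ?_]
    · change ((b.repr.symm (b.repr (T.a.rangeRestrict x)) : T.a.range) : T.A₁) = T.a x
      rw [LinearEquiv.symm_apply_apply]
      rfl
    · ext i
      exact hsq _

/-- A symmetric categorical group `K(T)` of type `T`. -/
noncomputable def K (T : Ty.{u}) : SCGr.{u} := Skel.toSCGr T.exists_form.choose

/-- The type of `K(T)` is isomorphic to `T`. -/
theorem type_K (T : Ty.{u}) : Nonempty ((K T).type ≅ T) :=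
  ⟨mkIso (Skel.pi0Equiv T.exists_form.choose) (Skel.pi1Equiv T.exists_form.choose) fun p => by
    obtain ⟨x, rfl⟩ := SCGr.cls_surj p
    change T.a x.val = Skel.deg (φ := T.exists_form.choose) (SCGr.sgn x)
    rw [← T.exists_form.choose_spec]
    exact (congrArg Skel.deg (Skel.sgn_eq (φ := T.exists_form.choose) x)).symm⟩

end Ty

/-! ## 2-rings -/

open Functor.LaxMonoidal in
/-- A biadditive functor `S × T → U` of symmetric categorical groups: a functor in two variables
with the structure of a symmetric monoidal functor in each variable, natural in the other
variable, such that the two ways to expand `(x + x') (y + y')` agree. (The compatibilities with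
the neutral objects follow, since all objects are invertible.) -/
structure BiaddFunctor (S T U : SCGr.{u}) where
  fn : S ⥤ T ⥤ U
  [right : ∀ x : S, (fn.obj x).LaxBraided]
  [left : ∀ y : T, (fn.flip.obj y).LaxBraided]
  [right_nat : ∀ {x x' : S} (f : x ⟶ x'), NatTrans.IsMonoidal (fn.map f)]
  [left_nat : ∀ {y y' : T} (g : y ⟶ y'), NatTrans.IsMonoidal (fn.flip.map g)]
  interchange : ∀ (x x' : S) (y y' : T),
    (μ (fn.obj x) y y' ⊗ₘ μ (fn.obj x') y y') ≫ μ (fn.flip.obj (y ⊗ y')) x x' =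
      tensorμ ((fn.obj x).obj y) ((fn.obj x).obj y') ((fn.obj x').obj y) ((fn.obj x').obj y') ≫
        (μ (fn.flip.obj y) x x' ⊗ₘ μ (fn.flip.obj y') x x') ≫ μ (fn.obj (x ⊗ x')) y y'

namespace BiaddFunctor

attribute [instance] right left right_nat left_nat

variable {S T U : SCGr.{u}} (P : BiaddFunctor S T U)

/-- The value `x y` on objects. -/
abbrev obj (x : S) (y : T) : U := (P.fn.obj x).obj y

/-- The value `f g` on morphisms. -/
def map {x x' : S} {y y' : T} (f : x ⟶ x') (g : y ⟶ y') : P.obj x y ⟶ P.obj x' y' :=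
  (P.fn.map f).app y ≫ (P.fn.obj x').map g

/-- The distributivity constraint `x y + x y' ⟶ x (y + y')`. -/
def distR (x : S) (y y' : T) : P.obj x y ⊗ P.obj x y' ⟶ P.obj x (y ⊗ y') :=
  Functor.LaxMonoidal.μ (P.fn.obj x) y y'

/-- The distributivity constraint `x y + x' y ⟶ (x + x') y`. -/
def distL (x x' : S) (y : T) : P.obj x y ⊗ P.obj x' y ⟶ P.obj (x ⊗ x') y :=
  Functor.LaxMonoidal.μ (P.fn.flip.obj y) x x'

@[simp] theorem map_id (x : S) (y : T) : P.map (𝟙 x) (𝟙 y) = 𝟙 (P.obj x y) := by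
  simp [map]

theorem map_comp_id {x x' x'' : S} (f : x ⟶ x') (f' : x' ⟶ x'') (y : T) :
    P.map (f ≫ f') (𝟙 y) = P.map f (𝟙 y) ≫ P.map f' (𝟙 y) := by
  simp [map]

end BiaddFunctor

/-- An associativity constraint `(x y) z ≅ x (y z)` for biadditive functors: a natural isomorphism
that is additive in each of the three variables. -/
structure AssocConstraint {S T U V W Z : SCGr.{u}} (P : BiaddFunctor S T V) (Q : BiaddFunctor V U Z)
    (P' : BiaddFunctor T U W) (Q' : BiaddFunctor S W Z) where
  iso : ∀ (x : S) (y : T) (z : U), Q.obj (P.obj x y) z ≅ Q'.obj x (P'.obj y z)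
  naturality : ∀ {x x' : S} {y y' : T} {z z' : U} (f : x ⟶ x') (g : y ⟶ y') (h : z ⟶ z'),
    Q.map (P.map f g) h ≫ (iso x' y' z').hom = (iso x y z).hom ≫ Q'.map f (P'.map g h)
  additive₁ : ∀ (x x' : S) (y : T) (z : U),
    Q.distL (P.obj x y) (P.obj x' y) z ≫ Q.map (P.distL x x' y) (𝟙 z) ≫ (iso (x ⊗ x') y z).hom =
      ((iso x y z).hom ⊗ₘ (iso x' y z).hom) ≫ Q'.distL x x' (P'.obj y z)
  additive₂ : ∀ (x : S) (y y' : T) (z : U),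
    Q.distL (P.obj x y) (P.obj x y') z ≫ Q.map (P.distR x y y') (𝟙 z) ≫ (iso x (y ⊗ y') z).hom =
      ((iso x y z).hom ⊗ₘ (iso x y' z).hom) ≫
        Q'.distR x (P'.obj y z) (P'.obj y' z) ≫ Q'.map (𝟙 x) (P'.distL y y' z)
  additive₃ : ∀ (x : S) (y : T) (z z' : U),
    Q.distR (P.obj x y) z z' ≫ (iso x y (z ⊗ z')).hom =
      ((iso x y z).hom ⊗ₘ (iso x y z').hom) ≫
        Q'.distR x (P'.obj y z) (P'.obj y z') ≫ Q'.map (𝟙 x) (P'.distR y z z')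

/-- A right unit constraint `x e ≅ x` for a biadditive functor: an additive natural
isomorphism. -/
structure RightUnitConstraint {S T : SCGr.{u}} (P : BiaddFunctor S T S) (e : T) where
  iso : ∀ x : S, P.obj x e ≅ x
  naturality : ∀ {x x' : S} (f : x ⟶ x'), P.map f (𝟙 e) ≫ (iso x').hom = (iso x).hom ≫ f
  additive : ∀ x x' : S, P.distL x x' e ≫ (iso (x ⊗ x')).hom = (iso x).hom ⊗ₘ (iso x').hom

/-- A left unit constraint `e y ≅ y` for a biadditive functor: an additive natural
isomorphism. -/
structure LeftUnitConstraint {S T : SCGr.{u}} (P : BiaddFunctor S T T) (e : S) where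
  iso : ∀ y : T, P.obj e y ≅ y
  naturality : ∀ {y y' : T} (g : y ⟶ y'), P.map (𝟙 e) g ≫ (iso y').hom = (iso y).hom ≫ g
  additive : ∀ y y' : T, P.distR e y y' ≫ (iso (y ⊗ y')).hom = (iso y).hom ⊗ₘ (iso y').hom

/-- A 2-ring (categorical ring, Ann-category): a symmetric categorical group with a biadditive
multiplication that is associative and unital up to coherent additive isomorphisms. -/
structure TwoRing where
  add : SCGr.{u}
  mul : BiaddFunctor add add add
  one : add
  assoc : AssocConstraint mul mul mul mul
  leftUnit : LeftUnitConstraint mul one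
  rightUnit : RightUnitConstraint mul one
  pentagon : ∀ x y z w : add,
    mul.map (assoc.iso x y z).hom (𝟙 w) ≫ (assoc.iso x (mul.obj y z) w).hom ≫
        mul.map (𝟙 x) (assoc.iso y z w).hom =
      (assoc.iso (mul.obj x y) z w).hom ≫ (assoc.iso x y (mul.obj z w)).hom
  triangle : ∀ x y : add,
    (assoc.iso x one y).hom ≫ mul.map (𝟙 x) (leftUnit.iso y).hom =
      mul.map (rightUnit.iso x).hom (𝟙 y)

/-! ## The 2-category of right 2-modules over a 2-ring -/

/-- A right 2-module over a 2-ring `R`: a symmetric categorical group with a biadditive right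
action of `R` that is associative and unital up to coherent additive isomorphisms. -/
structure RightModule (R : TwoRing.{u}) where
  add : SCGr.{u}
  act : BiaddFunctor add R.add add
  assoc : AssocConstraint act act R.mul act
  unit : RightUnitConstraint act R.one
  pentagon : ∀ (m : add) (x y z : R.add),
    act.map (assoc.iso m x y).hom (𝟙 z) ≫ (assoc.iso m (R.mul.obj x y) z).hom ≫
        act.map (𝟙 m) (R.assoc.iso x y z).hom =
      (assoc.iso (act.obj m x) y z).hom ≫ (assoc.iso m x (R.mul.obj y z)).hom
  triangle : ∀ (m : add) (x : R.add),
    (assoc.iso m R.one x).hom ≫ act.map (𝟙 m) (R.leftUnit.iso x).hom =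
      act.map (unit.iso m).hom (𝟙 x)

namespace RightModule

variable {R : TwoRing.{u}}

open Functor.LaxMonoidal in
/-- A morphism of right 2-modules: a morphism `F` of symmetric categorical groups with natural
isomorphisms `F m · x ≅ F (m · x)` that are additive in both variables and compatible with the
associativity and unit constraints. -/
structure Hom (M N : RightModule R) where
  hom : M.add ⟶ N.add
  lin : ∀ (m : M.add) (x : R.add), N.act.obj (hom.fn.obj m) x ≅ hom.fn.obj (M.act.obj m x)
  naturality : ∀ {m m' : M.add} {x x' : R.add} (f : m ⟶ m') (g : x ⟶ x'),
    N.act.map (hom.fn.map f) g ≫ (lin m' x').hom = (lin m x).hom ≫ hom.fn.map (M.act.map f g)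
  additive₁ : ∀ (m m' : M.add) (x : R.add),
    N.act.distL (hom.fn.obj m) (hom.fn.obj m') x ≫ N.act.map (μ hom.fn m m') (𝟙 x) ≫
        (lin (m ⊗ m') x).hom =
      ((lin m x).hom ⊗ₘ (lin m' x).hom) ≫ μ hom.fn (M.act.obj m x) (M.act.obj m' x) ≫
        hom.fn.map (M.act.distL m m' x)
  additive₂ : ∀ (m : M.add) (x x' : R.add),
    N.act.distR (hom.fn.obj m) x x' ≫ (lin m (x ⊗ x')).hom =
      ((lin m x).hom ⊗ₘ (lin m x').hom) ≫ μ hom.fn (M.act.obj m x) (M.act.obj m x') ≫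
        hom.fn.map (M.act.distR m x x')
  assoc : ∀ (m : M.add) (x y : R.add),
    N.act.map (lin m x).hom (𝟙 y) ≫ (lin (M.act.obj m x) y).hom ≫
        hom.fn.map (M.assoc.iso m x y).hom =
      (N.assoc.iso (hom.fn.obj m) x y).hom ≫ (lin m (R.mul.obj x y)).hom
  unit : ∀ m : M.add,
    (lin m R.one).hom ≫ hom.fn.map (M.unit.iso m).hom = (N.unit.iso (hom.fn.obj m)).hom

/-- A 2-morphism between morphisms of right 2-modules: a monoidal natural transformation
compatible with the actions. -/
@[ext]
structure Hom₂ {M N : RightModule R} (F G : Hom M N) where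
  hom : F.hom ⟶ G.hom
  lin : ∀ (m : M.add) (x : R.add),
    N.act.map (hom.nt.app m) (𝟙 x) ≫ (G.lin m x).hom =
      (F.lin m x).hom ≫ hom.nt.app (M.act.obj m x)

/-- The identity of a right 2-module. -/
def Hom.id (M : RightModule R) : Hom M M where
  hom := 𝟙 M.add
  lin m x := Iso.refl (M.act.obj m x)
  naturality f g := by simp
  additive₁ m m' x := by simp
  additive₂ m x x' := by simp
  assoc m x y := by simp
  unit m := by simp

theorem Hom.map_lin {M N : RightModule R} (F : Hom M N) {m m' : M.add} (f : m ⟶ m')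
    (x : R.add) {z : N.add} (h : F.hom.fn.obj (M.act.obj m' x) ⟶ z) :
    N.act.map (F.hom.fn.map f) (𝟙 x) ≫ (F.lin m' x).hom ≫ h =
      (F.lin m x).hom ≫ F.hom.fn.map (M.act.map f (𝟙 x)) ≫ h := by
  rw [← Category.assoc, F.naturality, Category.assoc]

open Functor.LaxMonoidal in
/-- The composite of two morphisms of right 2-modules. -/
def Hom.comp {M N L : RightModule R} (F : Hom M N) (G : Hom N L) : Hom M L where
  hom := F.hom ≫ G.hom
  lin m x := G.lin (F.hom.fn.obj m) x ≪≫ G.hom.fn.mapIso (F.lin m x)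
  naturality {m m' x x'} f g := by
    have h := G.naturality (F.hom.fn.map f) g
    simp only [SCGr.comp_fn, Functor.comp_obj, Functor.comp_map, Iso.trans_hom,
      Functor.mapIso_hom, Category.assoc]
    rw [reassoc_of% h, ← Functor.map_comp, F.naturality, Functor.map_comp]
  additive₁ m m' x := by
    have hG := G.additive₁ (F.hom.fn.obj m) (F.hom.fn.obj m') x
    have hF := congrArg G.hom.fn.map (F.additive₁ m m' x)
    simp only [Functor.map_comp] at hF
    simp only [comp_μ, SCGr.comp_fn, Functor.comp_obj, Functor.comp_map, Iso.trans_hom,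
      Functor.mapIso_hom, Category.assoc, BiaddFunctor.map_comp_id, Hom.map_lin]
    rw [reassoc_of% hG, hF, ← MonoidalCategory.tensorHom_comp_tensorHom_assoc, μ_natural_assoc]
  additive₂ m x x' := by
    have hG := G.additive₂ (F.hom.fn.obj m) x x'
    have hF := congrArg G.hom.fn.map (F.additive₂ m x x')
    simp only [Functor.map_comp] at hF
    simp only [comp_μ, SCGr.comp_fn, Functor.comp_obj, Functor.comp_map, Iso.trans_hom,
      Functor.mapIso_hom, Category.assoc]
    rw [reassoc_of% hG, hF, ← MonoidalCategory.tensorHom_comp_tensorHom_assoc, μ_natural_assoc]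
  assoc m x y := by
    have hG := G.assoc (F.hom.fn.obj m) x y
    have hF := congrArg G.hom.fn.map (F.assoc m x y)
    simp only [Functor.map_comp] at hF
    simp only [SCGr.comp_fn, Functor.comp_obj, Functor.comp_map, Iso.trans_hom,
      Functor.mapIso_hom, Category.assoc, BiaddFunctor.map_comp_id, Hom.map_lin]
    rw [hF, reassoc_of% hG]
  unit m := by
    have hG := G.unit (F.hom.fn.obj m)
    have hF := congrArg G.hom.fn.map (F.unit m)
    simp only [Functor.map_comp] at hF
    simp only [SCGr.comp_fn, Functor.comp_obj, Functor.comp_map, Iso.trans_hom,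
      Functor.mapIso_hom, Category.assoc]
    rw [hF, hG]

instance : CategoryStruct (RightModule R) where
  Hom := Hom
  id := Hom.id
  comp := Hom.comp

instance (M N : RightModule R) : Category (M ⟶ N) where
  Hom F G := Hom₂ F G
  id F := ⟨𝟙 (Hom.hom F), fun m x => by simp⟩
  comp {F G H} η θ := ⟨η.hom ≫ θ.hom, fun m x => by
    simp only [SCGr.comp_nt, NatTrans.comp_app, BiaddFunctor.map_comp_id, Category.assoc]
    rw [θ.lin, ← Category.assoc, η.lin, Category.assoc]⟩

theorem hom₂_ext {M N : RightModule R} {F G : M ⟶ N} {η θ : F ⟶ G}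
    (h : Hom₂.hom η = Hom₂.hom θ) : η = θ := Hom₂.ext h

/-- The 2-isomorphism of module morphisms given by a compatible 2-isomorphism of the underlying
morphisms. -/
def mkIso₂ {M N : RightModule R} (F G : M ⟶ N) (e : Hom.hom F ≅ Hom.hom G)
    (h : ∀ (m : M.add) (x : R.add), N.act.map (e.hom.nt.app m) (𝟙 x) ≫ (Hom.lin G m x).hom =
      (Hom.lin F m x).hom ≫ e.hom.nt.app (M.act.obj m x)) : F ≅ G where
  hom := Hom₂.mk (F := F) (G := G) e.hom h
  inv := Hom₂.mk (F := G) (G := F) e.inv fun m x => by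
    have h₁ : ∀ z, e.hom.nt.app z ≫ e.inv.nt.app z = 𝟙 _ := fun z =>
      congrArg (fun η => (SCGr.Hom₂.nt η).app z) e.hom_inv_id
    have h₂ : ∀ z, e.inv.nt.app z ≫ e.hom.nt.app z = 𝟙 _ := fun z =>
      congrArg (fun η => (SCGr.Hom₂.nt η).app z) e.inv_hom_id
    have h₃ : (Hom.lin G m x).hom = N.act.map (e.inv.nt.app m) (𝟙 x) ≫
        (Hom.lin F m x).hom ≫ e.hom.nt.app (M.act.obj m x) := by
      rw [← h, ← Category.assoc, ← BiaddFunctor.map_comp_id, h₂]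
      simp
    rw [h₃]
    simp only [Category.assoc]
    rw [h₁]
    exact congrArg _ (Category.comp_id _).symm
  hom_inv_id := Hom₂.ext e.hom_inv_id
  inv_hom_id := Hom₂.ext e.inv_hom_id

/-- The horizontal composite of the identity of `F` with `η`. -/
def wL {M N L : RightModule R} (F : M ⟶ N) {G H : N ⟶ L} (η : G ⟶ H) : F ≫ G ⟶ F ≫ H :=
  Hom₂.mk (F := F ≫ G) (G := F ≫ H) (Bicategory.whiskerLeft (Hom.hom F) (Hom₂.hom η)) fun m x => by
    have h := Hom₂.lin η ((Hom.hom F).fn.obj m) x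
    change L.act.map ((Hom₂.hom η).nt.app ((Hom.hom F).fn.obj m)) (𝟙 x) ≫
      (Hom.lin H ((Hom.hom F).fn.obj m) x).hom ≫ (Hom.hom H).fn.map (Hom.lin F m x).hom =
      ((Hom.lin G ((Hom.hom F).fn.obj m) x).hom ≫ (Hom.hom G).fn.map (Hom.lin F m x).hom) ≫
      (Hom₂.hom η).nt.app ((Hom.hom F).fn.obj (M.act.obj m x))
    rw [Category.assoc, reassoc_of% h, NatTrans.naturality]

/-- The horizontal composite of `η` with the identity of `H`. -/
def wR {M N L : RightModule R} {F G : M ⟶ N} (η : F ⟶ G) (H : N ⟶ L) : F ≫ H ⟶ G ≫ H :=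
  Hom₂.mk (F := F ≫ H) (G := G ≫ H) (Bicategory.whiskerRight (Hom₂.hom η) (Hom.hom H)) fun m x => by
    have h := Hom₂.lin η m x
    change L.act.map ((Hom.hom H).fn.map ((Hom₂.hom η).nt.app m)) (𝟙 x) ≫
      (Hom.lin H ((Hom.hom G).fn.obj m) x).hom ≫ (Hom.hom H).fn.map (Hom.lin G m x).hom =
      ((Hom.lin H ((Hom.hom F).fn.obj m) x).hom ≫ (Hom.hom H).fn.map (Hom.lin F m x).hom) ≫
      (Hom.hom H).fn.map ((Hom₂.hom η).nt.app (M.act.obj m x))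
    rw [Hom.map_lin, Category.assoc, ← Functor.map_comp, ← Functor.map_comp, h]

/-- The 2-category of right 2-modules over `R`. -/
instance : Bicategory (RightModule R) where
  whiskerLeft F _ _ η := wL F η
  whiskerRight η H := wR η H
  associator F G H := mkIso₂ ((F ≫ G) ≫ H) (F ≫ G ≫ H)
    (Bicategory.associator (Hom.hom F) (Hom.hom G) (Hom.hom H)) fun m x => by
      rename_i M N L K
      change K.act.map (𝟙 _) (𝟙 x) ≫ ((Hom.lin H _ x).hom ≫
          (Hom.hom H).fn.map (Hom.lin G _ x).hom) ≫
            (Hom.hom H).fn.map ((Hom.hom G).fn.map (Hom.lin F m x).hom) =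
        ((Hom.lin H _ x).hom ≫ (Hom.hom H).fn.map ((Hom.lin G _ x).hom ≫
          (Hom.hom G).fn.map (Hom.lin F m x).hom)) ≫ 𝟙 _
      rw [BiaddFunctor.map_id, Category.id_comp, Category.comp_id, Functor.map_comp, Category.assoc]
  leftUnitor {M _} F := mkIso₂ (𝟙 M ≫ F) F (Bicategory.leftUnitor (Hom.hom F)) fun m x => by
    rename_i N
    change N.act.map (𝟙 _) (𝟙 x) ≫ (Hom.lin F m x).hom =
      ((Hom.lin F m x).hom ≫ (Hom.hom F).fn.map (𝟙 _)) ≫ 𝟙 _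
    rw [BiaddFunctor.map_id, Category.id_comp, Category.comp_id, CategoryTheory.Functor.map_id,
      Category.comp_id]
  rightUnitor {_ N} F := mkIso₂ (F ≫ 𝟙 N) F (Bicategory.rightUnitor (Hom.hom F)) fun m x => by
    change N.act.map (𝟙 _) (𝟙 x) ≫ (Hom.lin F m x).hom = (𝟙 _ ≫ (Hom.lin F m x).hom) ≫ 𝟙 _
    rw [BiaddFunctor.map_id, Category.id_comp, Category.comp_id]
  whiskerLeft_id _ _ := hom₂_ext (Bicategory.whiskerLeft_id _ _)
  whiskerLeft_comp _ _ _ _ _ _ := hom₂_ext (Bicategory.whiskerLeft_comp _ _ _)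
  id_whiskerLeft _ := hom₂_ext (Bicategory.id_whiskerLeft _)
  comp_whiskerLeft _ _ _ _ _ := hom₂_ext (Bicategory.comp_whiskerLeft _ _ _)
  id_whiskerRight _ _ := hom₂_ext (Bicategory.id_whiskerRight _ _)
  comp_whiskerRight _ _ _ := hom₂_ext (Bicategory.comp_whiskerRight _ _ _)
  whiskerRight_id _ := hom₂_ext (Bicategory.whiskerRight_id _)
  whiskerRight_comp _ _ _ := hom₂_ext (Bicategory.whiskerRight_comp _ _ _)
  whisker_assoc _ _ _ _ _ := hom₂_ext (Bicategory.whisker_assoc _ _ _)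
  whisker_exchange _ _ := hom₂_ext (Bicategory.whisker_exchange _ _)
  pentagon _ _ _ _ := hom₂_ext (Bicategory.pentagon _ _ _ _)
  triangle _ _ := hom₂_ext (Bicategory.triangle _ _)

end RightModule

/-- An abelian group is divisible if multiplication by every positive integer is surjective. -/
def IsDivisibleGroup (Q : Type u) [AddCommGroup Q] : Prop :=
  ∀ n : ℕ, 0 < n → ∀ q : Q, ∃ p : Q, n • p = q

/-! A symmetric monoidal functor from `S` to a skeletal symmetric categorical group with `π₀ = A`,
`π₁ = B` and commutativity constraint a form `c` is recorded by its values in `A` on objects and by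
the degrees in `B` of its values on morphisms and of its structure maps: a `Character`. Let `B` be
divisible and let `x ↦ c x x` be a bijection from `A` to the 2-torsion of `B`, as for `K(r(B))`.
Everything rests on the claim that isomorphism classes of characters of `S` then correspond to
homomorphisms `π₁ S → B`.

Uniqueness (`Character.nonempty_trans`): the symmetry axiom at `(x, x)` expresses `c (val x) (val
x)` through the degree on `Aut 0`, so `val` is determined. If `F` and `G` agree on objects and on
`Aut 0`, pairs `(x, b)`, with `b` a possible comparison of `F x` with `G x`, form up to isomorphism
a commutative monoid containing `B`. Divisibility gives a retraction onto `B`, whose values at the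
pairs `(x, 0)` are an isomorphism `F ≅ G`.

Existence (`Twist.exists_character`): given `ψ : π₁ S → B`, push the morphisms of `S` out along `ψ`
and twist the commutativity constraint by `-c`. Then all self-braidings are trivial, and coherence
holds in its strong form: two morphisms between formal tensor words built from the constraints agree
even if letters repeat. This is proved by sorting words by insertion. Hence morphisms between words
modulo canonical isomorphisms form a commutative monoid under `⊗` into which `π₁` embeds, even after
translation. A homomorphism on `π₁` extends to this monoid by divisibility and yields degrees
additive under composition and tensor product (`TensorWord.exists_degree`). Undoing the twist gives
the character.

A faithful morphism is injective on `π₁`, so extending characters along it amounts to extending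
homomorphisms to a divisible group; this makes `K(r(Q))` injective. Embedding `π₁ S` in a divisible
group gives a faithful morphism from `S` to such an object. If `S` is injective, that morphism
splits, so `π₁ S` is a retract of a divisible group. The morphism `S → K(r(π₁ S))` that is the
identity on `π₁` splits too, and uniqueness makes the other composite isomorphic to the identity.

For modules, the characters of `R` form a right module by `(F · x)(y) = F(x y)`. Coinduction `h ↦ (m
↦ h(m · -))` and evaluation at the unit match characters of `M` with module morphisms from `M` to
it. Testing against `R` itself shows that a faithful module morphism is faithful as a functor, so
injectivity reduces to extending characters, and coinducing a faithful character of `M` gives a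
faithful morphism. -/

/-! ## Divisible groups -/

/-- A homomorphism to a divisible group extends along injective homomorphisms. -/
theorem IsDivisibleGroup.exists_extension {Q : Type u} [AddCommGroup Q] (hQ : IsDivisibleGroup Q)
    {M N : Type*} [AddCommGroup M] [AddCommGroup N] (f : M →+ N) (hf : Function.Injective f)
    (g : M →+ Q) : ∃ h : N →+ Q, ∀ x, h (f x) = g x := by
  let _ : DivisibleBy Q ℕ := divisibleByOfSMulRightSurj Q ℕ fun {n} hn q =>
    hQ n (Nat.pos_of_ne_zero hn) q
  let _ : DivisibleBy Q ℤ := AddGroup.divisibleByIntOfDivisibleByNat Q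
  obtain ⟨h, hh⟩ := (Module.Baer.of_divisible Q).extension_property_addMonoidHom f hf g
  exact ⟨h, fun x => DFunLike.congr_fun hh x⟩

/-- A homomorphism from an abelian group `M` to a divisible group extends along homomorphisms from
`M` to commutative monoids that stay injective after all translations. -/
theorem IsDivisibleGroup.exists_extension_of_monoid {Q : Type u} [AddCommGroup Q]
    (hQ : IsDivisibleGroup Q) {M E : Type*} [AddCommGroup M] [AddCommMonoid E] (f : M →+ E)
    (hf : ∀ k a b, k + f a = k + f b → a = b) (g : M →+ Q) :
    ∃ h : E →+ Q, ∀ x, h (f x) = g x := by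
  -- Two elements of `E` agree in the Grothendieck group exactly when they agree after adding some
  -- `k`, so `hf` says that `M` embeds there.
  obtain ⟨h, hh⟩ := hQ.exists_extension
    ((Algebra.GrothendieckAddGroup.of : E →+ Algebra.GrothendieckAddGroup E).comp f) (fun a b hab => by
      obtain ⟨k, hk⟩ := (AddLocalization.addMonoidOf (⊤ : AddSubmonoid E)).eq_iff_exists.1 hab
      exact hf k a b hk) g
  exact ⟨h.comp Algebra.GrothendieckAddGroup.of, hh⟩

/-- Every abelian group embeds into a divisible one. -/
theorem exists_injective_divisible (M : Type u) [AddCommGroup M] :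
    ∃ (Q : Type u) (_ : AddCommGroup Q) (f : M →+ Q), IsDivisibleGroup Q ∧
      Function.Injective f := by
  -- Evaluation maps `M` to a product of copies of `ℚ/ℤ`, one for each character; division is
  -- componentwise and characters separate points.
  refine ⟨CharacterModule M → AddCircle (1 : ℚ), inferInstance,
    AddMonoidHom.mk' (fun x c => c x) fun x y => funext fun c => map_add c x y, ?_, ?_⟩
  · intro n hn q
    refine ⟨fun c => DivisibleBy.div (q c) (n : ℤ), funext fun c => ?_⟩
    have h := DivisibleBy.div_cancel (q c) (Int.natCast_ne_zero.2 hn.ne')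
    rwa [natCast_zsmul] at h
  · rw [injective_iff_map_eq_zero]
    intro x hx
    exact CharacterModule.eq_zero_of_character_apply fun c => congrFun hx c

/-! ## Symmetric monoidal functors to skeletal symmetric categorical groups -/

section

variable {A B : Type u} [AddCommGroup A] [AddCommGroup B]

/-- A symmetric monoidal functor from `S` to the skeletal symmetric categorical group defined
by `φ`, given by its values on objects and the degrees of its values on morphisms and of its
structure maps. (The compatibility with the neutral objects follows.) -/
structure Character (S : SCGr.{u}) (φ : BraidingForm A B) where
  val : S → A
  deg : ∀ {x y : S}, (x ⟶ y) → B
  m : S → S → B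
  val_eq : ∀ {x y : S}, (x ⟶ y) → val x = val y
  val_tensor : ∀ x y : S, val (x ⊗ y) = val x + val y
  deg_comp : ∀ {x y z : S} (f : x ⟶ y) (g : y ⟶ z), deg (f ≫ g) = deg f + deg g
  m_left : ∀ {x y : S} (f : x ⟶ y) (z : S), m x z + deg (f ▷ z) = deg f + m y z
  m_right : ∀ (z : S) {x y : S} (f : x ⟶ y), m z x + deg (z ◁ f) = deg f + m z y
  m_assoc : ∀ x y z : S, m x y + m (x ⊗ y) z + deg (α_ x y z).hom = m y z + m x (y ⊗ z)
  m_symm : ∀ x y : S, m x y + deg (β_ x y).hom = φ.c (val x) (val y) + m y x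

namespace Character

variable {S T U : SCGr.{u}} {φ : BraidingForm A B}

section

variable (F : Character S φ)

@[simp] theorem deg_id (x : S) : F.deg (𝟙 x) = 0 := by
  have h := F.deg_comp (𝟙 x) (𝟙 x)
  rw [Category.comp_id] at h
  exact left_eq_add.1 h

theorem deg_hom_add_inv {x y : S} (e : x ≅ y) : F.deg e.hom + F.deg e.inv = 0 := by
  rw [← F.deg_comp, e.hom_inv_id, F.deg_id]

theorem deg_inv {x y : S} (e : x ≅ y) : F.deg e.inv = -F.deg e.hom :=
  (neg_eq_of_add_eq_zero_right (F.deg_hom_add_inv e)).symm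

theorem deg_isIso_inv {x y : S} (e : x ⟶ y) [IsIso e] : F.deg (inv e) = -F.deg e :=
  F.deg_inv (asIso e)

theorem deg_tensorHom {x y x' y' : S} (f : x ⟶ y) (g : x' ⟶ y') :
    F.m x x' + F.deg (f ⊗ₘ g) = F.deg f + F.deg g + F.m y y' := by
  rw [MonoidalCategory.tensorHom_def, F.deg_comp, ← add_assoc, F.m_left, add_assoc, F.m_right,
    add_assoc]

@[simp] theorem val_unit : F.val (𝟙_ S) = 0 := by
  have h := F.val_eq (λ_ (𝟙_ S)).hom
  rw [F.val_tensor] at h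
  exact left_eq_add.1 h.symm

/-- The degree of the structure map `𝟙_ ⟶ F 𝟙_`. -/
def e : B := -(F.m (𝟙_ S) (𝟙_ S) + F.deg (λ_ (𝟙_ S)).hom)

/-- `e` is defined so that this holds at `𝟙_`. Associativity for `(0 + 0) + x` and the triangle
axiom carry it to every `x`. -/
theorem e_left (x : S) : F.e + F.m (𝟙_ S) x + F.deg (λ_ x).hom = 0 := by
  have h₁ := F.m_assoc (𝟙_ S) (𝟙_ S) x
  have h₂ := F.m_left (λ_ (𝟙_ S)).hom x
  have h₃ := F.m_right (𝟙_ S) (λ_ x).hom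
  have h₄ : (λ_ (𝟙_ S)).hom ▷ x = (α_ _ _ _).hom ≫ 𝟙_ S ◁ (λ_ x).hom := by
    rw [unitors_equal, triangle]
  rw [h₄, F.deg_comp] at h₂
  rw [e]
  linear_combination (norm := abel) h₂ - h₁ - h₃

/-- Braiding `x` past the unit reduces this to `e_left`; the form contributes nothing because `val`
vanishes on the unit. -/
theorem e_right (x : S) : F.e + F.m x (𝟙_ S) + F.deg (ρ_ x).hom = 0 := by
  have h₁ := F.m_symm x (𝟙_ S)
  have h₂ := F.e_left x
  rw [← braiding_leftUnitor, F.deg_comp, ← h₂]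
  rw [F.val_unit, map_zero, zero_add] at h₁
  linear_combination (norm := abel) h₁

theorem deg_translate (x : S) (a : 𝟙_ S ⟶ 𝟙_ S) : F.deg (SCGr.translate x a) = F.deg a := by
  have h := F.m_right x a
  rw [SCGr.translate, F.deg_comp, F.deg_comp, F.deg_inv]
  linear_combination (norm := abel) h

/-- In the symmetry axiom at `(x, x)` the terms `m x x` cancel. This ties values on objects to
degrees on `Aut 0`, and is why `π₁` alone can control a character. -/
theorem deg_sgn (x : S) : F.deg (SCGr.sgn x) = φ.c (F.val x) (F.val x) := by
  have h := F.m_symm x x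
  rw [← SCGr.translate_sgn, F.deg_translate] at h
  linear_combination (norm := abel) h

/-- The homomorphism on automorphism groups of the neutral objects. -/
noncomputable def pi1 : SCGr.Pi1 S →+ B :=
  AddMonoidHom.mk' (fun a => F.deg (SCGr.toPi1.symm a)) fun a b =>
    F.deg_comp (SCGr.toPi1.symm a) (SCGr.toPi1.symm b)

theorem pi1_toPi1 (a : 𝟙_ S ⟶ 𝟙_ S) : F.pi1 (SCGr.toPi1 a) = F.deg a := rfl

end

/-- A symmetric monoidal functor to a skeletal symmetric categorical group, in degrees. -/
def ofHom (F : S ⟶ Skel.toSCGr φ) : Character S φ where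
  val x := Skel.val (φ := φ) ((SCGr.Hom.fn F).obj x)
  deg f := Skel.deg (φ := φ) ((SCGr.Hom.fn F).map f)
  m x y := Skel.deg (φ := φ) (Functor.LaxMonoidal.μ (SCGr.Hom.fn F) x y)
  val_eq f := Skel.eq_of_hom (φ := φ) ((SCGr.Hom.fn F).map f)
  val_tensor x y := (Skel.eq_of_hom (φ := φ) (Functor.LaxMonoidal.μ (SCGr.Hom.fn F) x y)).symm
  deg_comp f g := congrArg (Skel.deg (φ := φ)) ((SCGr.Hom.fn F).map_comp f g)
  m_left f z := (congrArg (Skel.deg (φ := φ))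
    (Functor.LaxMonoidal.μ_natural_left (SCGr.Hom.fn F) f z)).symm
  m_right z _ _ f := (congrArg (Skel.deg (φ := φ))
    (Functor.LaxMonoidal.μ_natural_right (SCGr.Hom.fn F) z f)).symm
  m_assoc x y z := by
    have h := congrArg (Skel.deg (φ := φ))
      (Functor.LaxMonoidal.associativity (SCGr.Hom.fn F) x y z)
    exact (add_assoc _ _ _).trans (h.trans (zero_add _))
  m_symm x y := congrArg (Skel.deg (φ := φ))
    (Functor.LaxBraided.braided (F := SCGr.Hom.fn F) x y)

/-- The functor given by a character. -/
def functor (F : Character S φ) : S ⥤ Skel φ where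
  obj x := ⟨F.val x⟩
  map f := Skel.hom (F.deg f) (F.val_eq f)
  map_id x := Skel.hom_ext (F.deg_id x)
  map_comp f g := Skel.hom_ext (F.deg_comp f g)

instance (F : Character S φ) : F.functor.LaxBraided where
  ε := Skel.hom F.e F.val_unit.symm
  μ x y := Skel.hom (F.m x y) (F.val_tensor x y).symm
  μ_natural_left f z := Skel.hom_ext (F.m_left f z).symm
  μ_natural_right z f := Skel.hom_ext (F.m_right z f).symm
  associativity x y z := Skel.hom_ext (((add_assoc _ _ _).symm.trans (F.m_assoc x y z)).trans
    (zero_add _).symm)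
  left_unitality x := Skel.hom_ext ((F.e_left x).symm.trans (add_assoc _ _ _))
  right_unitality x := Skel.hom_ext ((F.e_right x).symm.trans (add_assoc _ _ _))
  braided x y := Skel.hom_ext (F.m_symm x y)

/-- The morphism of symmetric categorical groups given by a character. -/
def toHom (F : Character S φ) : S ⟶ Skel.toSCGr φ :=
  SCGr.Hom.mk (T := Skel.toSCGr φ) F.functor (braided := (inferInstance : F.functor.LaxBraided))

/-- The restriction of a character along a symmetric monoidal functor. -/
def comap (G : S ⥤ T) [G.LaxBraided] (F : Character T φ) : Character S φ where
  val x := F.val (G.obj x)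
  deg f := F.deg (G.map f)
  m x y := F.m (G.obj x) (G.obj y) + F.deg (Functor.LaxMonoidal.μ G x y)
  val_eq f := F.val_eq (G.map f)
  val_tensor x y := by
    rw [← F.val_eq (Functor.LaxMonoidal.μ G x y), F.val_tensor]
  deg_comp f g := by rw [G.map_comp, F.deg_comp]
  m_left f z := by
    have h := congrArg F.deg (Functor.LaxMonoidal.μ_natural_left G f z)
    rw [F.deg_comp, F.deg_comp] at h
    rw [add_assoc, ← h, ← add_assoc, F.m_left, add_assoc]
  m_right z _ _ f := by
    have h := congrArg F.deg (Functor.LaxMonoidal.μ_natural_right G z f)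
    rw [F.deg_comp, F.deg_comp] at h
    rw [add_assoc, ← h, ← add_assoc, F.m_right, add_assoc]
  m_assoc x y z := by
    have h := congrArg F.deg (Functor.LaxMonoidal.associativity G x y z)
    simp only [F.deg_comp] at h
    have h₁ := F.m_assoc (G.obj x) (G.obj y) (G.obj z)
    have h₂ := F.m_left (Functor.LaxMonoidal.μ G x y) (G.obj z)
    have h₃ := F.m_right (G.obj x) (Functor.LaxMonoidal.μ G y z)
    linear_combination (norm := abel) h + h₁ - h₂ + h₃
  m_symm x y := by
    have h := congrArg F.deg (Functor.LaxBraided.braided (F := G) x y)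
    simp only [F.deg_comp] at h
    have h₁ := F.m_symm (G.obj x) (G.obj y)
    linear_combination (norm := abel) h + h₁

/-- Transformations of characters: monoidal natural transformations, in degrees. -/
@[ext]
structure Trans (F G : Character S φ) where
  t : S → B
  val_eq : ∀ x, F.val x = G.val x
  nat : ∀ {x y : S} (f : x ⟶ y), F.deg f + t y = t x + G.deg f
  mul : ∀ x y : S, F.m x y + t (x ⊗ y) = t x + t y + G.m x y

/-- The unit condition is no extra requirement: it follows from multiplicativity at `(𝟙_, 𝟙_)` and
naturality along `λ_`. -/
theorem Trans.unit {F G : Character S φ} (η : Trans F G) : F.e + η.t (𝟙_ S) = G.e := by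
  have h₁ := η.mul (𝟙_ S) (𝟙_ S)
  have h₂ := η.nat (λ_ (𝟙_ S)).hom
  rw [e, e]
  linear_combination (norm := abel) -h₁ - h₂

theorem e_ofHom (F : S ⟶ Skel.toSCGr φ) :
    (ofHom F).e = Skel.deg (φ := φ) (Functor.LaxMonoidal.ε (SCGr.Hom.fn F)) := by
  have h₁ : (0 : B) = Skel.deg (φ := φ) (Functor.LaxMonoidal.ε (SCGr.Hom.fn F)) +
      ((ofHom F).m (𝟙_ S) (𝟙_ S) + (ofHom F).deg (λ_ (𝟙_ S)).hom) :=
    congrArg (Skel.deg (φ := φ)) (Functor.LaxMonoidal.left_unitality (SCGr.Hom.fn F) (𝟙_ S))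
  exact neg_eq_of_add_eq_zero_left h₁.symm

/-- The isomorphism of symmetric monoidal functors given by a transformation of characters. -/
def Trans.toIso {F G : S ⟶ Skel.toSCGr φ} (η : Trans (ofHom F) (ofHom G)) : F ≅ G :=
  SCGr.mkIso₂ F G
    (NatIso.ofComponents (fun x => (Skel.iso (φ := φ) (η.t x) (η.val_eq x) :))
      fun f => Skel.hom_ext (φ := φ) (η.nat f))
    { unit := by
        have h := η.unit
        rw [e_ofHom, e_ofHom] at h
        exact Skel.hom_ext (φ := φ) h
      tensor := fun x y => Skel.hom_ext (φ := φ) (η.mul x y) }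

end Character

end

/-! ## Uniqueness of characters with given values on automorphisms -/

namespace Character

variable {A B : Type u} [AddCommGroup A] [AddCommGroup B]
variable {S : SCGr.{u}} {φ : BraidingForm A B}

/-- Pairs of an object `x` and an element of `B`, thought of as a transformation at `x` between
two characters. -/
def transSetoid (F G : Character S φ) : Setoid (S × B) where
  r p q := ∃ f : p.1 ⟶ q.1, p.2 + F.deg f = q.2 + G.deg f
  iseqv :=
    { refl := fun p => ⟨𝟙 _, by simp⟩
      symm := by
        rintro p q ⟨f, h⟩
        refine ⟨inv f, ?_⟩
        rw [deg_isIso_inv, deg_isIso_inv]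
        linear_combination (norm := abel) -h
      trans := by
        rintro p q r ⟨f, h⟩ ⟨g, h'⟩
        refine ⟨f ≫ g, ?_⟩
        rw [deg_comp, deg_comp]
        linear_combination (norm := abel) h + h' }

/-- The commutative monoid of all such pairs up to isomorphism. -/
def TransMonoid (F G : Character S φ) (_ : ∀ x, F.val x = G.val x) : Type u :=
  Quotient (transSetoid F G)

namespace TransMonoid

variable {F G : Character S φ} {hv : ∀ x, F.val x = G.val x}

variable (hv) in
/-- The class of a pair. -/
def mk (x : S) (q : B) : TransMonoid F G hv := Quotient.mk (transSetoid F G) (x, q)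

theorem mk_surj (p : TransMonoid F G hv) : ∃ x q, mk hv x q = p := by
  obtain ⟨⟨x, q⟩, rfl⟩ := Quotient.exists_rep p
  exact ⟨x, q, rfl⟩

theorem mk_eq_iff {x y : S} {q r : B} : mk hv x q = mk hv y r ↔
    ∃ f : x ⟶ y, q + F.deg f = r + G.deg f :=
  ⟨fun h => Quotient.exact h, fun h => Quotient.sound (s := transSetoid F G) h⟩

instance : Add (TransMonoid F G hv) where
  add := Quotient.map₂ (sa := transSetoid F G) (sb := transSetoid F G) (sc := transSetoid F G)
    (fun p q => (p.1 ⊗ q.1, p.2 + q.2 + (F.m p.1 q.1 - G.m p.1 q.1))) <| by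
      rintro p p' ⟨f, hf⟩ q q' ⟨g, hg⟩
      refine ⟨f ⊗ₘ g, ?_⟩
      have h₁ := F.deg_tensorHom f g
      have h₂ := G.deg_tensorHom f g
      dsimp only
      linear_combination (norm := abel) hf + hg + h₁ - h₂

theorem mk_add (x y : S) (q r : B) :
    mk hv x q + mk hv y r = mk hv (x ⊗ y) (q + r + (F.m x y - G.m x y)) := rfl

-- The shift `F.e - G.e` compares the two unit structure maps; with it the left unitor identifies `0
-- + a` with `a`.
instance : Zero (TransMonoid F G hv) := ⟨mk hv (𝟙_ S) (F.e - G.e)⟩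

theorem zero_def : (0 : TransMonoid F G hv) = mk hv (𝟙_ S) (F.e - G.e) := rfl

theorem add_comm' (a b : TransMonoid F G hv) : a + b = b + a := by
  obtain ⟨x, q, rfl⟩ := mk_surj a
  obtain ⟨y, r, rfl⟩ := mk_surj b
  rw [mk_add, mk_add, mk_eq_iff]
  refine ⟨(β_ x y).hom, ?_⟩
  have h₁ := F.m_symm x y
  have h₂ := G.m_symm x y
  rw [hv, hv] at h₁
  linear_combination (norm := abel) h₁ - h₂

theorem zero_add' (a : TransMonoid F G hv) : 0 + a = a := by
  obtain ⟨x, q, rfl⟩ := mk_surj a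
  rw [zero_def, mk_add, mk_eq_iff]
  refine ⟨(λ_ x).hom, ?_⟩
  have h₁ := F.e_left x
  have h₂ := G.e_left x
  linear_combination (norm := abel) h₁ - h₂

instance : AddCommMonoid (TransMonoid F G hv) where
  add_assoc a b c := by
    obtain ⟨x, q, rfl⟩ := mk_surj a
    obtain ⟨y, r, rfl⟩ := mk_surj b
    obtain ⟨z, s, rfl⟩ := mk_surj c
    simp only [mk_add]
    rw [mk_eq_iff]
    refine ⟨(α_ x y z).hom, ?_⟩
    have h₁ := F.m_assoc x y z
    have h₂ := G.m_assoc x y z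
    linear_combination (norm := abel) h₁ - h₂
  zero_add := zero_add'
  add_zero a := by rw [add_comm', zero_add']
  add_comm := add_comm'
  nsmul := nsmulRec

variable (hv) in
/-- The inclusion of `B`. -/
def incl : B →+ TransMonoid F G hv where
  toFun q := mk hv (𝟙_ S) (q + (F.e - G.e))
  map_zero' := by rw [zero_add]; rfl
  map_add' q r := by
    rw [mk_add, mk_eq_iff.2]
    refine ⟨(λ_ (𝟙_ S)).inv, ?_⟩
    have h₁ := F.e_left (𝟙_ S)
    have h₂ := G.e_left (𝟙_ S)
    rw [deg_inv, deg_inv]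
    linear_combination (norm := abel) -h₁ + h₂

theorem mk_add_incl (x : S) (q r : B) : mk hv x q + incl hv r = mk hv x (q + r) := by
  change mk hv x q + mk hv _ _ = _
  rw [mk_add, mk_eq_iff]
  refine ⟨(ρ_ x).hom, ?_⟩
  have h₁ := F.e_right x
  have h₂ := G.e_right x
  linear_combination (norm := abel) h₁ - h₂

end TransMonoid

/-- Two characters with values in a divisible group are isomorphic if they agree on objects and on
automorphisms of the neutral object. -/
theorem nonempty_trans (hB : IsDivisibleGroup B) {F G : Character S φ}
    (hv : ∀ x, F.val x = G.val x) (hd : ∀ a : 𝟙_ S ⟶ 𝟙_ S, F.deg a = G.deg a) :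
    Nonempty (Trans F G) := by
  -- Pairs over the same `x` are identified only through an automorphism of `x`. It is the translate
  -- of some `c` in `Aut 0`, where the degrees of `F` and `G` agree. So `B` stays embedded after
  -- every translation and the identity of `B` extends to a retraction `χ`.
  obtain ⟨χ, hχ⟩ := hB.exists_extension_of_monoid (TransMonoid.incl hv) (fun k a b h => by
    obtain ⟨x, q, rfl⟩ := TransMonoid.mk_surj k
    rw [TransMonoid.mk_add_incl, TransMonoid.mk_add_incl, TransMonoid.mk_eq_iff] at h
    obtain ⟨f, hf⟩ := h
    obtain ⟨c, rfl⟩ := (SCGr.translate_bijective x).2 f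
    rw [deg_translate, deg_translate, hd] at hf
    exact add_left_cancel (add_right_cancel hf)) (AddMonoidHom.id B)
  have hmk : ∀ x q, χ (TransMonoid.mk hv x q) = χ (TransMonoid.mk hv x 0) + q := fun x q => by
    rw [← zero_add q, ← TransMonoid.mk_add_incl, map_add, hχ, zero_add]
    rfl
  -- Naturality expresses the identification of pairs along `f`; compatibility with tensor products
  -- is additivity of `χ`.
  refine ⟨⟨fun x => χ (TransMonoid.mk hv x 0), hv, fun {x y} f => ?_, fun x y => ?_⟩⟩
  · have h : TransMonoid.mk hv x (G.deg f) = TransMonoid.mk hv y (F.deg f) := TransMonoid.mk_eq_iff.2 ⟨f, add_comm _ _⟩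
    have h' := congrArg χ h
    rw [hmk, hmk y] at h'
    linear_combination (norm := abel) -h'
  · have h := congrArg χ (TransMonoid.mk_add (hv := hv) x y 0 0)
    rw [map_add, hmk (x ⊗ y)] at h
    linear_combination (norm := abel) -h

end Character

/-! ## Coherence for symmetric monoidal groupoids with trivial self-braidings -/

/-- Formal tensor products of objects. -/
inductive TensorWord (X : Type u) : Type u
  | unit : TensorWord X
  | of : X → TensorWord X
  | tensor : TensorWord X → TensorWord X → TensorWord X

namespace TensorWord

section

variable {C : Type u} [Category.{u} C] [MonoidalCategory C]

/-- The value of a formal tensor product. -/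
@[reducible] def ev : TensorWord C → C
  | unit => 𝟙_ C
  | of x => x
  | tensor w w' => ev w ⊗ ev w'

/-- The left bracketed tensor product of the reverse of a list. -/
@[reducible] def evList : List C → C
  | [] => 𝟙_ C
  | x :: l => evList l ⊗ x

/-- A morphism from `c` to the tensor product of some list. -/
structure NormalForm (c : C) : Type u where
  list : List C
  mor : c ⟶ evList list

namespace NormalForm

/-- Precomposition. -/
def pre {c c' : C} (f : c ⟶ c') (n : NormalForm c') : NormalForm c := ⟨n.list, f ≫ n.mor⟩

theorem pre_id {c : C} (n : NormalForm c) : pre (𝟙 c) n = n :=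
  congrArg (NormalForm.mk n.list) (Category.id_comp _)

theorem pre_pre {c c' c'' : C} (f : c ⟶ c') (g : c' ⟶ c'') (n : NormalForm c'') :
    pre f (pre g n) = pre (f ≫ g) n :=
  congrArg (NormalForm.mk n.list) (Category.assoc f g n.mor).symm

/-- Appending a letter at the end. -/
def snoc {c : C} (n : NormalForm c) (x : C) : NormalForm (c ⊗ x) := ⟨x :: n.list, n.mor ▷ x⟩

theorem snoc_pre {c c' : C} (f : c ⟶ c') (n : NormalForm c') (x : C) :
    snoc (pre f n) x = pre (f ▷ x) (snoc n x) :=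
  congrArg (NormalForm.mk (x :: n.list)) (comp_whiskerRight f n.mor x)

end NormalForm

end

open NormalForm

section

variable {C : Type u} [Category.{u} C] [MonoidalCategory C] [SymmetricCategory C]

/-- The interchange of the two last factors. -/
def swap (c x y : C) : (c ⊗ x) ⊗ y ⟶ (c ⊗ y) ⊗ x :=
  (α_ c x y).hom ≫ c ◁ (β_ x y).hom ≫ (α_ c y x).inv

theorem swap_swap (c x y : C) : swap c x y ≫ swap c y x = 𝟙 _ := by
  simp [swap, ← whiskerLeft_comp_assoc]

theorem swap_naturality {c c' : C} (f : c ⟶ c') (x y : C) :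
    f ▷ x ▷ y ≫ swap c' x y = swap c x y ≫ f ▷ y ▷ x := by
  simp only [swap, Category.assoc, associator_naturality_left_assoc, ← whisker_exchange_assoc,
    associator_inv_naturality_left]

/-- The Yang–Baxter equation with a spectator factor `c` on the left. -/
theorem swap_braid (c x y z : C) :
    swap (c ⊗ x) y z ≫ swap c x z ▷ y ≫ swap (c ⊗ z) x y =
      swap c x y ▷ z ≫ swap (c ⊗ y) x z ≫ swap c y z ▷ x := by
  have h := congrArg (fun f => (α_ (c ⊗ x) y z).hom ≫ (α_ c x (y ⊗ z)).hom ≫ c ◁ f ≫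
    (α_ c z (y ⊗ x)).inv ≫ (α_ (c ⊗ z) y x).inv) (BraidedCategory.yang_baxter x y z)
  refine Eq.trans ?_ (h.symm.trans ?_)
  · simp only [swap]; monoidal
  · simp only [swap]; monoidal

theorem swap_unit (c x : C) : swap c x (𝟙_ C) ≫ (ρ_ c).hom ▷ x = (ρ_ (c ⊗ x)).hom := by
  simp only [swap, braiding_tensorUnit_right, whiskerLeft_comp, Category.assoc]
  monoidal

/-- The hexagon axiom: passing `a ⊗ b` at once is passing `a`, then `b`. -/
theorem swap_tensor (c x a b : C) :
    (α_ (c ⊗ x) a b).inv ≫ swap c x a ▷ b ≫ swap (c ⊗ a) x b =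
      swap c x (a ⊗ b) ≫ (α_ c a b).inv ▷ x := by
  simp only [swap, BraidedCategory.braiding_tensor_right_hom]
  monoidal

/-- The point at which triviality of self-braidings enters the coherence argument. -/
theorem swap_self {x : C} (hβ : (β_ x x).hom = 𝟙 (x ⊗ x)) (c : C) : swap c x x = 𝟙 _ := by
  simp [swap, hβ]

end

/-! ### Normal forms by insertion, and coherence -/

section

variable {C : Type u} [Category.{u} C] [MonoidalCategory C] [SymmetricCategory C] [LinearOrder C]

/-- Insertion of a letter into a list. -/
def insertLetter : (l : List C) → (x : C) → NormalForm (evList l ⊗ x)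
  | [], x => ⟨[x], 𝟙 _⟩
  | z :: l, x => if z ≤ x then ⟨x :: z :: l, 𝟙 _⟩ else
      pre (swap (evList l) z x) (snoc (insertLetter l x) z)

/-- The action of letters on normal forms by insertion. -/
def actLetter {c : C} (n : NormalForm c) (x : C) : NormalForm (c ⊗ x) :=
  pre (n.mor ▷ x) (insertLetter n.list x)

theorem actLetter_pre {c c' : C} (f : c ⟶ c') (n : NormalForm c') (x : C) :
    actLetter (pre f n) x = pre (f ▷ x) (actLetter n x) := by
  rw [actLetter, actLetter, pre_pre, ← comp_whiskerRight]
  rfl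

theorem actLetter_nil (x : C) : actLetter (⟨[], 𝟙 _⟩ : NormalForm (𝟙_ C)) x =
    snoc ⟨[], 𝟙 _⟩ x :=
  congrArg (NormalForm.mk [x]) (Category.comp_id _)

theorem actLetter_snoc_of_le {c : C} (n : NormalForm c) {x z : C} (h : z ≤ x) :
    actLetter (snoc n z) x = snoc (snoc n z) x := by
  rw [actLetter, snoc, insertLetter, if_pos h]
  exact congrArg (NormalForm.mk (x :: z :: n.list)) (Category.comp_id _)

theorem actLetter_snoc_of_lt {c : C} (n : NormalForm c) {x z : C} (h : x < z) :
    actLetter (snoc n z) x = pre (swap c z x) (snoc (actLetter n x) z) := by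
  rw [actLetter, snoc, insertLetter, if_neg (not_le.2 h), pre_pre, swap_naturality, ← pre_pre,
    actLetter, snoc_pre]

/-- Induction on the list, which need not be sorted, comparing its last letter `z` with `x < y`. If
`z ≤ x` or `x < z ≤ y`, both orders of insertion end in the same place up to one swap. If `y < z`,
both letters move past `z`, the two paths are matched by `swap_braid`, and the induction hypothesis
handles the shorter list. -/
theorem actLetter_actLetter_of_lt {x y : C} (hxy : x < y) (l : List C) :
    actLetter (actLetter (⟨l, 𝟙 _⟩ : NormalForm (evList l)) x) y =
      pre (swap _ x y) (actLetter (actLetter ⟨l, 𝟙 _⟩ y) x) := by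
  induction l with
  | nil =>
    change actLetter (actLetter (⟨[], 𝟙 _⟩ : NormalForm (𝟙_ C)) x) y =
      pre (swap _ x y) (actLetter (actLetter (⟨[], 𝟙 _⟩ : NormalForm (𝟙_ C)) y) x)
    rw [actLetter_nil, actLetter_nil, actLetter_snoc_of_le _ hxy.le, actLetter_snoc_of_lt _ hxy,
      pre_pre, swap_swap, pre_id, actLetter_nil]
  | cons z l ih =>
    have h : (⟨z :: l, 𝟙 _⟩ : NormalForm (evList (z :: l))) =
        snoc (⟨l, 𝟙 _⟩ : NormalForm (evList l)) z :=
      congrArg (NormalForm.mk (z :: l)) (id_whiskerRight _ _).symm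
    rw [h]
    generalize (⟨l, 𝟙 _⟩ : NormalForm (evList l)) = n at ih
    change actLetter (actLetter (snoc n z) x) y =
      pre (swap (evList l ⊗ z) x y) (actLetter (actLetter (snoc n z) y) x)
    rcases le_or_gt z x with hx | hx
    · rw [actLetter_snoc_of_le _ hx, actLetter_snoc_of_le _ (hx.trans hxy.le),
        actLetter_snoc_of_le _ hxy.le, actLetter_snoc_of_lt _ hxy, pre_pre, swap_swap, pre_id,
        actLetter_snoc_of_le _ hx]
    · rw [actLetter_snoc_of_lt _ hx, actLetter_pre]
      rcases le_or_gt z y with hy | hy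
      · rw [actLetter_snoc_of_le _ hy, actLetter_snoc_of_le _ hy, actLetter_snoc_of_lt _ hxy,
          pre_pre, swap_swap, pre_id, actLetter_snoc_of_lt _ hx, snoc_pre]
      · rw [actLetter_snoc_of_lt _ hy, actLetter_snoc_of_lt _ hy, actLetter_pre,
          actLetter_snoc_of_lt _ hx, ih, snoc_pre, pre_pre, pre_pre, pre_pre, pre_pre,
          Category.assoc, Category.assoc, ← swap_braid]

/-- Distinct letters reduce to the ordered case by symmetry. Inserting the same letter twice demands
that its swap with itself be the identity, which is `hβ`. -/
theorem actLetter_actLetter (hβ : ∀ x : C, (β_ x x).hom = 𝟙 (x ⊗ x)) {c : C} (n : NormalForm c)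
    (x y : C) :
    actLetter (actLetter n x) y = pre (swap c x y) (actLetter (actLetter n y) x) := by
  have hn : n = pre n.mor ⟨n.list, 𝟙 _⟩ :=
    congrArg (NormalForm.mk n.list) (Category.comp_id n.mor).symm
  rw [hn]
  simp only [actLetter_pre, pre_pre]
  rw [← swap_naturality, ← pre_pre]
  congr 1
  rcases lt_trichotomy x y with h | rfl | h
  · exact actLetter_actLetter_of_lt h _
  · rw [swap_self (hβ x), pre_id]
  · rw [actLetter_actLetter_of_lt h, pre_pre, swap_swap, pre_id]

/-- The action of formal tensor products on normal forms. -/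
def act : (w : TensorWord C) → {c : C} → NormalForm c → NormalForm (c ⊗ ev w)
  | unit, c, n => pre (ρ_ c).hom n
  | of x, _, n => actLetter n x
  | tensor w w', c, n => pre (α_ c (ev w) (ev w')).inv (act w' (act w n))

theorem act_pre (w : TensorWord C) {c c' : C} (f : c ⟶ c') (n : NormalForm c') :
    act w (pre f n) = pre (f ▷ ev w) (act w n) := by
  induction w generalizing c c' with
  | unit =>
    simp only [act, pre_pre, ev, rightUnitor_naturality]
  | of x => exact actLetter_pre f n x
  | tensor w w' ih ih' =>
    simp only [act, ih, ih', pre_pre, ev, associator_inv_naturality_left]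

theorem act_act_comm {w w' : TensorWord C}
    (h : ∀ (c : C) (n : NormalForm c), act w' (act w n) = pre (swap c (ev w) (ev w'))
      (act w (act w' n))) (c : C) (n : NormalForm c) :
    act w (act w' n) = pre (swap c (ev w') (ev w)) (act w' (act w n)) := by
  rw [h, pre_pre, swap_swap, pre_id]

/-- Induction on `w'`: commutation past a product is commutation past its factors in turn, by the
hexagon in the form `swap_tensor`. -/
theorem act_act_of_letters {w : TensorWord C}
    (h : ∀ (x : C) (c : C) (n : NormalForm c), act (of x) (act w n) =
      pre (swap c (ev w) x) (act w (act (of x) n))) (w' : TensorWord C) (c : C)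
    (n : NormalForm c) : act w' (act w n) = pre (swap c (ev w) (ev w')) (act w (act w' n)) := by
  induction w' generalizing c with
  | unit =>
    simp only [act, act_pre, pre_pre, ev, swap_unit]
  | of x => exact h x c n
  | tensor a b iha ihb =>
    simp only [act, act_pre, pre_pre, ev, ← swap_tensor]
    rw [iha, act_pre, ihb]
    simp only [pre_pre]

/-- Two passes extend commutation from letters to words: first one argument becomes a word, then,
after exchanging the roles by symmetry, the other. -/
theorem act_act (hβ : ∀ x : C, (β_ x x).hom = 𝟙 (x ⊗ x)) (w w' : TensorWord C) (c : C)
    (n : NormalForm c) : act w' (act w n) = pre (swap c (ev w) (ev w')) (act w (act w' n)) :=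
  act_act_of_letters (fun x => act_act_comm
    (act_act_of_letters (w := of x) (fun y _ n => actLetter_actLetter hβ n x y) w)) w' c n

/-- The morphisms compatible with normal forms: those that arise from the constraints. -/
def IsCanonical (w w' : TensorWord C) (u : ev w ⟶ ev w') : Prop :=
  ∀ (c : C) (n : NormalForm c), act w n = pre (c ◁ u) (act w' n)

namespace IsCanonical

theorem id (w : TensorWord C) : IsCanonical w w (𝟙 (ev w)) := fun c n => by
  rw [MonoidalCategory.whiskerLeft_id, pre_id]

theorem comp {w w' w'' : TensorWord C} {u : ev w ⟶ ev w'} {u' : ev w' ⟶ ev w''}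
    (h : IsCanonical w w' u) (h' : IsCanonical w' w'' u') : IsCanonical w w'' (u ≫ u') :=
  fun c n => by rw [h, h', pre_pre, MonoidalCategory.whiskerLeft_comp]

theorem inv {w w' : TensorWord C} {u : ev w ⟶ ev w'} [IsIso u] (h : IsCanonical w w' u) :
    IsCanonical w' w (CategoryTheory.inv u) := fun c n => by
  rw [h, pre_pre, ← MonoidalCategory.whiskerLeft_comp, IsIso.inv_hom_id,
    MonoidalCategory.whiskerLeft_id, pre_id]

theorem tensor {w w' v v' : TensorWord C} {u : ev w ⟶ ev v} {u' : ev w' ⟶ ev v'}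
    (h : IsCanonical w v u) (h' : IsCanonical w' v' u') :
    IsCanonical (w.tensor w') (v.tensor v') (u ⊗ₘ u') := fun c n => by
  simp only [act]
  rw [h, act_pre, h', pre_pre, pre_pre, pre_pre]
  congr 1
  simp only [ev, MonoidalCategory.tensorHom_def]
  monoidal

theorem associator (w w' w'' : TensorWord C) :
    IsCanonical ((w.tensor w').tensor w'') (w.tensor (w'.tensor w''))
      (α_ (ev w) (ev w') (ev w'')).hom := fun c n => by
  simp only [act, act_pre, pre_pre]
  congr 1
  simp only [ev]
  monoidal

theorem leftUnitor (w : TensorWord C) :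
    IsCanonical (unit.tensor w) w (λ_ (ev w)).hom := fun c n => by
  simp only [act, act_pre, pre_pre]
  congr 1
  simp only [ev]
  monoidal

theorem braiding (hβ : ∀ x : C, (β_ x x).hom = 𝟙 (x ⊗ x)) (w w' : TensorWord C) :
    IsCanonical (w.tensor w') (w'.tensor w) (β_ (ev w) (ev w')).hom := fun c n => by
  simp only [act, act_act hβ w w', pre_pre]
  congr 1
  simp only [ev, swap]
  simp

/-- Strong coherence. Acting on the empty normal form gives a morphism `m` with `m = (𝟙_ ◁ u) ≫ m`,
and `m` is invertible. Consequently there is at most one canonical morphism between two words. -/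
theorem eq_id [IsGroupoid C] {w : TensorWord C} {u : ev w ⟶ ev w} (h : IsCanonical w w u) :
    u = 𝟙 (ev w) := by
  have h' := h (𝟙_ C) ⟨[], 𝟙 _⟩
  generalize act w (⟨[], 𝟙 _⟩ : NormalForm (𝟙_ C)) = n at h'
  obtain ⟨l, m⟩ := n
  have h₁ : m = (𝟙_ C ◁ u) ≫ m := by
    have := (NormalForm.mk.injEq _ _ _ _).mp h'
    exact eq_of_heq this.2
  have h₂ : 𝟙_ C ◁ u = 𝟙 _ := by
    rw [← cancel_mono m, ← h₁, Category.id_comp]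
  rw [MonoidalCategory.id_whiskerLeft] at h₂
  rw [← cancel_epi (λ_ (ev w)).hom, ← cancel_mono (λ_ (ev w)).inv, Category.assoc, h₂]
  simp

end IsCanonical

end

end TensorWord

/-! ## The commutative monoid of morphisms between formal tensor products -/

namespace TensorWord

variable {C : Type u} [Category.{u} C] [MonoidalCategory C] [SymmetricCategory C] [LinearOrder C]
  [IsGroupoid C]

variable (C) in
/-- A morphism between the values of two formal tensor products. -/
structure Arrow : Type u where
  src : TensorWord C
  tgt : TensorWord C
  mor : ev src ⟶ ev tgt

variable (C) in
/-- Two morphisms are equivalent if they differ by canonical isomorphisms. -/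
def arrowSetoid : Setoid (Arrow C) where
  r p q := ∃ (i : ev p.src ⟶ ev q.src) (j : ev p.tgt ⟶ ev q.tgt),
    IsCanonical _ _ i ∧ IsCanonical _ _ j ∧ p.mor ≫ j = i ≫ q.mor
  iseqv :=
    { refl := fun p => ⟨𝟙 _, 𝟙 _, .id _, .id _, by simp⟩
      symm := by
        rintro p q ⟨i, j, hi, hj, h⟩
        exact ⟨inv i, inv j, hi.inv, hj.inv, by
          rw [IsIso.eq_inv_comp, ← Category.assoc, ← h, Category.assoc, IsIso.hom_inv_id,
            Category.comp_id]⟩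
      trans := by
        rintro p q r ⟨i, j, hi, hj, h⟩ ⟨i', j', hi', hj', h'⟩
        exact ⟨i ≫ i', j ≫ j', hi.comp hi', hj.comp hj', by
          rw [reassoc_of% h, h', Category.assoc]⟩ }

/-- Classes of morphisms between formal tensor products. -/
def ArrowMonoid (_ : ∀ x : C, (β_ x x).hom = 𝟙 (x ⊗ x)) : Type u := Quotient (arrowSetoid C)

namespace ArrowMonoid

variable {hβ : ∀ x : C, (β_ x x).hom = 𝟙 (x ⊗ x)}

variable (hβ) in
/-- The class of a morphism. -/
def mk (w w' : TensorWord C) (f : ev w ⟶ ev w') : ArrowMonoid hβ :=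
  Quotient.mk (arrowSetoid C) ⟨w, w', f⟩

theorem mk_surj (p : ArrowMonoid hβ) : ∃ w w' f, mk hβ w w' f = p := by
  obtain ⟨⟨w, w', f⟩, rfl⟩ := Quotient.exists_rep p
  exact ⟨w, w', f, rfl⟩

theorem mk_eq_iff {w w' v v' : TensorWord C} {f : ev w ⟶ ev w'} {g : ev v ⟶ ev v'} :
    mk hβ w w' f = mk hβ v v' g ↔ ∃ (i : ev w ⟶ ev v) (j : ev w' ⟶ ev v'),
      IsCanonical w v i ∧ IsCanonical w' v' j ∧ f ≫ j = i ≫ g :=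
  ⟨fun h => Quotient.exact h, fun h => Quotient.sound (s := arrowSetoid C) h⟩

instance : Add (ArrowMonoid hβ) where
  add := Quotient.map₂ (sa := arrowSetoid C) (sb := arrowSetoid C) (sc := arrowSetoid C)
    (fun p q => ⟨p.src.tensor q.src, p.tgt.tensor q.tgt, p.mor ⊗ₘ q.mor⟩) <| by
      rintro p p' ⟨i, j, hi, hj, h⟩ q q' ⟨i', j', hi', hj', h'⟩
      refine ⟨i ⊗ₘ i', j ⊗ₘ j', hi.tensor hi', hj.tensor hj', ?_⟩
      simp only [ev, MonoidalCategory.tensorHom_comp_tensorHom, h, h']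

theorem mk_add (w w' v v' : TensorWord C) (f : ev w ⟶ ev w') (g : ev v ⟶ ev v') :
    mk hβ w w' f + mk hβ v v' g = mk hβ (w.tensor v) (w'.tensor v') (f ⊗ₘ g) := rfl

instance : Zero (ArrowMonoid hβ) := ⟨mk hβ unit unit (𝟙 _)⟩

theorem zero_def : (0 : ArrowMonoid hβ) = mk hβ unit unit (𝟙 _) := rfl

theorem add_comm' (a b : ArrowMonoid hβ) : a + b = b + a := by
  obtain ⟨w, w', f, rfl⟩ := mk_surj a
  obtain ⟨v, v', g, rfl⟩ := mk_surj b
  rw [mk_add, mk_add, mk_eq_iff]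
  exact ⟨_, _, .braiding hβ _ _, .braiding hβ _ _, BraidedCategory.braiding_naturality _ _⟩

theorem zero_add' (a : ArrowMonoid hβ) : 0 + a = a := by
  obtain ⟨w, w', f, rfl⟩ := mk_surj a
  rw [zero_def, mk_add, mk_eq_iff]
  exact ⟨_, _, .leftUnitor _, .leftUnitor _, by simp [ev]⟩

instance : AddCommMonoid (ArrowMonoid hβ) where
  add_assoc a b c := by
    obtain ⟨w, w', f, rfl⟩ := mk_surj a
    obtain ⟨v, v', g, rfl⟩ := mk_surj b
    obtain ⟨z, z', h, rfl⟩ := mk_surj c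
    simp only [mk_add]
    rw [mk_eq_iff]
    exact ⟨_, _, .associator _ _ _, .associator _ _ _, associator_naturality _ _ _⟩
  zero_add := zero_add'
  add_zero a := by rw [add_comm', zero_add']
  add_comm := add_comm'
  nsmul := nsmulRec

/-- Composition becomes addition: `(f ≫ g) ⊗ 𝟙` and `f ⊗ g` differ by a braiding once `f` is slid
across the self-braiding of `ev w'`, which is trivial. -/
theorem mk_comp_add_id {w w' w'' : TensorWord C} (f : ev w ⟶ ev w') (g : ev w' ⟶ ev w'') :
    mk hβ w w'' (f ≫ g) + mk hβ w' w' (𝟙 _) = mk hβ w w' f + mk hβ w' w'' g := by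
  rw [mk_add, mk_add, mk_eq_iff]
  refine ⟨𝟙 _, (β_ _ _).hom, .id _, .braiding hβ _ _, ?_⟩
  have h := BraidedCategory.braiding_naturality_left f (ev w')
  rw [hβ, Category.comp_id] at h
  rw [BraidedCategory.braiding_naturality, Category.id_comp, id_tensorHom,
    MonoidalCategory.whiskerLeft_comp, ← reassoc_of% h, MonoidalCategory.tensorHom_def]

theorem mk_congr {w w' v v' : TensorWord C} {f : ev w ⟶ ev w'} {g : ev v ⟶ ev v'}
    {i : ev w ⟶ ev v} {j : ev w' ⟶ ev v'} (hi : IsCanonical w v i) (hj : IsCanonical w' v' j)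
    (h : f ≫ j = i ≫ g) : mk hβ w w' f = mk hβ v v' g :=
  mk_eq_iff.2 ⟨i, j, hi, hj, h⟩

end ArrowMonoid

end TensorWord

/-! ### Characters when all self-braidings are trivial -/

namespace Character

open TensorWord

/-- If all self-braidings are trivial, every homomorphism from the automorphism group of the
neutral object to a divisible group extends to all morphisms between formal tensor products. -/
theorem _root_.TensorWord.exists_degree {Q : Type u} [AddCommGroup Q] (hQ : IsDivisibleGroup Q)
    (T : SCGr.{u}) [LinearOrder T] (hβ : ∀ x : T, (β_ x x).hom = 𝟙 (x ⊗ x))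
    (ψ : SCGr.Pi1 T →+ Q) :
    ∃ D : ∀ w w' : TensorWord T, (ev w ⟶ ev w') → Q,
      (∀ w w' w'' (f : ev w ⟶ ev w') (g : ev w' ⟶ ev w''),
        D w w'' (f ≫ g) = D w w' f + D w' w'' g) ∧
      (∀ w w' v v' (f : ev w ⟶ ev w') (g : ev v ⟶ ev v'),
        D (w.tensor v) (w'.tensor v') (f ⊗ₘ g) = D w w' f + D v v' g) ∧
      (∀ w w' (f : ev w ⟶ ev w'), IsCanonical w w' f → D w w' f = 0) ∧
      ∀ a : 𝟙_ T ⟶ 𝟙_ T, D unit unit a = ψ (SCGr.toPi1 a) := by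
  let ι : SCGr.Pi1 T →+ ArrowMonoid hβ :=
    { toFun := fun a => ArrowMonoid.mk hβ unit unit (SCGr.toPi1.symm a)
      map_zero' := rfl
      map_add' := fun a b => by
        rw [ArrowMonoid.mk_add]
        refine (ArrowMonoid.mk_congr (.leftUnitor _) (.leftUnitor _) ?_).symm
        change _ = (λ_ (𝟙_ T)).hom ≫ (SCGr.toPi1.symm a ≫ SCGr.toPi1.symm b)
        rw [MonoidalCategory.tensorHom_def, Category.assoc, leftUnitor_naturality, unitors_equal,
          rightUnitor_naturality_assoc] }
  have hι : ∀ k a b, k + ι a = k + ι b → a = b := by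
    intro k a b h
    obtain ⟨w, w', f, rfl⟩ := ArrowMonoid.mk_surj k
    obtain ⟨i, j, hi, hj, h⟩ := ArrowMonoid.mk_eq_iff.1 h
    -- Both morphisms have the same source and target words, so the canonical isomorphisms relating
    -- them are identities; what remains is that tensoring with `f` is injective.
    rw [hi.eq_id, hj.eq_id, Category.id_comp, Category.comp_id] at h
    change f ⊗ₘ SCGr.toPi1.symm a = f ⊗ₘ SCGr.toPi1.symm b at h
    rw [MonoidalCategory.tensorHom_def, MonoidalCategory.tensorHom_def, cancel_epi] at h
    have := T.isEquivalence_tensorLeft (ev w')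
    exact SCGr.toPi1.symm.injective ((tensorLeft (ev w')).map_injective h)
  obtain ⟨χ, hχ⟩ := hQ.exists_extension_of_monoid ι hι ψ
  -- Subtracting the value at the identity of the source gives identities degree zero; by
  -- `mk_comp_add_id` the result is additive under composition.
  refine ⟨fun w w' f => χ (.mk hβ w w' f) - χ (.mk hβ w w (𝟙 _)), ?_, ?_, ?_, ?_⟩
  · intro w w' w'' f g
    have h := congrArg χ (ArrowMonoid.mk_comp_add_id (hβ := hβ) f g)
    rw [map_add, map_add] at h
    beta_reduce
    linear_combination (norm := abel) h
  · intro w w' v v' f g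
    have h₁ := congrArg χ (ArrowMonoid.mk_add (hβ := hβ) _ _ _ _ f g)
    have h₂ := congrArg χ (ArrowMonoid.mk_add (hβ := hβ) _ _ _ _ (𝟙 (ev w)) (𝟙 (ev v)))
    rw [id_tensorHom_id] at h₂
    rw [map_add] at h₁ h₂
    beta_reduce
    linear_combination (norm := abel) h₂ - h₁
  · intro w w' f hf
    have h : ArrowMonoid.mk hβ w w' f = ArrowMonoid.mk hβ w w (𝟙 _) :=
      ArrowMonoid.mk_congr (.id _) hf.inv (by simp)
    rw [sub_eq_zero, h]
  · intro a
    refine (sub_eq_self.2 ?_).trans (hχ (SCGr.toPi1 a))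
    exact map_zero χ

/-- If all self-braidings are trivial, every homomorphism from the automorphism group of the
neutral object to a divisible group is induced by a character. -/
theorem exists_of_braiding_self {A Q : Type u} [AddCommGroup A] [AddCommGroup Q]
    (hQ : IsDivisibleGroup Q) (φ : BraidingForm A Q)
    (T : SCGr.{u}) (hβ : ∀ x : T, (β_ x x).hom = 𝟙 (x ⊗ x)) (ψ : SCGr.Pi1 T →+ Q) :
    ∃ F : Character T φ, (∀ x, F.val x = 0) ∧ ∀ a : 𝟙_ T ⟶ 𝟙_ T, F.deg a = ψ (SCGr.toPi1 a) := by
  -- An arbitrary order, needed only to define normal forms.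
  let _ : LinearOrder T := IsWellOrder.linearOrder WellOrderingRel
  obtain ⟨D, hcomp, htensor, hcan, hψ⟩ := TensorWord.exists_degree hQ T hβ ψ
  have hid : ∀ w, D w w (𝟙 _) = 0 := fun w => hcan w w _ (.id w)
  refine ⟨
    { val := fun _ => 0
      deg := fun {x y} f => D (of x) (of y) f
      -- The identity of `x ⊗ y`, read from a formal product of two letters to the single letter `x
      -- ⊗ y`; it need not be canonical, so its degree may be nonzero. Each axiom below compares
      -- factorisations of one morphism through different words.
      m := fun x y => D ((of x).tensor (of y)) (of (x ⊗ y)) (𝟙 (x ⊗ y))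
      val_eq := fun _ => rfl
      val_tensor := fun _ _ => (add_zero 0).symm
      deg_comp := fun {x y z} f g => hcomp (of x) (of y) (of z) f g
      m_left := ?_
      m_right := ?_
      m_assoc := ?_
      m_symm := ?_ }, fun _ => rfl, ?_⟩
  · intro x y f z
    have h₁ := hcomp ((of x).tensor (of z)) (of (x ⊗ z)) (of (y ⊗ z)) (𝟙 (x ⊗ z)) (f ▷ z)
    have h₂ := hcomp ((of x).tensor (of z)) ((of y).tensor (of z)) (of (y ⊗ z)) (f ▷ z)
      (𝟙 (y ⊗ z))
    have h₃ := htensor (of x) (of y) (of z) (of z) f (𝟙 z)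
    rw [Category.id_comp] at h₁
    rw [Category.comp_id] at h₂
    rw [tensorHom_id, hid, add_zero] at h₃
    rw [← h₁, h₂, h₃]
  · intro z x y f
    have h₁ := hcomp ((of z).tensor (of x)) (of (z ⊗ x)) (of (z ⊗ y)) (𝟙 (z ⊗ x)) (z ◁ f)
    have h₂ := hcomp ((of z).tensor (of x)) ((of z).tensor (of y)) (of (z ⊗ y)) (z ◁ f)
      (𝟙 (z ⊗ y))
    have h₃ := htensor (of z) (of z) (of x) (of y) (𝟙 z) f
    rw [Category.id_comp] at h₁
    rw [Category.comp_id] at h₂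
    rw [id_tensorHom, hid, zero_add] at h₃
    rw [← h₁, h₂, h₃]
  · intro x y z
    have h₁ := htensor ((of x).tensor (of y)) (of (x ⊗ y)) (of z) (of z) (𝟙 (x ⊗ y)) (𝟙 z)
    have h₂ := htensor (of x) (of x) ((of y).tensor (of z)) (of (y ⊗ z)) (𝟙 x) (𝟙 (y ⊗ z))
    have h₃ := hcan _ _ _ (.associator (of x) (of y) (of z))
    have h₄ := hcomp (((of x).tensor (of y)).tensor (of z)) ((of (x ⊗ y)).tensor (of z))
      (of ((x ⊗ y) ⊗ z)) (𝟙 ((x ⊗ y) ⊗ z)) (𝟙 ((x ⊗ y) ⊗ z))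
    have h₅ := hcomp (((of x).tensor (of y)).tensor (of z)) (of ((x ⊗ y) ⊗ z))
      (of (x ⊗ y ⊗ z)) (𝟙 ((x ⊗ y) ⊗ z)) (α_ x y z).hom
    have h₆ := hcomp ((of x).tensor ((of y).tensor (of z))) ((of x).tensor (of (y ⊗ z)))
      (of (x ⊗ y ⊗ z)) (𝟙 (x ⊗ y ⊗ z)) (𝟙 (x ⊗ y ⊗ z))
    have h₇ := hcomp (((of x).tensor (of y)).tensor (of z)) ((of x).tensor ((of y).tensor (of z)))
      (of (x ⊗ y ⊗ z)) (α_ x y z).hom (𝟙 (x ⊗ y ⊗ z))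
    rw [hid, id_tensorHom_id] at h₁ h₂
    rw [Category.comp_id] at h₄ h₆ h₇
    rw [Category.id_comp] at h₅
    linear_combination (norm := abel) -h₁ + h₂ + h₃ - h₄ - h₅ + h₆ + h₇
  · intro x y
    have h₁ := hcomp ((of x).tensor (of y)) (of (x ⊗ y)) (of (y ⊗ x)) (𝟙 (x ⊗ y)) (β_ x y).hom
    have h₂ := hcomp ((of x).tensor (of y)) ((of y).tensor (of x)) (of (y ⊗ x)) (β_ x y).hom
      (𝟙 (y ⊗ x))
    have h₃ := hcan _ _ _ (.braiding hβ (of x) (of y))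
    rw [Category.id_comp] at h₁
    rw [Category.comp_id] at h₂
    rw [map_zero, zero_add]
    linear_combination (norm := abel) -h₁ + h₂ + h₃
  -- `D` is prescribed on the empty word, while `deg` uses the one-letter word `of (𝟙_ T)`; the
  -- degree of the identity between them cancels.
  · intro a
    have h₁ := hcomp unit (of (𝟙_ T)) (of (𝟙_ T)) (𝟙 (𝟙_ T)) a
    have h₂ := hcomp unit unit (of (𝟙_ T)) a (𝟙 (𝟙_ T))
    rw [Category.id_comp] at h₁
    rw [Category.comp_id, hψ] at h₂
    linear_combination (norm := abel) -h₁ + h₂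

end Character

/-! ## Pushing out along homomorphisms of automorphism groups -/

section

variable {A B : Type u} [AddCommGroup A] [AddCommGroup B]

/-- A homomorphism `ψ` from the automorphism group of the neutral object, and an additive map on
objects for which `φ` computes the values of `ψ` on self-braidings. -/
structure Twist (S : SCGr.{u}) (φ : BraidingForm A B) where
  ψ : SCGr.Pi1 S →+ B
  val : S → A
  val_eq : ∀ {x y : S}, (x ⟶ y) → val x = val y
  val_tensor : ∀ x y : S, val (x ⊗ y) = val x + val y
  diag : ∀ x : S, φ.c (val x) (val x) = ψ (SCGr.toPi1 (SCGr.sgn x))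

variable {S : SCGr.{u}} {φ : BraidingForm A B}

/-- The objects of the pushout of `S` along `ψ`, with braiding twisted by `φ`. -/
structure Pushout (D : Twist S φ) where
  val : S

namespace Pushout

variable {D : Twist S φ}

/-- A pair of a morphism and an element of `B`, up to the action of automorphisms of `𝟙_`. -/
def homSetoid (D : Twist S φ) (x y : S) : Setoid ((x ⟶ y) × B) where
  r p q := ∃ a : 𝟙_ S ⟶ 𝟙_ S, q.1 = p.1 ≫ SCGr.translate y a ∧ p.2 = q.2 + D.ψ (SCGr.toPi1 a)
  iseqv :=
    { refl := fun p => ⟨𝟙 _, by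
        rw [SCGr.translate_id, SCGr.toPi1_id, map_zero]
        simp⟩
      symm := by
        rintro ⟨f, q⟩ ⟨g, r⟩ ⟨a, h, h'⟩
        dsimp only at h h'
        refine ⟨inv a, ?_, ?_⟩
        · dsimp only
          rw [h, Category.assoc, ← SCGr.translate_comp, IsIso.hom_inv_id, SCGr.translate_id,
            Category.comp_id]
        · dsimp only
          rw [h', add_assoc, ← map_add, ← SCGr.toPi1_comp, IsIso.hom_inv_id, SCGr.toPi1_id,
            map_zero, add_zero]
      trans := by
        rintro ⟨f, q⟩ ⟨g, r⟩ ⟨h, s⟩ ⟨a, h₁, h₂⟩ ⟨b, h₃, h₄⟩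
        dsimp only at h₁ h₂ h₃ h₄
        refine ⟨a ≫ b, ?_, ?_⟩
        · dsimp only
          rw [h₃, h₁, SCGr.translate_comp, Category.assoc]
        · dsimp only
          rw [h₂, h₄, SCGr.toPi1_comp, map_add]
          abel }

/-- The morphisms of the pushout. -/
def Mor (x y : Pushout D) : Type u := Quotient (homSetoid D x.val y.val)

/-- The class of a pair. -/
def Mor.mk {x y : Pushout D} (f : x.val ⟶ y.val) (q : B) : Mor x y :=
  Quotient.mk (homSetoid D x.val y.val) (f, q)

theorem translate_comp_translate {x y z : S} (f : x ⟶ y) (g : y ⟶ z) (a b : 𝟙_ S ⟶ 𝟙_ S) :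
    (f ≫ SCGr.translate y a) ≫ g ≫ SCGr.translate z b =
      (f ≫ g) ≫ SCGr.translate z (a ≫ b) := by
  rw [Category.assoc, Category.assoc, SCGr.translate_comp, ← SCGr.translate_naturality_assoc]

instance : Category (Pushout D) where
  Hom := Mor
  id x := .mk (𝟙 _) 0
  comp {x y z} := Quotient.map₂ (sa := homSetoid D x.val y.val) (sb := homSetoid D y.val z.val)
    (sc := homSetoid D x.val z.val) (fun p q => (p.1 ≫ q.1, p.2 + q.2)) <| by
      rintro ⟨f, q⟩ ⟨f', q'⟩ ⟨a, h₁, h₂⟩ ⟨g, r⟩ ⟨g', r'⟩ ⟨b, h₃, h₄⟩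
      dsimp only at h₁ h₂ h₃ h₄
      refine ⟨a ≫ b, ?_, ?_⟩
      · dsimp only
        rw [h₁, h₃, translate_comp_translate]
      · dsimp only
        rw [h₂, h₄, SCGr.toPi1_comp, map_add]
        abel
  id_comp := by
    rintro x y ⟨f, q⟩
    exact congrArg₂ Mor.mk (Category.id_comp f) (zero_add q)
  comp_id := by
    rintro x y ⟨f, q⟩
    exact congrArg₂ Mor.mk (Category.comp_id f) (add_zero q)
  assoc := by
    rintro x y z w ⟨f, q⟩ ⟨g, r⟩ ⟨h, s⟩
    exact congrArg₂ Mor.mk (Category.assoc f g h) (add_assoc q r s)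

/-- The morphism given by a pair. -/
def hom {x y : Pushout D} (f : x.val ⟶ y.val) (q : B) : x ⟶ y := Mor.mk f q

theorem hom_surj {x y : Pushout D} (f : x ⟶ y) : ∃ g q, hom g q = f := by
  obtain ⟨⟨g, q⟩, rfl⟩ := Quotient.exists_rep f
  exact ⟨g, q, rfl⟩

theorem hom_eq_iff {x y : Pushout D} {f g : x.val ⟶ y.val} {q r : B} :
    (hom f q : x ⟶ y) = hom g r ↔
      ∃ a : 𝟙_ S ⟶ 𝟙_ S, g = f ≫ SCGr.translate y.val a ∧ q = r + D.ψ (SCGr.toPi1 a) :=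
  ⟨fun h => Quotient.exact h, fun h => Quotient.sound (s := homSetoid D x.val y.val) h⟩

theorem id_eq (x : Pushout D) : 𝟙 x = hom (𝟙 x.val) 0 := rfl

theorem hom_comp {x y z : Pushout D} (f : x.val ⟶ y.val) (g : y.val ⟶ z.val) (q r : B) :
    (hom f q : x ⟶ y) ≫ (hom g r : y ⟶ z) = hom (f ≫ g) (q + r) := rfl

/-- The isomorphism given by an isomorphism and an element of `B`. -/
def iso {x y : Pushout D} (e : x.val ≅ y.val) (q : B) : x ≅ y where
  hom := hom e.hom q
  inv := hom e.inv (-q)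
  hom_inv_id := by rw [hom_comp, e.hom_inv_id, add_neg_cancel, id_eq]
  inv_hom_id := by rw [hom_comp, e.inv_hom_id, neg_add_cancel, id_eq]

instance : IsGroupoid (Pushout D) where
  all_isIso {x y} f := by
    obtain ⟨g, q, rfl⟩ := hom_surj f
    exact (iso (asIso g) q).isIso_hom

instance : MonoidalCategoryStruct (Pushout D) where
  tensorObj x y := ⟨x.val ⊗ y.val⟩
  whiskerLeft x y z := Quotient.map (sa := homSetoid D y.val z.val)
    (sb := homSetoid D (x.val ⊗ y.val) (x.val ⊗ z.val)) (fun p => (x.val ◁ p.1, p.2)) <| by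
      rintro ⟨f, q⟩ ⟨g, r⟩ ⟨a, h₁, h₂⟩
      dsimp only at h₁ h₂
      refine ⟨a, ?_, h₂⟩
      dsimp only
      rw [h₁, MonoidalCategory.whiskerLeft_comp, SCGr.translate_tensor_right]
  whiskerRight {y z} f x := Quotient.map (sa := homSetoid D y.val z.val)
    (sb := homSetoid D (y.val ⊗ x.val) (z.val ⊗ x.val)) (fun p => (p.1 ▷ x.val, p.2)) (by
      rintro ⟨f, q⟩ ⟨g, r⟩ ⟨a, h₁, h₂⟩
      dsimp only at h₁ h₂
      refine ⟨a, ?_, h₂⟩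
      dsimp only
      rw [h₁, comp_whiskerRight, SCGr.translate_tensor_left]) f
  tensorUnit := ⟨𝟙_ S⟩
  associator x y z := iso (α_ x.val y.val z.val) 0
  leftUnitor x := iso (λ_ x.val) 0
  rightUnitor x := iso (ρ_ x.val) 0

theorem val_tensor (x y : Pushout D) : (x ⊗ y).val = x.val ⊗ y.val := rfl

theorem val_unit : (𝟙_ (Pushout D)).val = 𝟙_ S := rfl

theorem whiskerLeft_hom (x : Pushout D) {y z : Pushout D} (f : y.val ⟶ z.val) (q : B) :
    x ◁ (hom f q : y ⟶ z) = hom (x.val ◁ f) q := rfl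

theorem hom_whiskerRight (x : Pushout D) {y z : Pushout D} (f : y.val ⟶ z.val) (q : B) :
    (hom f q : y ⟶ z) ▷ x = hom (f ▷ x.val) q := rfl

theorem tensorHom_hom {x y x' y' : Pushout D} (f : x.val ⟶ y.val) (q : B) (f' : x'.val ⟶ y'.val)
    (q' : B) : (hom f q : x ⟶ y) ⊗ₘ (hom f' q' : x' ⟶ y') = hom (f ⊗ₘ f') (q + q') := by
  rw [MonoidalCategory.tensorHom_def]
  rfl

theorem associator_hom (x y z : Pushout D) : (α_ x y z).hom = hom (α_ x.val y.val z.val).hom 0 := rfl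

theorem associator_inv (x y z : Pushout D) :
    (α_ x y z).inv = hom (α_ x.val y.val z.val).inv 0 := congrArg (hom _) neg_zero

theorem leftUnitor_hom (x : Pushout D) : (λ_ x).hom = hom (λ_ x.val).hom 0 := rfl

theorem rightUnitor_hom (x : Pushout D) : (ρ_ x).hom = hom (ρ_ x.val).hom 0 := rfl

theorem rightUnitor_inv (x : Pushout D) : (ρ_ x).inv = hom (ρ_ x.val).inv 0 :=
  congrArg (hom _) neg_zero

instance : MonoidalCategory (Pushout D) where
  tensorHom_def _ _ := rfl
  id_tensorHom_id x y := by
    simp only [id_eq, tensorHom_hom, id_tensorHom_id, add_zero, val_tensor]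
  tensorHom_comp_tensorHom f f' g g' := by
    obtain ⟨f, p, rfl⟩ := hom_surj f
    obtain ⟨f', p', rfl⟩ := hom_surj f'
    obtain ⟨g, q, rfl⟩ := hom_surj g
    obtain ⟨g', q', rfl⟩ := hom_surj g'
    simp only [tensorHom_hom, hom_comp, MonoidalCategory.tensorHom_comp_tensorHom]
    exact congrArg (hom _) (add_add_add_comm _ _ _ _)
  whiskerLeft_id x y := by
    simp only [id_eq, whiskerLeft_hom, MonoidalCategory.whiskerLeft_id, val_tensor]
  id_whiskerRight x y := by
    simp only [id_eq, hom_whiskerRight, MonoidalCategory.id_whiskerRight, val_tensor]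
  associator_naturality f g h := by
    obtain ⟨f, p, rfl⟩ := hom_surj f
    obtain ⟨g, q, rfl⟩ := hom_surj g
    obtain ⟨h, r, rfl⟩ := hom_surj h
    simp only [tensorHom_hom, hom_comp, associator_hom, val_tensor, add_zero, zero_add, add_assoc]
    exact congrArg (hom · _) (associator_naturality f g h)
  leftUnitor_naturality f := by
    obtain ⟨f, p, rfl⟩ := hom_surj f
    simp only [whiskerLeft_hom, hom_comp, leftUnitor_hom, add_zero, zero_add]
    exact congrArg (hom · _) (leftUnitor_naturality f)
  rightUnitor_naturality f := by
    obtain ⟨f, p, rfl⟩ := hom_surj f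
    simp only [hom_whiskerRight, hom_comp, rightUnitor_hom, add_zero, zero_add]
    exact congrArg (hom · _) (rightUnitor_naturality f)
  pentagon x y z w := by
    simp only [associator_hom, hom_whiskerRight, whiskerLeft_hom, hom_comp, add_zero]
    exact congrArg (hom · _) (MonoidalCategory.pentagon x.val y.val z.val w.val)
  triangle x y := by
    simp only [associator_hom, hom_whiskerRight, whiskerLeft_hom, hom_comp, add_zero,
      leftUnitor_hom, rightUnitor_hom]
    exact congrArg (hom · _) (MonoidalCategory.triangle x.val y.val)

/-- The commutativity constraint is twisted by `φ`. -/
instance : BraidedCategory (Pushout D) where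
  braiding x y := iso (β_ x.val y.val) (-φ.c (D.val x.val) (D.val y.val))
  braiding_naturality_right x y z f := by
    obtain ⟨f, p, rfl⟩ := hom_surj f
    refine congrArg₂ hom (BraidedCategory.braiding_naturality_right x.val f) ?_
    rw [D.val_eq f, add_comm]
  braiding_naturality_left f z := by
    obtain ⟨f, p, rfl⟩ := hom_surj f
    refine congrArg₂ hom (BraidedCategory.braiding_naturality_left f z.val) ?_
    rw [D.val_eq f, add_comm]
  hexagon_forward x y z := by
    refine congrArg₂ hom (BraidedCategory.hexagon_forward x.val y.val z.val) ?_
    change 0 + (-φ.c (D.val x.val) (D.val (y.val ⊗ z.val)) + 0) = -φ.c (D.val x.val) (D.val y.val) +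
      (0 + -φ.c (D.val x.val) (D.val z.val))
    rw [D.val_tensor, map_add]
    abel
  hexagon_reverse x y z := by
    rw [associator_inv, associator_inv, associator_inv]
    refine congrArg₂ hom (BraidedCategory.hexagon_reverse x.val y.val z.val) ?_
    change 0 + (-φ.c (D.val (x.val ⊗ y.val)) (D.val z.val) + 0) = -φ.c (D.val y.val) (D.val z.val) +
      (0 + -φ.c (D.val x.val) (D.val z.val))
    rw [D.val_tensor, map_add, AddMonoidHom.add_apply]
    abel

theorem braiding_hom (x y : Pushout D) :
    (β_ x y).hom = hom (β_ x.val y.val).hom (-φ.c (D.val x.val) (D.val y.val)) := rfl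

instance : SymmetricCategory (Pushout D) where
  symmetry x y := by
    rw [braiding_hom, braiding_hom, hom_comp, SymmetricCategory.symmetry, ← neg_add, φ.symm,
      neg_zero]
    rfl

theorem isEquivalence_tensorLeft (x : Pushout D) : (tensorLeft x).IsEquivalence where
  faithful := ⟨fun {y z f g} h => by
    obtain ⟨f, q, rfl⟩ := hom_surj f
    obtain ⟨g, r, rfl⟩ := hom_surj g
    obtain ⟨a, h₁, h₂⟩ := hom_eq_iff.1 h
    refine hom_eq_iff.2 ⟨a, ?_, h₂⟩
    have := S.isEquivalence_tensorLeft x.val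
    apply (tensorLeft x.val).map_injective
    change x.val ◁ g = x.val ◁ (f ≫ _)
    rw [MonoidalCategory.whiskerLeft_comp, ← SCGr.translate_tensor_right]
    exact h₁⟩
  full := ⟨fun {y z} f => by
    obtain ⟨f, q, rfl⟩ := hom_surj f
    have := S.isEquivalence_tensorLeft x.val
    obtain ⟨g, hg⟩ := (tensorLeft x.val).map_surjective f
    exact ⟨hom g q, congrArg (hom · q) hg⟩⟩
  essSurj := ⟨fun y => by
    have := S.isEquivalence_tensorLeft x.val
    exact ⟨⟨(tensorLeft x.val).objPreimage y.val⟩,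
      ⟨iso ((tensorLeft x.val).objObjPreimageIso y.val) 0⟩⟩⟩

variable (D) in
/-- The pushout as a symmetric categorical group. -/
abbrev toSCGr : SCGr.{u} where
  carrier := Pushout D
  isEquivalence_tensorLeft := isEquivalence_tensorLeft

/-- The purpose of the twist. The self-braiding in `S` is the translate of `sgn x`, which the
pushout identifies with the element `ψ (sgn x)` of `B`; the twist subtracts exactly this. -/
theorem braiding_self (x : Pushout D) : (β_ x x).hom = 𝟙 (x ⊗ x) := by
  rw [braiding_hom, id_eq, eq_comm, hom_eq_iff]
  refine ⟨SCGr.sgn x.val, ?_, ?_⟩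
  · exact (SCGr.translate_sgn x.val).symm.trans (Category.id_comp _).symm
  · rw [← D.diag, neg_add_cancel]

theorem translate_hom (x : Pushout D) (a : 𝟙_ S ⟶ 𝟙_ S) (q : B) :
    SCGr.translate (S := toSCGr D) x (hom a q : 𝟙_ (Pushout D) ⟶ 𝟙_ (Pushout D)) =
      hom (SCGr.translate x.val a) q := by
  change (ρ_ x).inv ≫ x ◁ (hom a q : 𝟙_ (Pushout D) ⟶ 𝟙_ (Pushout D)) ≫ (ρ_ x).hom = _
  rw [rightUnitor_inv, rightUnitor_hom, whiskerLeft_hom, hom_comp, hom_comp, zero_add, add_zero]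
  rfl

variable (D) in
/-- The homomorphism induced by `ψ` on automorphisms of the neutral object of the pushout. -/
noncomputable def degUnit : (𝟙_ (Pushout D) ⟶ 𝟙_ (Pushout D)) → B :=
  Quotient.lift (s := homSetoid D (𝟙_ S) (𝟙_ S)) (fun p => D.ψ (SCGr.toPi1 p.1) + p.2) <| by
    rintro ⟨f, q⟩ ⟨g, r⟩ ⟨a, h₁, h₂⟩
    dsimp only at h₁ h₂ ⊢
    rw [h₁, h₂, SCGr.translate_unit, SCGr.toPi1_comp, map_add]
    abel

theorem degUnit_hom (a : 𝟙_ S ⟶ 𝟙_ S) (q : B) :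
    degUnit D (hom a q) = D.ψ (SCGr.toPi1 a) + q := rfl

variable (D) in
/-- The homomorphism induced by `ψ` on automorphisms of the neutral object of the pushout. -/
noncomputable def pi1Hom : SCGr.Pi1 (toSCGr D) →+ B :=
  AddMonoidHom.mk' (fun a => degUnit D (SCGr.toPi1.symm a)) fun a b => by
    obtain ⟨f, q, hf⟩ := hom_surj (D := D) (SCGr.toPi1.symm a)
    obtain ⟨g, r, hg⟩ := hom_surj (D := D) (SCGr.toPi1.symm b)
    change degUnit D (SCGr.toPi1.symm a ≫ SCGr.toPi1.symm b) = _
    rw [← hf, ← hg]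
    change D.ψ (SCGr.toPi1 (f ≫ g)) + (q + r) = D.ψ (SCGr.toPi1 f) + q + (D.ψ (SCGr.toPi1 g) + r)
    have h : SCGr.toPi1 (f ≫ g) = SCGr.toPi1 f + SCGr.toPi1 g := rfl
    rw [h, map_add]
    abel

theorem pi1Hom_hom (a : 𝟙_ S ⟶ 𝟙_ S) (q : B) :
    pi1Hom D (SCGr.toPi1 (S := toSCGr D) (hom a q : 𝟙_ (Pushout D) ⟶ 𝟙_ (Pushout D))) =
      D.ψ (SCGr.toPi1 a) + q := rfl

/-- The component `q` is a translated automorphism of the unit, on which `G` has degree `q`. -/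
theorem deg_hom {A' : Type u} [AddCommGroup A'] {φ' : BraidingForm A' B}
    (G : Character (toSCGr D) φ') (hG : ∀ a, G.deg a = pi1Hom D (SCGr.toPi1 a))
    {x y : Pushout D} (f : x.val ⟶ y.val) (q : B) :
    G.deg (hom f q : x ⟶ y) = G.deg (hom f 0 : x ⟶ y) + q := by
  have h : (hom f q : x ⟶ y) = hom f 0 ≫ SCGr.translate (S := toSCGr D) y
      (hom (𝟙 (𝟙_ S)) q : 𝟙_ (Pushout D) ⟶ 𝟙_ (Pushout D)) := by
    rw [translate_hom, hom_comp, SCGr.translate_id, Category.comp_id, zero_add]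
  rw [h]
  refine (G.deg_comp _ _).trans ?_
  rw [G.deg_translate, hG, pi1Hom_hom, SCGr.toPi1_id, map_zero, zero_add]

end Pushout

/-- Every twist with values in a divisible group comes from a character. -/
theorem Twist.exists_character (hB : IsDivisibleGroup B) (D : Twist S φ) :
    ∃ F : Character S φ, ∀ a : 𝟙_ S ⟶ 𝟙_ S, F.deg a = D.ψ (SCGr.toPi1 a) := by
  -- The pushout has trivial self-braidings, so it has a character with all values zero. It is
  -- restricted along `f ↦ (f, 0)`, and `D.val` supplies the new values on objects.
  obtain ⟨G, hG₀, hG⟩ := Character.exists_of_braiding_self hB φ (Pushout.toSCGr D)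
    Pushout.braiding_self (Pushout.pi1Hom D)
  let ob (x : S) : Pushout D := ⟨x⟩
  let mk {x y : S} (f : x ⟶ y) (q : B) : ob x ⟶ ob y := Pushout.hom f q
  refine ⟨
    { val := D.val
      deg := fun f => G.deg (mk f 0)
      m := fun x y => G.m (ob x) (ob y)
      val_eq := D.val_eq
      val_tensor := D.val_tensor
      deg_comp := fun {x y z} f g => ?_
      m_left := fun f z => G.m_left (mk f 0) (ob z)
      m_right := fun z _ _ f => G.m_right (ob z) (mk f 0)
      m_assoc := fun x y z => G.m_assoc (ob x) (ob y) (ob z)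
      m_symm := fun x y => ?_ }, fun a => ?_⟩
  · refine Eq.trans ?_ (G.deg_comp (mk f 0) (mk g 0))
    refine congrArg G.deg ?_
    exact congrArg (Pushout.hom (f ≫ g)) (zero_add 0).symm
  -- The map `f ↦ (f, 0)` respects the commutativity constraints only up to `-c (val x) (val y)`;
  -- the braiding of the target, evaluated at the new values, makes up for this.
  · have h := G.m_symm (ob x) (ob y)
    rw [hG₀ (ob x), map_zero, AddMonoidHom.zero_apply, zero_add] at h
    have h' := Pushout.deg_hom G hG (x := ob x ⊗ ob y) (y := ob y ⊗ ob x) (β_ x y).hom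
      (-φ.c (D.val x) (D.val y))
    have h₁ : G.m (ob x) (ob y) + (G.deg (mk (β_ x y).hom 0) + -φ.c (D.val x) (D.val y)) =
      G.m (ob y) (ob x) := (congrArg _ h'.symm).trans h
    linear_combination (norm := abel) h₁
  · exact (hG _).trans ((Pushout.pi1Hom_hom a 0).trans (add_zero _))

end

/-! ## Injective symmetric categorical groups -/

section

variable {A B : Type u} [AddCommGroup A] [AddCommGroup B]

/-- The diagonal of `φ` is a bijection to the 2-torsion subgroup. -/
structure BraidingForm.IsTorsionForm (φ : BraidingForm A B) : Prop where
  inj : ∀ x y, φ.c x x = φ.c y y → x = y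
  surj : ∀ b : B, b + b = 0 → ∃ x, φ.c x x = b

theorem Ty.isTorsionForm_r (Q : Type u) [AddCommGroup Q] :
    (Ty.r Q).exists_form.choose.IsTorsionForm where
  inj x y h := by
    rw [(Ty.r Q).exists_form.choose_spec, (Ty.r Q).exists_form.choose_spec] at h
    exact Subtype.ext h
  surj b hb := ⟨⟨b, (two_nsmul b).trans hb⟩, (Ty.r Q).exists_form.choose_spec _⟩

/-- The cross terms cancel because `c x y + c y x = 0`. -/
theorem BraidingForm.diag_add (φ : BraidingForm A B) (x y : A) :
    φ.c (x + y) (x + y) = φ.c x x + φ.c y y := by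
  have h := φ.symm x y
  simp only [map_add, AddMonoidHom.add_apply]
  linear_combination (norm := abel) h

variable {S T : SCGr.{u}} {φ : BraidingForm A B}

/-- As `sgn x` has order at most two, `ψ (sgn x)` is the diagonal value of a unique element of `A`.
Uniqueness makes this choice additive and invariant under isomorphism, so `ψ` alone defines a twist.
-/
theorem Character.exists_of_pi1 (hB : IsDivisibleGroup B) (hφ : φ.IsTorsionForm)
    (ψ : SCGr.Pi1 S →+ B) :
    ∃ F : Character S φ, ∀ a : 𝟙_ S ⟶ 𝟙_ S, F.deg a = ψ (SCGr.toPi1 a) := by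
  choose v hv using fun x : S => hφ.surj (ψ (SCGr.toPi1 (SCGr.sgn x))) (by
    rw [← map_add, ← SCGr.toPi1_comp, SCGr.sgn_comp_self, SCGr.toPi1_id, map_zero])
  let D : Twist S φ :=
    { ψ := ψ
      val := v
      val_eq := fun {x y} f => hφ.inj _ _ (by rw [hv, hv, SCGr.sgn_congr (asIso f)])
      val_tensor := fun x y => hφ.inj _ _ (by
        rw [φ.diag_add, hv, hv, hv, SCGr.sgn_tensor, SCGr.toPi1_comp, map_add])
      diag := hv }
  exact D.exists_character hB

/-- By `deg_sgn` the degrees on `Aut 0` fix the diagonal of the object values, hence the values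
themselves. With `exists_of_pi1` this classifies characters by homomorphisms on `π₁`. -/
theorem Character.nonempty_trans_of_pi1 (hB : IsDivisibleGroup B) (hφ : φ.IsTorsionForm)
    {F G : Character S φ} (hd : ∀ a : 𝟙_ S ⟶ 𝟙_ S, F.deg a = G.deg a) :
    Nonempty (Character.Trans F G) :=
  Character.nonempty_trans hB (fun x => hφ.inj _ _ (by
    rw [← F.deg_sgn, ← G.deg_sgn, hd])) hd

/-- The homomorphism of automorphism groups of the neutral objects induced by a morphism. -/
noncomputable def SCGr.pi1Map (f : S ⟶ T) : SCGr.Pi1 S →+ SCGr.Pi1 T :=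
  AddMonoidHom.mk' (fun a => SCGr.toPi1 (Functor.LaxMonoidal.ε (SCGr.Hom.fn f) ≫
    (SCGr.Hom.fn f).map (SCGr.toPi1.symm a) ≫ inv (Functor.LaxMonoidal.ε (SCGr.Hom.fn f))))
    fun a b => by
      rw [← SCGr.toPi1_comp]
      refine congrArg SCGr.toPi1 ?_
      change _ ≫ (SCGr.Hom.fn f).map (SCGr.toPi1.symm a ≫ SCGr.toPi1.symm b) ≫ _ = _
      simp

theorem SCGr.pi1Map_toPi1 (f : S ⟶ T) (a : 𝟙_ S ⟶ 𝟙_ S) :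
    SCGr.pi1Map f (SCGr.toPi1 a) = SCGr.toPi1 (Functor.LaxMonoidal.ε (SCGr.Hom.fn f) ≫
      (SCGr.Hom.fn f).map a ≫ inv (Functor.LaxMonoidal.ε (SCGr.Hom.fn f))) := rfl

theorem SCGr.pi1Map_injective (f : S ⟶ T)
    (hf : ∀ a : 𝟙_ S ⟶ 𝟙_ S, (SCGr.Hom.fn f).map a = 𝟙 _ → a = 𝟙 _) :
    Function.Injective (SCGr.pi1Map f) := by
  rw [injective_iff_map_eq_zero]
  intro a h
  have h' : Functor.LaxMonoidal.ε (SCGr.Hom.fn f) ≫ (SCGr.Hom.fn f).map (SCGr.toPi1.symm a) ≫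
    inv (Functor.LaxMonoidal.ε (SCGr.Hom.fn f)) = 𝟙 _ := h
  refine hf (SCGr.toPi1.symm a) ?_
  rw [← Category.assoc, IsIso.comp_inv_eq, Category.id_comp] at h'
  rw [← cancel_epi (Functor.LaxMonoidal.ε (SCGr.Hom.fn f)), h', Category.comp_id]

/-- Characters extend along morphisms that are injective on automorphisms of the neutral
object. -/
theorem Character.exists_extension (hB : IsDivisibleGroup B) (hφ : φ.IsTorsionForm) (f : S ⟶ T)
    (hf : ∀ a : 𝟙_ S ⟶ 𝟙_ S, (SCGr.Hom.fn f).map a = 𝟙 _ → a = 𝟙 _) (F : Character S φ) :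
    ∃ G : Character T φ, Nonempty (Character.Trans (G.comap (SCGr.Hom.fn f)) F) := by
  obtain ⟨ψ, hψ⟩ := hB.exists_extension _ (SCGr.pi1Map_injective f hf) F.pi1
  obtain ⟨G, hG⟩ := Character.exists_of_pi1 hB hφ ψ
  refine ⟨G, Character.nonempty_trans_of_pi1 hB hφ fun a => ?_⟩
  have h := hψ (SCGr.toPi1 a)
  -- Conjugation by the unit structure map of `f` does not affect degrees, since `B` is commutative.
  rw [SCGr.pi1Map_toPi1, ← hG, G.deg_comp, G.deg_comp, G.deg_isIso_inv, F.pi1_toPi1] at h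
  change G.deg ((SCGr.Hom.fn f).map a) = _
  rw [← h]
  abel

/-- Parallel morphisms differ by the translate of an automorphism of the unit, so faithfulness can
be tested on `Aut 0`. -/
theorem Character.deg_injective (F : Character S φ)
    (hF : ∀ a : 𝟙_ S ⟶ 𝟙_ S, F.deg a = 0 → a = 𝟙 _) {x y : S} {f g : x ⟶ y}
    (h : F.deg f = F.deg g) : f = g := by
  obtain ⟨a, ha⟩ := (SCGr.translate_bijective y).2 (inv f ≫ g)
  have h₁ : F.deg a = 0 := by
    rw [← F.deg_translate y, ha, F.deg_comp, F.deg_isIso_inv, h, neg_add_cancel]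
  rw [hF a h₁, SCGr.translate_id, IsIso.eq_inv_comp, Category.comp_id] at ha
  exact ha

namespace SCGr

theorem isFaithfulMor_of_injective (f : S ⟶ T)
    (hf : ∀ (x y : S) (g h : x ⟶ y), (Hom.fn f).map g = (Hom.fn f).map h → g = h) :
    IsFaithfulMor f := by
  intro X g h σ τ e
  refine hom₂_ext fun x => hf _ _ _ _ ?_
  exact congrArg (fun η => (Hom₂.nt η).app x) e

/-- The zero morphism. -/
def zeroHom (X S : SCGr.{u}) : X ⟶ S :=
  Hom.mk (S := X) ((Functor.const X).obj (𝟙_ S))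
    (braided :=
      { ε := 𝟙 _
        μ := fun _ _ => (λ_ (𝟙_ S)).hom
        μ_natural_left := fun _ _ => by simp
        μ_natural_right := fun _ _ => by simp
        associativity := fun _ _ _ => by
          change (λ_ (𝟙_ S)).hom ▷ 𝟙_ S ≫ (λ_ (𝟙_ S)).hom ≫ 𝟙 _ =
            (α_ _ _ _).hom ≫ 𝟙_ S ◁ (λ_ (𝟙_ S)).hom ≫ (λ_ (𝟙_ S)).hom
          rw [Category.comp_id, ← Category.assoc]
          exact congrArg (· ≫ _) ((congrArg (· ▷ 𝟙_ S) unitors_equal).trans (triangle _ _).symm)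
        left_unitality := fun _ => by simp
        right_unitality := fun _ => by simp [unitors_equal]
        braided := fun _ _ => by
          change (λ_ (𝟙_ S)).hom ≫ 𝟙 _ = (β_ _ _).hom ≫ (λ_ (𝟙_ S)).hom
          rw [braiding_leftUnitor, Category.comp_id, unitors_equal] })

/-- A faithful morphism is injective on automorphisms of the neutral object. -/
theorem eq_id_of_isFaithfulMor (f : S ⟶ T) (hf : IsFaithfulMor f) (a : 𝟙_ S ⟶ 𝟙_ S)
    (ha : (Hom.fn f).map a = 𝟙 _) : a = 𝟙 _ := by
  -- The test object is the discrete symmetric categorical group on the kernel of `f` on `π₁`. The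
  -- elements of the kernel are the components of an endomorphism of the zero morphism to `S` that
  -- `f` sends to the identity.
  let K : AddSubgroup (Pi1 S) :=
    { carrier := {a | (Hom.fn f).map (toPi1.symm a) = 𝟙 _}
      zero_mem' := (Hom.fn f).map_id _
      add_mem' := fun {a b} ha hb => by
        change (Hom.fn f).map (toPi1.symm a ≫ toPi1.symm b) = 𝟙 _
        rw [Functor.map_comp, ha, hb, Category.comp_id]
      neg_mem' := fun {a} ha => by
        change (Hom.fn f).map (inv (toPi1.symm a)) = 𝟙 _
        have h : (Hom.fn f).map (toPi1.symm a) = 𝟙 _ := ha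
        rw [Functor.map_inv, IsIso.inv_eq_of_hom_inv_id]
        rw [h, Category.comp_id] }
  -- Trivial coefficients leave only identity morphisms, so naturality of a transformation is
  -- automatic and monoidality is additivity.
  let φ₀ : BraidingForm K PUnit.{u + 1} := ⟨0, fun _ _ => rfl⟩
  let g : Skel.toSCGr φ₀ ⟶ S := zeroHom (Skel.toSCGr φ₀) S
  let σ : g ⟶ g := Hom₂.mk (F := g) (G := g)
    { app := fun x : Skel φ₀ => toPi1.symm x.val.1
      naturality := fun (x y : Skel φ₀) h => by
        change 𝟙 (𝟙_ S) ≫ toPi1.symm y.val.1 = toPi1.symm x.val.1 ≫ 𝟙 (𝟙_ S)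
        rw [Category.id_comp, Category.comp_id, Skel.eq_of_hom h] }
    (isMonoidal :=
      { unit := Category.id_comp _
        tensor := fun (x y : Skel φ₀) => by
          change (λ_ (𝟙_ S)).hom ≫ (toPi1.symm x.val.1 ≫ toPi1.symm y.val.1) =
            (toPi1.symm x.val.1 ⊗ₘ toPi1.symm y.val.1) ≫ (λ_ (𝟙_ S)).hom
          rw [MonoidalCategory.tensorHom_def, Category.assoc, leftUnitor_naturality, unitors_equal,
            rightUnitor_naturality_assoc] })
  have h := hf _ g g σ (𝟙 g) (hom₂_ext fun (x : Skel φ₀) => by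
    change (Hom.fn f).map (toPi1.symm x.val.1) = (Hom.fn f).map (𝟙 _)
    rw [CategoryTheory.Functor.map_id]
    exact x.val.2)
  exact congrArg (fun η => (Hom₂.nt η).app (⟨⟨toPi1 a, ha⟩⟩ : Skel φ₀)) h

/-- Faithfulness enters only as injectivity on `π₁`; a morphism to the skeletal target is read as a
character, extended, and turned back into a morphism. -/
theorem isInjectiveObj_toSCGr (hB : IsDivisibleGroup B) (hφ : φ.IsTorsionForm) :
    IsInjectiveObj (Skel.toSCGr φ) := by
  intro S T f hf g
  obtain ⟨G, ⟨η⟩⟩ := Character.exists_extension hB hφ f (eq_id_of_isFaithfulMor f hf)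
    (Character.ofHom g)
  exact ⟨G.toHom, ⟨Character.Trans.toIso (F := f ≫ G.toHom) (G := g) η⟩⟩

theorem isInjectiveObj_K_r (Q : Type u) [AddCommGroup Q] (hQ : IsDivisibleGroup Q) :
    IsInjectiveObj (Ty.K (Ty.r Q)) :=
  isInjectiveObj_toSCGr (B := Q) hQ (Ty.isTorsionForm_r Q)

/-- Every symmetric categorical group has a faithful character with values in a divisible group. -/
theorem exists_faithful_character (S : SCGr.{u}) :
    ∃ (A B : Type u) (_ : AddCommGroup A) (_ : AddCommGroup B) (φ : BraidingForm A B),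
      IsDivisibleGroup B ∧ φ.IsTorsionForm ∧ ∃ F : Character S φ,
        ∀ (x y : S) (f g : x ⟶ y), F.deg f = F.deg g → f = g := by
  obtain ⟨Q, _, ψ, hQ, hψ⟩ := exists_injective_divisible (Pi1 S)
  obtain ⟨F, hF⟩ := Character.exists_of_pi1 (B := Q) hQ (Ty.isTorsionForm_r Q) ψ
  refine ⟨_, Q, _, _, _, hQ, Ty.isTorsionForm_r Q, F, fun x y f g h =>
    F.deg_injective (fun a ha => ?_) h⟩
  rw [hF] at ha
  exact (injective_iff_map_eq_zero ψ).1 hψ _ ha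

theorem isFaithfulMor_toHom (F : Character S φ)
    (hF : ∀ (x y : S) (f g : x ⟶ y), F.deg f = F.deg g → f = g) : IsFaithfulMor F.toHom :=
  isFaithfulMor_of_injective F.toHom
    fun x y f g h => hF x y f g (congrArg (Skel.deg (φ := φ)) h)

theorem hasEnoughInjectives : HasEnoughInjectives SCGr.{u} := fun S => by
  obtain ⟨A, B, _, _, φ, hB, hφ, F, hF⟩ := exists_faithful_character S
  exact ⟨_, F.toHom, isInjectiveObj_toSCGr hB hφ, isFaithfulMor_toHom F hF⟩

end SCGr

end

/-- An object equivalent to an injective object is injective. -/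
theorem IsInjectiveObj.of_equivalence {C : Type*} [Bicategory C] {i j : C}
    (e : Bicategory.Equivalence i j)
    (hj : IsInjectiveObj j) : IsInjectiveObj i := fun a b f hf g => by
  obtain ⟨h, ⟨η⟩⟩ := hj a b f hf (g ≫ e.hom)
  exact ⟨h ≫ e.inv, ⟨(Bicategory.associator _ _ _).symm ≪≫ Bicategory.whiskerRightIso η e.inv ≪≫
    Bicategory.associator _ _ _ ≪≫ Bicategory.whiskerLeftIso g e.unit.symm ≪≫
    Bicategory.rightUnitor g⟩⟩

/-! ### Functoriality of `π₁` and the structure of injective objects -/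

namespace SCGr

theorem pi1Map_id (S : SCGr.{u}) (a : Pi1 S) : pi1Map (𝟙 S) a = a := by
  obtain ⟨a, rfl⟩ := toPi1.surjective a
  rw [pi1Map_toPi1]
  change toPi1 (𝟙 _ ≫ a ≫ inv (𝟙 _)) = _
  rw [IsIso.inv_id, Category.comp_id, Category.id_comp]

theorem pi1Map_comp {S T U : SCGr.{u}} (f : S ⟶ T) (g : T ⟶ U) (a : Pi1 S) :
    pi1Map (f ≫ g) a = pi1Map g (pi1Map f a) := by
  obtain ⟨a, rfl⟩ := toPi1.surjective a
  rw [pi1Map_toPi1, pi1Map_toPi1, pi1Map_toPi1]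
  refine congrArg toPi1 ?_
  simp

/-- The component of `η` at the unit relates both the unit structure maps and the images of `a`, and
drops out of the conjugate. -/
theorem pi1Map_congr {S T : SCGr.{u}} {f g : S ⟶ T} (η : f ⟶ g) (a : Pi1 S) :
    pi1Map f a = pi1Map g a := by
  obtain ⟨a, rfl⟩ := toPi1.surjective a
  rw [pi1Map_toPi1, pi1Map_toPi1]
  refine congrArg toPi1 ?_
  have h := NatTrans.IsMonoidal.unit (τ := Hom₂.nt η)
  have h' := (Hom₂.nt η).naturality a
  have h₁ : (Hom.fn f).map a = (Hom₂.nt η).app _ ≫ (Hom.fn g).map a ≫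
      inv ((Hom₂.nt η).app (𝟙_ S)) := by
    rw [← Category.assoc, IsIso.eq_comp_inv, h']
  have h₂ : Functor.LaxMonoidal.ε (Hom.fn f) = Functor.LaxMonoidal.ε (Hom.fn g) ≫
      inv ((Hom₂.nt η).app (𝟙_ S)) := by
    rw [IsIso.eq_comp_inv, h]
  rw [h₁, h₂]
  simp

theorem isDivisibleGroup_pi1_toSCGr {A B : Type u} [AddCommGroup A] [AddCommGroup B]
    (hB : IsDivisibleGroup B) (φ : BraidingForm A B) : IsDivisibleGroup (Pi1 (Skel.toSCGr φ)) :=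
  fun n hn q => by
    obtain ⟨p, hp⟩ := hB n hn (Skel.pi1Equiv φ q)
    exact ⟨(Skel.pi1Equiv φ).symm p, (Skel.pi1Equiv φ).injective (by rw [map_nsmul]; simpa using hp)⟩

theorem deg_ofHom_eq {A B : Type u} [AddCommGroup A] [AddCommGroup B] {φ : BraidingForm A B}
    {S : SCGr.{u}} (f : S ⟶ Skel.toSCGr φ) (a : 𝟙_ S ⟶ 𝟙_ S) :
    (Character.ofHom f).deg a = Skel.pi1Equiv φ (pi1Map f (toPi1 a)) := by
  have h : Functor.LaxMonoidal.ε (Hom.fn f) ≫ (Hom.fn f).map a =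
      toPi1.symm (pi1Map f (toPi1 a)) ≫ Functor.LaxMonoidal.ε (Hom.fn f) := by
    rw [pi1Map_toPi1]
    simp
  have h' := congrArg (Skel.deg (φ := φ)) h
  exact add_left_cancel (h'.trans (add_comm _ _))

/-- The group of automorphisms of the neutral object of an injective symmetric categorical group is
divisible. -/
theorem isDivisibleGroup_pi1 (S : SCGr.{u}) (hS : IsInjectiveObj S) : IsDivisibleGroup (Pi1 S) := by
  obtain ⟨A, B, _, _, φ, hB, hφ, F, hF⟩ := exists_faithful_character S
  -- Extending the identity of `S` along a faithful morphism splits it, so `π₁ S` is a retract of a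
  -- divisible group.
  obtain ⟨h, ⟨η⟩⟩ := hS _ _ F.toHom (isFaithfulMor_toHom F hF) (𝟙 S)
  intro n hn q
  obtain ⟨p, hp⟩ := isDivisibleGroup_pi1_toSCGr hB φ n hn (pi1Map F.toHom q)
  exact ⟨pi1Map h p, by rw [← map_nsmul, hp, ← pi1Map_comp, pi1Map_congr η.hom, pi1Map_id]⟩

/-- An injective symmetric categorical group is determined by the group of automorphisms of the
neutral object. -/
theorem nonempty_equivalence (S : SCGr.{u}) (hS : IsInjectiveObj S) :
    Nonempty (Bicategory.Equivalence S (Ty.K (Ty.r (Pi1 S)))) := by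
  have hQ := isDivisibleGroup_pi1 S hS
  obtain ⟨φ, hK, hφ⟩ : ∃ φ : BraidingForm (Ty.r (Pi1 S)).A₀ (Pi1 S),
      Ty.K (Ty.r (Pi1 S)) = Skel.toSCGr φ ∧ φ.IsTorsionForm := ⟨_, rfl, Ty.isTorsionForm_r (Pi1 S)⟩
  rw [hK]
  -- The identity homomorphism gives a morphism inducing an isomorphism on `π₁`, hence a faithful
  -- one, which splits because `S` is injective.
  obtain ⟨F, hF⟩ := Character.exists_of_pi1 (S := S) hQ hφ (AddMonoidHom.id _)
  let f : S ⟶ Skel.toSCGr φ := F.toHom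
  have hf : ∀ a : Pi1 S, Skel.pi1Equiv φ (pi1Map f a) = a := fun a =>
    (deg_ofHom_eq f (toPi1.symm a)).symm.trans (hF _)
  obtain ⟨h, ⟨η⟩⟩ := hS _ _ f (isFaithfulMor_toHom F fun x y g g' e =>
    F.deg_injective (fun a ha => toPi1.injective ((hF a).symm.trans ha)) e) (𝟙 S)
  have hh : ∀ a, pi1Map (h ≫ f) a = a := fun a => by
    obtain ⟨b, rfl⟩ : ∃ b, pi1Map f b = a :=
      ⟨Skel.pi1Equiv φ a, (Skel.pi1Equiv φ).injective (hf _)⟩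
    rw [pi1Map_comp, ← pi1Map_comp f h, pi1Map_congr η.hom, pi1Map_id]
  -- The composite `h ≫ f` is the identity on `π₁`, because `f` is surjective there and `f ≫ h ≅ 𝟙`.
  -- Characters being determined by `π₁`, it is isomorphic to the identity.
  obtain ⟨ε⟩ := Character.nonempty_trans_of_pi1 hQ hφ (F := Character.ofHom (h ≫ f))
    (G := Character.ofHom (𝟙 _)) fun a => by
      rw [deg_ofHom_eq, deg_ofHom_eq, hh, pi1Map_id]
  exact ⟨Bicategory.Equivalence.mkOfAdjointifyCounit η.symm ε.toIso⟩

end SCGr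

/-! ## The symmetric categorical group of characters -/

namespace Character

variable {A B : Type u} [AddCommGroup A] [AddCommGroup B]
variable {S T : SCGr.{u}} {φ : BraidingForm A B}

instance : Category (Character S φ) where
  Hom := Trans
  id F := ⟨fun _ => 0, fun _ => rfl, by simp, by simp⟩
  comp η θ := ⟨fun x => η.t x + θ.t x, fun x => (η.val_eq x).trans (θ.val_eq x),
    fun {x y} f => by
      have h₁ := η.nat f
      have h₂ := θ.nat f
      linear_combination (norm := abel) h₁ + h₂,
    fun x y => by
      have h₁ := η.mul x y
      have h₂ := θ.mul x y
      linear_combination (norm := abel) h₁ + h₂⟩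
  id_comp _ := Trans.ext (funext fun _ => zero_add _)
  comp_id _ := Trans.ext (funext fun _ => add_zero _)
  assoc _ _ _ := Trans.ext (funext fun _ => add_assoc _ _ _)

/-- The value of a morphism of characters. -/
def t {F G : Character S φ} (η : F ⟶ G) (x : S) : B := Trans.t η x

theorem hom_ext {F G : Character S φ} {η θ : F ⟶ G} (h : ∀ x, t η x = t θ x) : η = θ :=
  Trans.ext (funext h)

theorem hom_val {F G : Character S φ} (η : F ⟶ G) (x : S) : F.val x = G.val x := Trans.val_eq η x

theorem hom_nat {F G : Character S φ} (η : F ⟶ G) {x y : S} (f : x ⟶ y) :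
    F.deg f + t η y = t η x + G.deg f := Trans.nat η f

theorem hom_mul {F G : Character S φ} (η : F ⟶ G) (x y : S) :
    F.m x y + t η (x ⊗ y) = t η x + t η y + G.m x y := Trans.mul η x y

@[simp] theorem t_id (F : Character S φ) (x : S) : t (𝟙 F) x = 0 := rfl

@[simp] theorem t_comp {F G H : Character S φ} (η : F ⟶ G) (θ : G ⟶ H) (x : S) :
    t (η ≫ θ) x = t η x + t θ x := rfl

/-- The inverse of a morphism of characters. -/
def Trans.symm {F G : Character S φ} (η : Trans F G) : Trans G F where
  t x := -η.t x
  val_eq x := (η.val_eq x).symm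
  nat f := by
    have h := η.nat f
    linear_combination (norm := abel) -h
  mul x y := by
    have h := η.mul x y
    linear_combination (norm := abel) -h

/-- Every morphism of characters is an isomorphism. -/
def Trans.iso {F G : Character S φ} (η : Trans F G) : F ≅ G where
  hom := η
  inv := η.symm
  hom_inv_id := hom_ext fun x => add_neg_cancel (η.t x)
  inv_hom_id := hom_ext fun x => neg_add_cancel (η.t x)

instance : IsGroupoid (Character S φ) where
  all_isIso f := (Trans.iso f).isIso_hom

/-- The pointwise sum of two characters. -/
def add (F G : Character S φ) : Character S φ where
  val x := F.val x + G.val x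
  deg f := F.deg f + G.deg f
  -- Rearranging `(F x + G x) + (F y + G y)` into `(F x + F y) + (G x + G y)` interchanges `G x` and
  -- `F y`.
  m x y := F.m x y + G.m x y + φ.c (G.val x) (F.val y)
  val_eq f := congrArg₂ (· + ·) (F.val_eq f) (G.val_eq f)
  val_tensor x y := by
    rw [F.val_tensor, G.val_tensor]
    abel
  deg_comp f g := by
    rw [F.deg_comp, G.deg_comp]
    abel
  m_left f z := by
    have h₁ := F.m_left f z
    have h₂ := G.m_left f z
    rw [G.val_eq f]
    linear_combination (norm := abel) h₁ + h₂
  m_right z _ _ f := by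
    have h₁ := F.m_right z f
    have h₂ := G.m_right z f
    rw [F.val_eq f]
    linear_combination (norm := abel) h₁ + h₂
  m_assoc x y z := by
    have h₁ := F.m_assoc x y z
    have h₂ := G.m_assoc x y z
    rw [F.val_tensor, G.val_tensor, map_add, map_add, AddMonoidHom.add_apply]
    linear_combination (norm := abel) h₁ + h₂
  m_symm x y := by
    have h₁ := F.m_symm x y
    have h₂ := G.m_symm x y
    have h₃ := φ.symm (F.val x) (G.val y)
    simp only [map_add, AddMonoidHom.add_apply]
    linear_combination (norm := abel) h₁ + h₂ - h₃

/-- The trivial character. -/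
def trivial (S : SCGr.{u}) (φ : BraidingForm A B) : Character S φ where
  val _ := 0
  deg _ := 0
  m _ _ := 0
  val_eq _ := rfl
  val_tensor _ _ := (add_zero 0).symm
  deg_comp _ _ := (add_zero 0).symm
  m_left _ _ := rfl
  m_right _ _ _ _ := rfl
  m_assoc _ _ _ := by simp
  m_symm _ _ := by simp

/-- The inverse of a character. -/
def neg (F : Character S φ) : Character S φ where
  val x := -F.val x
  deg f := -F.deg f
  -- The correction cancels the interchange term `c (-F x) (F y)` in the sum of `F` and its inverse.
  m x y := -F.m x y + φ.c (F.val x) (F.val y)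
  val_eq f := congrArg _ (F.val_eq f)
  val_tensor x y := by
    rw [F.val_tensor]
    abel
  deg_comp f g := by
    rw [F.deg_comp]
    abel
  m_left f z := by
    have h₁ := F.m_left f z
    rw [F.val_eq f]
    linear_combination (norm := abel) -h₁
  m_right z _ _ f := by
    have h₁ := F.m_right z f
    rw [F.val_eq f]
    linear_combination (norm := abel) -h₁
  m_assoc x y z := by
    have h₁ := F.m_assoc x y z
    simp only [F.val_tensor, map_add, AddMonoidHom.add_apply]
    linear_combination (norm := abel) -h₁
  m_symm x y := by
    have h₁ := F.m_symm x y
    have h₂ := φ.symm (F.val x) (F.val y)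
    simp only [map_neg, AddMonoidHom.neg_apply, neg_neg]
    linear_combination (norm := abel) -h₁ - h₂

instance : MonoidalCategoryStruct (Character S φ) where
  tensorObj := add
  whiskerLeft F G H η := ⟨fun x => t η x, fun x => congrArg (F.val x + ·) (hom_val η x),
    fun {x y} f => by
      have h := hom_nat η f
      change F.deg f + G.deg f + t η y = t η x + (F.deg f + H.deg f)
      linear_combination (norm := abel) h,
    fun x y => by
      have h := hom_mul η x y
      change F.m x y + G.m x y + φ.c (G.val x) (F.val y) + t η (x ⊗ y) =
        t η x + t η y + (F.m x y + H.m x y + φ.c (H.val x) (F.val y))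
      rw [hom_val η x]
      linear_combination (norm := abel) h⟩
  whiskerRight {G H} η F := ⟨fun x => t η x, fun x => congrArg (· + F.val x) (hom_val η x),
    fun {x y} f => by
      have h := hom_nat η f
      change G.deg f + F.deg f + t η y = t η x + (H.deg f + F.deg f)
      linear_combination (norm := abel) h,
    fun x y => by
      have h := hom_mul η x y
      change G.m x y + F.m x y + φ.c (F.val x) (G.val y) + t η (x ⊗ y) =
        t η x + t η y + (H.m x y + F.m x y + φ.c (F.val x) (H.val y))
      rw [hom_val η y]
      linear_combination (norm := abel) h⟩
  tensorUnit := trivial S φ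
  associator F G H := Trans.iso
    ⟨fun _ => 0, fun x => add_assoc _ _ _, fun {x y} f => by
      change F.deg f + G.deg f + H.deg f + 0 = 0 + (F.deg f + (G.deg f + H.deg f))
      abel,
    fun x y => by
      change F.m x y + G.m x y + φ.c (G.val x) (F.val y) + H.m x y +
        φ.c (H.val x) (F.val y + G.val y) + 0 = 0 + 0 +
          (F.m x y + (G.m x y + H.m x y + φ.c (H.val x) (G.val y)) +
            φ.c (G.val x + H.val x) (F.val y))
      simp only [map_add, AddMonoidHom.add_apply]
      abel⟩
  leftUnitor F := Trans.iso
    ⟨fun _ => 0, fun x => zero_add _, fun {x y} f => by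
      change 0 + F.deg f + 0 = 0 + F.deg f
      abel,
    fun x y => by
      change 0 + F.m x y + φ.c (F.val x) 0 + 0 = 0 + 0 + F.m x y
      rw [map_zero]
      abel⟩
  rightUnitor F := Trans.iso
    ⟨fun _ => 0, fun x => add_zero _, fun {x y} f => by
      change F.deg f + 0 + 0 = 0 + F.deg f
      abel,
    fun x y => by
      change F.m x y + 0 + φ.c 0 (F.val y) + 0 = 0 + 0 + F.m x y
      rw [map_zero, AddMonoidHom.zero_apply]
      abel⟩

@[simp] theorem tensor_deg (F G : Character S φ) {x y : S} (f : x ⟶ y) :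
    (F ⊗ G).deg f = F.deg f + G.deg f := rfl

@[simp] theorem tensor_m (F G : Character S φ) (x y : S) :
    (F ⊗ G).m x y = F.m x y + G.m x y + φ.c (G.val x) (F.val y) := rfl

@[simp] theorem unit_deg {x y : S} (f : x ⟶ y) : (𝟙_ (Character S φ)).deg f = 0 := rfl

@[simp] theorem unit_m (x y : S) : (𝟙_ (Character S φ)).m x y = 0 := rfl

@[simp] theorem t_whiskerLeft (F : Character S φ) {G H : Character S φ} (η : G ⟶ H) (x : S) :
    t (F ◁ η) x = t η x := rfl

@[simp] theorem t_whiskerRight (F : Character S φ) {G H : Character S φ} (η : G ⟶ H) (x : S) :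
    t (η ▷ F) x = t η x := rfl

@[simp] theorem t_tensorHom {F G F' G' : Character S φ} (η : F ⟶ G) (η' : F' ⟶ G') (x : S) :
    t (η ⊗ₘ η') x = t η x + t η' x := rfl

@[simp] theorem t_associator (F G H : Character S φ) (x : S) : t (α_ F G H).hom x = 0 := rfl

@[simp] theorem t_associator_inv (F G H : Character S φ) (x : S) : t (α_ F G H).inv x = 0 :=
  neg_zero

@[simp] theorem t_leftUnitor (F : Character S φ) (x : S) : t (λ_ F).hom x = 0 := rfl

@[simp] theorem t_rightUnitor (F : Character S φ) (x : S) : t (ρ_ F).hom x = 0 := rfl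

instance : MonoidalCategory (Character S φ) where
  tensorHom_def _ _ := hom_ext fun _ => by simp
  id_tensorHom_id _ _ := hom_ext fun _ => by simp
  tensorHom_comp_tensorHom _ _ _ _ := hom_ext fun _ => by
    simp only [t_comp, t_tensorHom]
    abel
  whiskerLeft_id _ _ := hom_ext fun _ => by simp
  id_whiskerRight _ _ := hom_ext fun _ => by simp
  associator_naturality _ _ _ := hom_ext fun _ => by
    simp only [t_comp, t_tensorHom, t_associator]
    abel
  leftUnitor_naturality _ := hom_ext fun _ => by simp
  rightUnitor_naturality _ := hom_ext fun _ => by simp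
  pentagon _ _ _ _ := hom_ext fun _ => by simp
  triangle _ _ := hom_ext fun _ => by simp

/-- The commutativity constraint of characters. -/
def braidTrans (F G : Character S φ) : Trans (F ⊗ G) (G ⊗ F) where
  t x := φ.c (F.val x) (G.val x)
  val_eq x := add_comm _ _
  nat {x y} f := by
    rw [tensor_deg, tensor_deg, F.val_eq f, G.val_eq f]
    abel
  mul x y := by
    have h := φ.symm (F.val y) (G.val x)
    simp only [tensor_m, F.val_tensor, G.val_tensor, map_add, AddMonoidHom.add_apply]
    linear_combination (norm := abel) h

instance : BraidedCategory (Character S φ) where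
  braiding F G := (braidTrans F G).iso
  braiding_naturality_right F _ _ η := hom_ext fun x => by
    change t η x + φ.c (F.val x) _ = φ.c (F.val x) _ + t η x
    rw [hom_val η, add_comm]
  braiding_naturality_left η F := hom_ext fun x => by
    change t η x + φ.c _ (F.val x) = φ.c _ (F.val x) + t η x
    rw [hom_val η, add_comm]
  hexagon_forward F G H := hom_ext fun x => by
    change 0 + (φ.c (F.val x) (G.val x + H.val x) + 0) =
      φ.c (F.val x) (G.val x) + (0 + φ.c (F.val x) (H.val x))
    rw [map_add]
    abel
  hexagon_reverse F G H := hom_ext fun x => by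
    change -0 + (φ.c (F.val x + G.val x) (H.val x) + -0) =
      φ.c (G.val x) (H.val x) + (-0 + φ.c (F.val x) (H.val x))
    rw [map_add, AddMonoidHom.add_apply]
    abel

@[simp] theorem t_braiding (F G : Character S φ) (x : S) :
    t (β_ F G).hom x = φ.c (F.val x) (G.val x) := rfl

instance : SymmetricCategory (Character S φ) where
  symmetry F G := hom_ext fun x => by simp [φ.symm]

/-- A morphism of characters of the form `F ⊗ G ⟶ F ⊗ H` comes from a morphism `G ⟶ H`. -/
def cancelLeft {F G H : Character S φ} (η : F ⊗ G ⟶ F ⊗ H) : G ⟶ H :=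
  ⟨fun x => t η x, fun x => add_left_cancel (hom_val η x),
    fun {x y} f => by
      have h := hom_nat η f
      rw [tensor_deg, tensor_deg] at h
      linear_combination (norm := abel) h,
    fun x y => by
      have h := hom_mul η x y
      have h' : G.val x = H.val x := add_left_cancel (hom_val η x)
      rw [tensor_m, tensor_m, h'] at h
      linear_combination (norm := abel) h⟩

/-- The character `neg F` is inverse to `F`. -/
def addNegTrans (F G : Character S φ) : Trans (F ⊗ (neg F ⊗ G)) G where
  t _ := 0
  val_eq x := add_neg_cancel_left (F.val x) (G.val x)
  nat f := by
    change F.deg f + (-F.deg f + G.deg f) + 0 = 0 + G.deg f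
    abel
  mul x y := by
    change F.m x y + (-F.m x y + φ.c (F.val x) (F.val y) + G.m x y + φ.c (G.val x) (-F.val y)) +
      φ.c (-F.val x + G.val x) (F.val y) + 0 = 0 + 0 + G.m x y
    simp only [map_add, map_neg, AddMonoidHom.add_apply, AddMonoidHom.neg_apply]
    abel

theorem isEquivalence_tensorLeft (F : Character S φ) : (tensorLeft F).IsEquivalence where
  faithful := ⟨fun {G H f g} h => hom_ext fun x => by
    have h' : t ((tensorLeft F).map f) x = t ((tensorLeft F).map g) x := congrArg (fun θ => t θ x) h
    exact h'⟩
  full := ⟨fun η => ⟨cancelLeft η, hom_ext fun _ => rfl⟩⟩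
  essSurj := ⟨fun G => ⟨neg F ⊗ G, ⟨(addNegTrans F G).iso⟩⟩⟩

end Character

/-- The symmetric categorical group of characters of `S`. -/
abbrev SCGr.characters {A B : Type u} [AddCommGroup A] [AddCommGroup B] (S : SCGr.{u})
    (φ : BraidingForm A B) : SCGr.{u} where
  carrier := Character S φ
  isEquivalence_tensorLeft := Character.isEquivalence_tensorLeft

/-! ## Characters and biadditive functors -/

namespace Character

variable {A B : Type u} [AddCommGroup A] [AddCommGroup B]
variable {S T U : SCGr.{u}} {φ : BraidingForm A B}

/-- The middle-four interchange in degrees: associativity terms telescope, and the target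
contributes only the braiding of `b` with `c`. -/
theorem deg_tensorμ (F : Character S φ) (a b c d : S) :
    F.m a b + F.m c d + F.m (a ⊗ b) (c ⊗ d) + F.deg (tensorμ a b c d) =
      φ.c (F.val b) (F.val c) + F.m a c + F.m b d + F.m (a ⊗ c) (b ⊗ d) := by
  have h₁ := F.m_assoc a b (c ⊗ d)
  have h₂ := F.m_right a (α_ b c d).inv
  have h₃ := F.m_assoc b c d
  have h₄ := F.m_right a ((β_ b c).hom ▷ d)
  have h₅ := F.m_left (β_ b c).hom d
  have h₆ := F.m_symm b c
  have h₇ := F.m_right a (α_ c b d).hom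
  have h₈ := F.m_assoc c b d
  have h₉ := F.m_assoc a c (b ⊗ d)
  simp only [tensorμ, F.deg_comp, F.deg_inv] at *
  linear_combination (norm := abel) h₁ + h₂ - h₃ + h₄ + h₅ + h₆ + h₇ + h₈ - h₉

theorem e_tensor (F G : Character S φ) : (F ⊗ G).e = F.e + G.e := by
  simp only [e, tensor_m, tensor_deg, val_unit, map_zero]
  abel

/-- The transformation of restricted characters given by a monoidal natural transformation. -/
def comapTrans (F : Character T φ) {G H : S ⥤ T} [G.LaxBraided] [H.LaxBraided] (η : G ⟶ H)
    [NatTrans.IsMonoidal η] : Trans (F.comap G) (F.comap H) where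
  t x := F.deg (η.app x)
  val_eq x := F.val_eq (η.app x)
  nat f := by
    have h := congrArg F.deg (η.naturality f)
    rwa [F.deg_comp, F.deg_comp] at h
  mul x y := by
    have h := congrArg F.deg (NatTrans.IsMonoidal.tensor (τ := η) x y)
    rw [F.deg_comp, F.deg_comp] at h
    have h' := F.deg_tensorHom (η.app x) (η.app y)
    change F.m _ _ + F.deg _ + F.deg _ = F.deg _ + F.deg _ + (F.m _ _ + F.deg _)
    linear_combination (norm := abel) h + h'

variable (P : BiaddFunctor S T U) (F : Character U φ)

/-- The interchange axiom of `P` read through `F`. Its `c`-term is what the interchange in a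
pointwise sum of characters requires, so the distributivity constraints become transformations of
characters in either variable. -/
theorem interchange (x x' : S) (y y' : T) :
    F.m (P.obj x y) (P.obj x y') + F.deg (P.distR x y y') +
      (F.m (P.obj x' y) (P.obj x' y') + F.deg (P.distR x' y y')) +
      (F.m (P.obj x (y ⊗ y')) (P.obj x' (y ⊗ y')) + F.deg (P.distL x x' (y ⊗ y'))) =
    φ.c (F.val (P.obj x y')) (F.val (P.obj x' y)) +
      (F.m (P.obj x y) (P.obj x' y) + F.deg (P.distL x x' y)) +
      (F.m (P.obj x y') (P.obj x' y') + F.deg (P.distL x x' y')) +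
      (F.m (P.obj (x ⊗ x') y) (P.obj (x ⊗ x') y') + F.deg (P.distR (x ⊗ x') y y')) := by
  have h₁ := congrArg F.deg (P.interchange x x' y y')
  have h₂ := F.deg_tensorHom (P.distR x y y') (P.distR x' y y')
  have h₃ := F.deg_tensorHom (P.distL x x' y) (P.distL x x' y')
  have h₄ := F.deg_tensorμ (P.obj x y) (P.obj x y') (P.obj x' y) (P.obj x' y')
  rw [F.deg_comp, F.deg_comp, F.deg_comp] at h₁
  change F.deg (P.distR x y y' ⊗ₘ P.distR x' y y') + F.deg (P.distL x x' (y ⊗ y')) =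
    F.deg (tensorμ (P.obj x y) (P.obj x y') (P.obj x' y) (P.obj x' y')) +
      (F.deg (P.distL x x' y ⊗ₘ P.distL x x' y') + F.deg (P.distR (x ⊗ x') y y')) at h₁
  linear_combination (norm := abel) h₁ - h₂ + h₃ + h₄

/-- The distributivity constraints in the first variable, as a transformation of characters in
the second variable. -/
def distLTrans (x x' : S) :
    Trans (F.comap (P.fn.obj x) ⊗ F.comap (P.fn.obj x')) (F.comap (P.fn.obj (x ⊗ x'))) where
  t y := F.m (P.obj x y) (P.obj x' y) + F.deg (P.distL x x' y)
  val_eq y := ((F.comap (P.fn.flip.obj y)).val_tensor x x').symm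
  -- Naturality in the second variable is monoidality, in the first variable, of the transformation
  -- induced by `g`.
  nat {y y'} g := (F.comapTrans (P.fn.flip.map g)).mul x x' |> fun h => by
    change F.m (P.obj x y) (P.obj x' y) + F.deg (P.distL x x' y) +
      F.deg ((P.fn.obj (x ⊗ x')).map g) = F.deg ((P.fn.obj x).map g) +
      F.deg ((P.fn.obj x').map g) + (F.m (P.obj x y') (P.obj x' y') +
        F.deg (P.distL x x' y')) at h
    exact h.symm
  mul y y' := by
    have h₁ := F.interchange P x x' y y'
    have h₂ := φ.symm (F.val (P.obj x y')) (F.val (P.obj x' y))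
    change F.m (P.obj x y) (P.obj x y') + F.deg (P.distR x y y') +
      (F.m (P.obj x' y) (P.obj x' y') + F.deg (P.distR x' y y')) +
      φ.c (F.val (P.obj x' y)) (F.val (P.obj x y')) +
      (F.m (P.obj x (y ⊗ y')) (P.obj x' (y ⊗ y')) + F.deg (P.distL x x' (y ⊗ y'))) =
      (F.m (P.obj x y) (P.obj x' y) + F.deg (P.distL x x' y)) +
      (F.m (P.obj x y') (P.obj x' y') + F.deg (P.distL x x' y')) +
      (F.m (P.obj (x ⊗ x') y) (P.obj (x ⊗ x') y') + F.deg (P.distR (x ⊗ x') y y'))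
    linear_combination (norm := abel) h₁ + h₂

/-- The distributivity constraints in the second variable, as a transformation of characters in
the first variable. -/
def distRTrans (y y' : T) :
    Trans (F.comap (P.fn.flip.obj y) ⊗ F.comap (P.fn.flip.obj y'))
      (F.comap (P.fn.flip.obj (y ⊗ y'))) where
  t x := F.m (P.obj x y) (P.obj x y') + F.deg (P.distR x y y')
  val_eq x := ((F.comap (P.fn.obj x)).val_tensor y y').symm
  nat {x x'} f := (F.comapTrans (P.fn.map f)).mul y y' |> fun h => by
    change F.m (P.obj x y) (P.obj x y') + F.deg (P.distR x y y') +
      F.deg ((P.fn.map f).app (y ⊗ y')) = F.deg ((P.fn.map f).app y) +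
      F.deg ((P.fn.map f).app y') + (F.m (P.obj x' y) (P.obj x' y') +
        F.deg (P.distR x' y y')) at h
    exact h.symm
  mul x x' := by
    have h₁ := F.interchange P x x' y y'
    change F.m (P.obj x y) (P.obj x' y) + F.deg (P.distL x x' y) +
      (F.m (P.obj x y') (P.obj x' y') + F.deg (P.distL x x' y')) +
      φ.c (F.val (P.obj x y')) (F.val (P.obj x' y)) +
      (F.m (P.obj (x ⊗ x') y) (P.obj (x ⊗ x') y') + F.deg (P.distR (x ⊗ x') y y')) =
      (F.m (P.obj x y) (P.obj x y') + F.deg (P.distR x y y')) +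
      (F.m (P.obj x' y) (P.obj x' y') + F.deg (P.distR x' y y')) +
      (F.m (P.obj x (y ⊗ y')) (P.obj x' (y ⊗ y')) + F.deg (P.distL x x' (y ⊗ y')))
    linear_combination (norm := abel) -h₁

/-- The structure map `0 ⟶ F (0 · -)`. -/
def zeroTrans : Trans (𝟙_ (Character T φ)) (F.comap (P.fn.obj (𝟙_ S))) where
  t y := (F.comap (P.fn.flip.obj y)).e
  val_eq y := (F.comap (P.fn.flip.obj y)).val_unit.symm
  nat {y y'} g := by
    have h := (F.comapTrans (P.fn.flip.map g)).unit
    rw [unit_deg, zero_add]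
    exact h.symm
  mul y y' := by
    have h := (F.distRTrans P y y').unit
    rw [e_tensor] at h
    rw [unit_m, zero_add]
    exact h.symm

/-- The functor `x ↦ F (x · -)`. -/
def coindFunctor : S ⥤ Character T φ where
  obj x := F.comap (P.fn.obj x)
  map f := F.comapTrans (P.fn.map f)
  map_id x := hom_ext fun y => (F.comap (P.fn.flip.obj y)).deg_id x
  map_comp f g := hom_ext fun y => (F.comap (P.fn.flip.obj y)).deg_comp f g

/-- Each axiom, evaluated at `y`, is the same axiom for the character `x ↦ F (x · y)`. -/
instance : (F.coindFunctor P).LaxBraided where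
  ε := F.zeroTrans P
  μ x x' := F.distLTrans P x x'
  μ_natural_left f x' := hom_ext fun y => ((F.comap (P.fn.flip.obj y)).m_left f x').symm
  μ_natural_right x' f := hom_ext fun y => ((F.comap (P.fn.flip.obj y)).m_right x' f).symm
  associativity x y z := hom_ext fun s =>
    ((add_assoc _ _ _).symm.trans ((F.comap (P.fn.flip.obj s)).m_assoc x y z)).trans
      (zero_add _).symm
  left_unitality x := hom_ext fun s =>
    ((F.comap (P.fn.flip.obj s)).e_left x).symm.trans (add_assoc _ _ _)
  right_unitality x := hom_ext fun s =>
    ((F.comap (P.fn.flip.obj s)).e_right x).symm.trans (add_assoc _ _ _)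
  braided x y := hom_ext fun s => (F.comap (P.fn.flip.obj s)).m_symm x y

end Character

/-! ## Modules of characters -/

namespace BiaddFunctor

variable {S T U : SCGr.{u}} (P : BiaddFunctor S T U)

theorem id_map_comp (x : S) {y y' y'' : T} (g : y ⟶ y') (g' : y' ⟶ y'') :
    P.map (𝟙 x) (g ≫ g') = P.map (𝟙 x) g ≫ P.map (𝟙 x) g' := by
  simp [map]

theorem map_id_right {x x' : S} (f : x ⟶ x') (y : T) : P.map f (𝟙 y) = (P.fn.map f).app y := by
  simp [map]

theorem map_id_left (x : S) {y y' : T} (g : y ⟶ y') : P.map (𝟙 x) g = (P.fn.obj x).map g := by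
  simp [map]

end BiaddFunctor

namespace TwoRing

variable (R : TwoRing.{u})

/-- Multiplication by the unit is naturally isomorphic to the identity, so an equation may be
checked after multiplying by it. -/
theorem id_one_map_injective {x y : R.add} {f g : x ⟶ y}
    (h : R.mul.map (𝟙 R.one) f = R.mul.map (𝟙 R.one) g) : f = g := by
  rw [← cancel_epi (R.leftUnit.iso x).hom, ← R.leftUnit.naturality, h, R.leftUnit.naturality]

/-- Kelly's argument: after multiplication by the unit on the left, the pentagon at `1, 1, x, y` and
the triangle axiom imply this further unit compatibility. -/
theorem assoc_leftUnit (x y : R.add) :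
    (R.assoc.iso R.one x y).hom ≫ (R.leftUnit.iso (R.mul.obj x y)).hom =
      R.mul.map (R.leftUnit.iso x).hom (𝟙 y) := by
  apply R.id_one_map_injective
  have h₁ := R.pentagon R.one R.one x y
  have h₂ := R.triangle R.one (R.mul.obj x y)
  have h₃ := R.assoc.naturality (R.rightUnit.iso R.one).hom (𝟙 x) (𝟙 y)
  have h₄ := R.assoc.naturality (𝟙 R.one) (R.leftUnit.iso x).hom (𝟙 y)
  rw [← cancel_epi (R.assoc.iso R.one (R.mul.obj R.one x) y).hom,
    ← cancel_epi (R.mul.map (R.assoc.iso R.one R.one x).hom (𝟙 y)), R.mul.id_map_comp,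
    reassoc_of% h₁, h₂, ← h₄]
  rw [BiaddFunctor.map_id] at h₃
  rw [← h₃, ← R.triangle R.one x, BiaddFunctor.map_comp_id, Category.assoc]

end TwoRing

namespace Character

variable {A B : Type u} [AddCommGroup A] [AddCommGroup B]
variable {S T U V W Z : SCGr.{u}} {φ : BraidingForm A B}

/-- The restriction of transformations. -/
def Trans.comap {F G : Character T φ} (η : Trans F G) (K : S ⥤ T) [K.LaxBraided] :
    Trans (F.comap K) (G.comap K) where
  t x := η.t (K.obj x)
  val_eq x := η.val_eq (K.obj x)
  nat f := η.nat (K.map f)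
  mul x y := by
    have h₁ := η.mul (K.obj x) (K.obj y)
    have h₂ := η.nat (Functor.LaxMonoidal.μ K x y)
    change F.m _ _ + F.deg _ + _ = _ + _ + (G.m _ _ + G.deg _)
    linear_combination (norm := abel) h₁ + h₂

/-- Restriction of characters along a symmetric monoidal functor. -/
def comapFunctor (K : S ⥤ T) [K.LaxBraided] (φ : BraidingForm A B) :
    Character T φ ⥤ Character S φ where
  obj F := F.comap K
  map η := Trans.comap η K

/-- Sums of characters are pointwise on objects and morphisms, and `K` adds its own structure maps
linearly, so every constraint has degree zero. -/
instance (K : S ⥤ T) [K.LaxBraided] : (comapFunctor K φ).LaxBraided where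
  ε := ⟨fun _ => 0, fun _ => rfl, fun _ => rfl, fun x y => by
    change (0 : B) + 0 = 0 + 0 + (0 + 0)
    abel⟩
  μ F G := ⟨fun _ => 0, fun _ => rfl, fun f => by
      change F.deg (K.map f) + G.deg (K.map f) + 0 = 0 + (F.deg (K.map f) + G.deg (K.map f))
      abel, fun x y => by
      change F.m _ _ + F.deg _ + (G.m _ _ + G.deg _) + φ.c (G.val _) (F.val _) + 0 =
        0 + 0 + (F.m _ _ + G.m _ _ + φ.c (G.val _) (F.val _) + (F.deg _ + G.deg _))
      abel⟩
  μ_natural_left η F := hom_ext fun x => (add_zero _).trans (zero_add _).symm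
  μ_natural_right F η := hom_ext fun x => (add_zero _).trans (zero_add _).symm
  associativity F G H := hom_ext fun x => rfl
  left_unitality F := hom_ext fun x => by
    change (0 : B) = 0 + (0 + 0)
    abel
  right_unitality F := hom_ext fun x => by
    change (0 : B) = 0 + (0 + 0)
    abel
  braided F G := hom_ext fun x => (zero_add _).trans (add_zero _).symm

/-- The functor `(F, x) ↦ F (x · -)` of two variables. -/
def coindBifunctor (P : BiaddFunctor S T U) (φ : BraidingForm A B) :
    Character U φ ⥤ S ⥤ Character T φ where
  obj F := coindFunctor P F
  map η :=
    { app := fun x => Trans.comap η (P.fn.obj x)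
      naturality := fun {x x'} f => hom_ext fun y => hom_nat η ((P.fn.map f).app y) }

instance (P : BiaddFunctor S T U) (F : Character U φ) :
    ((coindBifunctor P φ).obj F).LaxBraided :=
  (inferInstance : (coindFunctor P F).LaxBraided)

instance (P : BiaddFunctor S T U) (x : S) : ((coindBifunctor P φ).flip.obj x).LaxBraided :=
  (inferInstance : (comapFunctor (P.fn.obj x) φ).LaxBraided)

/-- The biadditive functor `(F, x) ↦ F (x · -)`. -/
def coindBiadd (P : BiaddFunctor S T U) (φ : BraidingForm A B) :
    BiaddFunctor (SCGr.characters U φ) S (SCGr.characters T φ) where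
  fn := coindBifunctor P φ
  right F := (inferInstance : ((coindBifunctor P φ).obj F).LaxBraided)
  left x := (inferInstance : ((coindBifunctor P φ).flip.obj x).LaxBraided)
  right_nat η :=
    { unit := hom_ext fun y => (Trans.comap η (P.fn.flip.obj y)).unit
      tensor := fun x x' => hom_ext fun y => (Trans.comap η (P.fn.flip.obj y)).mul x x' }
  left_nat g :=
    { unit := hom_ext fun y => (zero_add _)
      tensor := fun F G => hom_ext fun y => (zero_add _).trans (add_zero _).symm }
  interchange F G x x' := hom_ext fun y => by
    -- The interchange of characters contributes this form in one order, the pointwise sum in the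
    -- other; antisymmetry cancels them.
    have h := φ.symm (F.val (P.obj x' y)) (G.val (P.obj x y))
    change F.m (P.obj x y) (P.obj x' y) + F.deg (P.distL x x' y) +
      (G.m (P.obj x y) (P.obj x' y) + G.deg (P.distL x x' y)) + 0 =
      (0 + (-0 + (φ.c (F.val (P.obj x' y)) (G.val (P.obj x y)) + (0 + -0)))) + (0 + 0 +
      (F.m (P.obj x y) (P.obj x' y) + G.m (P.obj x y) (P.obj x' y) +
        φ.c (G.val (P.obj x y)) (F.val (P.obj x' y)) +
        (F.deg (P.distL x x' y) + G.deg (P.distL x x' y))))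
    linear_combination (norm := abel) -h

end Character

/-! ### Associativity and unit constraints seen by characters -/

namespace Character

variable {A B : Type u} [AddCommGroup A] [AddCommGroup B]
variable {S T U V W Z : SCGr.{u}} {φ : BraidingForm A B}

section

variable {P : BiaddFunctor S T V} {Q : BiaddFunctor V U Z} {P' : BiaddFunctor T U W}
  {Q' : BiaddFunctor S W Z} (a : AssocConstraint P Q P' Q') (F : Character Z φ)

theorem assoc_naturality {x x' : S} {y y' : T} (f : x ⟶ x') (g : y ⟶ y') (z : U) :
    F.deg ((Q.fn.map (P.map f g)).app z) + F.deg (a.iso x' y' z).hom =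
      F.deg (a.iso x y z).hom + (F.deg ((Q'.fn.map f).app (P'.obj y z)) +
        F.deg ((Q'.fn.obj x').map ((P'.fn.map g).app z))) := by
  have h := congrArg F.deg (a.naturality f g (𝟙 z))
  rw [F.deg_comp, F.deg_comp, BiaddFunctor.map_id_right, BiaddFunctor.map_id_right] at h
  exact h.trans (congrArg _ (F.deg_comp _ _))

/-- The additivity axiom in degrees, solved for the inverse constraint, which is the direction used
by characters. -/
theorem assoc_additive₁ (x x' : S) (y : T) (z : U) :
    F.m (Q'.obj x (P'.obj y z)) (Q'.obj x' (P'.obj y z)) +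
      F.deg (Q'.distL x x' (P'.obj y z)) - F.deg (a.iso (x ⊗ x') y z).hom =
    -F.deg (a.iso x y z).hom + -F.deg (a.iso x' y z).hom +
      (F.m (Q.obj (P.obj x y) z) (Q.obj (P.obj x' y) z) +
        F.deg (Q.distL (P.obj x y) (P.obj x' y) z) +
        F.deg ((Q.fn.map (P.distL x x' y)).app z)) := by
  have h := congrArg F.deg (a.additive₁ x x' y z)
  have h' := F.deg_tensorHom (a.iso x y z).hom (a.iso x' y z).hom
  rw [F.deg_comp, F.deg_comp, F.deg_comp, BiaddFunctor.map_id_right] at h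
  linear_combination (norm := abel) -h - h'

theorem assoc_additive₂ (x : S) (y y' : T) (z : U) :
    F.m (Q'.obj x (P'.obj y z)) (Q'.obj x (P'.obj y' z)) +
      F.deg (Q'.distR x (P'.obj y z) (P'.obj y' z)) +
      F.deg ((Q'.fn.obj x).map (P'.distL y y' z)) - F.deg (a.iso x (y ⊗ y') z).hom =
    -F.deg (a.iso x y z).hom + -F.deg (a.iso x y' z).hom +
      (F.m (Q.obj (P.obj x y) z) (Q.obj (P.obj x y') z) +
        F.deg (Q.distL (P.obj x y) (P.obj x y') z) +
        F.deg ((Q.fn.map (P.distR x y y')).app z)) := by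
  have h := congrArg F.deg (a.additive₂ x y y' z)
  have h' := F.deg_tensorHom (a.iso x y z).hom (a.iso x y' z).hom
  rw [F.deg_comp, F.deg_comp, F.deg_comp, F.deg_comp, BiaddFunctor.map_id_right,
    BiaddFunctor.map_id_left] at h
  linear_combination (norm := abel) -h - h'

/-- An associativity constraint, as a transformation of characters in the third variable. -/
def assocTrans (x : S) (y : T) :
    Trans ((F.comap (Q'.fn.obj x)).comap (P'.fn.obj y)) (F.comap (Q.fn.obj (P.obj x y))) where
  -- The sign appears because restriction reverses direction: acting first by `x`, then by `y`,
  -- evaluates `F` at `x (y z)`, and the constraint must lead to `(x y) z`.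
  t z := -F.deg (a.iso x y z).hom
  val_eq z := (F.val_eq (a.iso x y z).hom).symm
  nat {z z'} f := by
    have h := congrArg F.deg (a.naturality (𝟙 x) (𝟙 y) f)
    rw [F.deg_comp, F.deg_comp, BiaddFunctor.map_id, BiaddFunctor.map_id_left,
      BiaddFunctor.map_id_left, BiaddFunctor.map_id_left] at h
    change F.deg ((Q'.fn.obj x).map ((P'.fn.obj y).map f)) + _ =
      _ + F.deg ((Q.fn.obj (P.obj x y)).map f)
    linear_combination (norm := abel) -h
  mul z z' := by
    have h := congrArg F.deg (a.additive₃ x y z z')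
    have h' := F.deg_tensorHom (a.iso x y z).hom (a.iso x y z').hom
    rw [F.deg_comp, F.deg_comp, F.deg_comp, BiaddFunctor.map_id_left] at h
    change F.m (Q'.obj x (P'.obj y z)) (Q'.obj x (P'.obj y z')) +
      F.deg (Q'.distR x (P'.obj y z) (P'.obj y z')) +
      F.deg ((Q'.fn.obj x).map (P'.distR y z z')) + _ = _ + _ +
        (F.m (Q.obj (P.obj x y) z) (Q.obj (P.obj x y) z') + F.deg (Q.distR (P.obj x y) z z'))
    linear_combination (norm := abel) -h - h'

end

/-- A left unit constraint, as a transformation of characters. -/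
def leftUnitTrans {P : BiaddFunctor S T T} {e : S} (l : LeftUnitConstraint P e)
    (F : Character T φ) : Trans (F.comap (P.fn.obj e)) F where
  t y := F.deg (l.iso y).hom
  val_eq y := F.val_eq (l.iso y).hom
  nat f := by
    have h := congrArg F.deg (l.naturality f)
    rwa [F.deg_comp, F.deg_comp, BiaddFunctor.map_id_left] at h
  mul y y' := by
    have h := congrArg F.deg (l.additive y y')
    have h' := F.deg_tensorHom (l.iso y).hom (l.iso y').hom
    rw [F.deg_comp] at h
    change F.m _ _ + F.deg (P.distR e y y') + _ = _
    linear_combination (norm := abel) h + h'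

end Character

/-! ### The module of characters of a 2-ring, and coinduction -/

namespace RightModule

open Character

variable {A B : Type u} [AddCommGroup A] [AddCommGroup B] (R : TwoRing.{u}) (φ : BraidingForm A B)

/-- The associativity constraint for characters of a 2-ring. -/
def charactersAssoc : AssocConstraint (coindBiadd R.mul φ) (coindBiadd R.mul φ) R.mul
    (coindBiadd R.mul φ) where
  iso F x y := (Character.assocTrans R.assoc F x y).iso
  naturality {F G x x' y y'} η f g := hom_ext fun z => by
    have h₁ := G.assoc_naturality R.assoc f g z
    have h₂ := hom_nat η (R.assoc.iso x y z).hom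
    change t η (R.mul.obj x (R.mul.obj y z)) + G.deg ((R.mul.fn.map f).app (R.mul.obj y z)) +
      G.deg ((R.mul.fn.obj x').map ((R.mul.fn.map g).app z)) + -G.deg (R.assoc.iso x' y' z).hom =
      -F.deg (R.assoc.iso x y z).hom + (t η (R.mul.obj (R.mul.obj x y) z) +
        G.deg ((R.mul.fn.map (R.mul.map f g)).app z))
    linear_combination (norm := abel) h₂ - h₁
  additive₁ F G x y := hom_ext fun z => by
    change (0 : B) + (0 + (F ⊗ G).deg ((R.mul.fn.obj x).map ((R.mul.fn.map (𝟙 y)).app z)) +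
      -(F ⊗ G).deg (R.assoc.iso x y z).hom) =
        -F.deg (R.assoc.iso x y z).hom + -G.deg (R.assoc.iso x y z).hom + 0
    simp
    abel
  additive₂ F x x' y := hom_ext fun z => by
    -- The variables shift by one, since the character takes the first place in its module:
    -- additivity in `x` is additivity of the constraint of `R` in its first variable. Additivity in
    -- the third variable of `R` was used to make the constraint a transformation.
    have h := F.assoc_additive₁ R.assoc x x' y z
    change (0 : B) + (F.m (R.mul.obj x (R.mul.obj y z)) (R.mul.obj x' (R.mul.obj y z)) +
      F.deg (R.mul.distL x x' (R.mul.obj y z)) +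
      F.deg ((R.mul.fn.obj (x ⊗ x')).map ((R.mul.fn.map (𝟙 y)).app z)) +
      -F.deg (R.assoc.iso (x ⊗ x') y z).hom) =
      -F.deg (R.assoc.iso x y z).hom + -F.deg (R.assoc.iso x' y z).hom +
      (F.m (R.mul.obj (R.mul.obj x y) z) (R.mul.obj (R.mul.obj x' y) z) +
        F.deg (R.mul.distL (R.mul.obj x y) (R.mul.obj x' y) z) +
        (0 + F.deg ((R.mul.fn.map (R.mul.distL x x' y)).app z)))
    simp only [CategoryTheory.Functor.map_id, NatTrans.id_app, deg_id]
    linear_combination (norm := abel) h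
  additive₃ F x y y' := hom_ext fun z => by
    have h := F.assoc_additive₂ R.assoc x y y' z
    change F.m (R.mul.obj x (R.mul.obj y z)) (R.mul.obj x (R.mul.obj y' z)) +
      F.deg (R.mul.distR x (R.mul.obj y z) (R.mul.obj y' z)) +
      F.deg ((R.mul.fn.obj x).map (R.mul.distL y y' z)) +
      -F.deg (R.assoc.iso x (y ⊗ y') z).hom =
      -F.deg (R.assoc.iso x y z).hom + -F.deg (R.assoc.iso x y' z).hom +
      (F.m (R.mul.obj (R.mul.obj x y) z) (R.mul.obj (R.mul.obj x y') z) +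
        F.deg (R.mul.distL (R.mul.obj x y) (R.mul.obj x y') z) +
        (0 + F.deg ((R.mul.fn.map (R.mul.distR x y y')).app z)))
    linear_combination (norm := abel) h

/-- The right unit constraint for characters of a 2-ring. -/
def charactersUnit : RightUnitConstraint (coindBiadd R.mul φ) R.one where
  iso F := (Character.leftUnitTrans R.leftUnit F).iso
  naturality {F G} η := hom_ext fun y => by
    have h := hom_nat η (R.leftUnit.iso y).hom
    change t η (R.mul.obj R.one y) + G.deg ((R.mul.fn.map (𝟙 R.one)).app y) +
      G.deg (R.leftUnit.iso y).hom = F.deg (R.leftUnit.iso y).hom + t η y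
    simp only [CategoryTheory.Functor.map_id, NatTrans.id_app, deg_id]
    linear_combination (norm := abel) -h
  additive F G := hom_ext fun y => zero_add _

/-- The right module of characters of a 2-ring. -/
def characters : RightModule R where
  add := SCGr.characters R.add φ
  act := coindBiadd R.mul φ
  assoc := charactersAssoc R φ
  unit := charactersUnit R φ
  pentagon F x y z := hom_ext fun w => by
    have h := congrArg (Character.deg F) (R.pentagon x y z w)
    simp only [F.deg_comp, BiaddFunctor.map_id_left, BiaddFunctor.map_id_right] at h
    change -F.deg (R.assoc.iso x y (R.mul.obj z w)).hom +
      F.deg ((R.mul.fn.obj (R.mul.obj x y)).map ((R.mul.fn.map (𝟙 z)).app w)) +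
      (-F.deg (R.assoc.iso (R.mul.obj x y) z w).hom +
        (0 + F.deg ((R.mul.fn.map (R.assoc.iso x y z).hom).app w))) =
      -F.deg ((R.mul.fn.obj x).map (R.assoc.iso y z w).hom) +
        -F.deg (R.assoc.iso x (R.mul.obj y z) w).hom
    simp only [CategoryTheory.Functor.map_id, NatTrans.id_app, deg_id]
    linear_combination (norm := abel) h
  triangle F x := hom_ext fun y => by
    -- Evaluation at `y` puts the unit in front of `x y`, so the derived left unit compatibility is
    -- needed here rather than the triangle axiom of `R`.
    have h := congrArg (Character.deg F) (R.assoc_leftUnit x y)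
    rw [F.deg_comp, BiaddFunctor.map_id_right] at h
    change -F.deg (R.assoc.iso R.one x y).hom +
      (0 + F.deg ((R.mul.fn.map (R.leftUnit.iso x).hom).app y)) =
      F.deg (R.leftUnit.iso (R.mul.obj x y)).hom + F.deg ((R.mul.fn.map (𝟙 x)).app y)
    simp only [CategoryTheory.Functor.map_id, NatTrans.id_app, deg_id]
    linear_combination (norm := abel) -h

variable {R φ}

/-- The morphism of modules `m ↦ h (m · -)` given by a character `h`. -/
def coind {M : RightModule R} (h : Character M.add φ) : M ⟶ characters R φ :=
  Hom.mk (N := characters R φ)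
    (hom := SCGr.Hom.mk (T := SCGr.characters R.add φ) (h.coindFunctor M.act))
    (lin := fun m x => (h.assocTrans M.assoc m x).iso)
    (naturality := fun {m m' x x'} f g => hom_ext fun s => by
      have e := h.assoc_naturality M.assoc f g s
      change h.deg ((M.act.fn.map f).app (R.mul.obj x s)) +
        h.deg ((M.act.fn.obj m').map ((R.mul.fn.map g).app s)) +
        -h.deg (M.assoc.iso m' x' s).hom =
        -h.deg (M.assoc.iso m x s).hom + h.deg ((M.act.fn.map (M.act.map f g)).app s)
      linear_combination (norm := abel) -e)
    (additive₁ := fun m m' x => hom_ext fun s => by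
      have e := h.assoc_additive₁ M.assoc m m' x s
      change (0 : B) + (h.m (M.act.obj m (R.mul.obj x s)) (M.act.obj m' (R.mul.obj x s)) +
        h.deg (M.act.distL m m' (R.mul.obj x s)) +
        h.deg ((M.act.fn.obj (m ⊗ m')).map ((R.mul.fn.map (𝟙 x)).app s)) +
        -h.deg (M.assoc.iso (m ⊗ m') x s).hom) =
        -h.deg (M.assoc.iso m x s).hom + -h.deg (M.assoc.iso m' x s).hom +
        (h.m (M.act.obj (M.act.obj m x) s) (M.act.obj (M.act.obj m' x) s) +
          h.deg (M.act.distL (M.act.obj m x) (M.act.obj m' x) s) +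
          h.deg ((M.act.fn.map (M.act.distL m m' x)).app s))
      simp only [CategoryTheory.Functor.map_id, NatTrans.id_app, deg_id]
      linear_combination (norm := abel) e)
    (additive₂ := fun m x x' => hom_ext fun s => by
      have e := h.assoc_additive₂ M.assoc m x x' s
      change h.m (M.act.obj m (R.mul.obj x s)) (M.act.obj m (R.mul.obj x' s)) +
        h.deg (M.act.distR m (R.mul.obj x s) (R.mul.obj x' s)) +
        h.deg ((M.act.fn.obj m).map (R.mul.distL x x' s)) +
        -h.deg (M.assoc.iso m (x ⊗ x') s).hom =
        -h.deg (M.assoc.iso m x s).hom + -h.deg (M.assoc.iso m x' s).hom +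
        (h.m (M.act.obj (M.act.obj m x) s) (M.act.obj (M.act.obj m x') s) +
          h.deg (M.act.distL (M.act.obj m x) (M.act.obj m x') s) +
          h.deg ((M.act.fn.map (M.act.distR m x x')).app s))
      linear_combination (norm := abel) e)
    (assoc := fun m x y => hom_ext fun s => by
      have e := congrArg h.deg (M.pentagon m x y s)
      simp only [h.deg_comp, BiaddFunctor.map_id_left, BiaddFunctor.map_id_right] at e
      change -h.deg (M.assoc.iso m x (R.mul.obj y s)).hom +
        h.deg ((M.act.fn.obj (M.act.obj m x)).map ((R.mul.fn.map (𝟙 y)).app s)) +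
        (-h.deg (M.assoc.iso (M.act.obj m x) y s).hom +
          h.deg ((M.act.fn.map (M.assoc.iso m x y).hom).app s)) =
        -h.deg ((M.act.fn.obj m).map (R.assoc.iso x y s).hom) +
          -h.deg (M.assoc.iso m (R.mul.obj x y) s).hom
      simp only [CategoryTheory.Functor.map_id, NatTrans.id_app, deg_id]
      linear_combination (norm := abel) e)
    (unit := fun m => hom_ext fun s => by
      have e := congrArg h.deg (M.triangle m s)
      rw [h.deg_comp, BiaddFunctor.map_id_right, BiaddFunctor.map_id_left] at e
      change -h.deg (M.assoc.iso m R.one s).hom + h.deg ((M.act.fn.map (M.unit.iso m).hom).app s) =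
        h.deg ((M.act.fn.obj m).map (R.leftUnit.iso s).hom)
      linear_combination (norm := abel) -e)

end RightModule

/-! ## Faithful morphisms of modules -/

namespace RightModule

variable {R : TwoRing.{u}}

theorem map_id_one_injective (M : RightModule R) {m m' : M.add} {f g : m ⟶ m'}
    (h : M.act.map f (𝟙 R.one) = M.act.map g (𝟙 R.one)) : f = g := by
  rw [← cancel_epi (M.unit.iso m).hom, ← M.unit.naturality, h, M.unit.naturality]

/-- The right-handed form of Kelly's argument, with the pentagon at `m, x, 1, 1`. It makes orbit
morphisms compatible with the unit constraints. -/
theorem assoc_rightUnit (M : RightModule R) (m : M.add) (x : R.add) :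
    (M.assoc.iso m x R.one).hom ≫ M.act.map (𝟙 m) (R.rightUnit.iso x).hom =
      (M.unit.iso (M.act.obj m x)).hom := by
  apply M.map_id_one_injective
  have h₁ := M.pentagon m x R.one R.one
  have h₂ := M.triangle (M.act.obj m x) R.one
  have h₃ := M.assoc.naturality (𝟙 m) (𝟙 x) (R.leftUnit.iso R.one).hom
  have h₄ := M.assoc.naturality (𝟙 m) (R.rightUnit.iso x).hom (𝟙 R.one)
  rw [BiaddFunctor.map_id] at h₃
  rw [← cancel_mono (M.assoc.iso m x R.one).hom, BiaddFunctor.map_comp_id, Category.assoc, h₄,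
    ← R.triangle x R.one, M.act.id_map_comp, reassoc_of% h₁, ← h₃, ← h₂, Category.assoc]

variable (R) in
/-- A 2-ring as a right module over itself. -/
abbrev regular : RightModule R where
  add := R.add
  act := R.mul
  assoc := R.assoc
  unit := R.rightUnit
  pentagon := R.pentagon
  triangle := R.triangle

/-- The morphism of modules `x ↦ m x`. -/
def orbit (M : RightModule R) (m : M.add) : regular R ⟶ M :=
  Hom.mk (M := regular R) (N := M)
    (hom := SCGr.Hom.mk (S := R.add) (T := M.add) (M.act.fn.obj m) (braided := M.act.right m))
    (lin := fun x y => M.assoc.iso m x y)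
    (naturality := fun {x x' y y'} f g => by
      have h := M.assoc.naturality (𝟙 m) f g
      rw [BiaddFunctor.map_id_left, BiaddFunctor.map_id_left] at h
      exact h)
    (additive₁ := fun x x' y => by
      have h := M.assoc.additive₂ m x x' y
      rw [BiaddFunctor.map_id_left] at h
      exact h)
    (additive₂ := fun x y y' => by
      have h := M.assoc.additive₃ m x y y'
      rw [BiaddFunctor.map_id_left] at h
      exact h)
    (assoc := fun x y z => by
      have h := M.pentagon m x y z
      rw [BiaddFunctor.map_id_left] at h
      exact h)
    (unit := fun x => by
      have h := M.assoc_rightUnit m x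
      rw [BiaddFunctor.map_id_left] at h
      exact h)

/-- The 2-morphism between orbit morphisms given by a morphism of objects. -/
def orbitMap (M : RightModule R) {m m' : M.add} (f : m ⟶ m') : M.orbit m ⟶ M.orbit m' :=
  Hom₂.mk (F := M.orbit m) (G := M.orbit m')
    (SCGr.Hom₂.mk (F := Hom.hom (M.orbit m)) (G := Hom.hom (M.orbit m')) (M.act.fn.map f)
      (isMonoidal := M.act.right_nat f))
    fun x y => by
      have h := M.assoc.naturality f (𝟙 x) (𝟙 y)
      rw [BiaddFunctor.map_id, BiaddFunctor.map_id_right M.act f,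
        BiaddFunctor.map_id_right M.act f] at h
      exact h

/-- The regular module detects morphisms of `M`: `f` gives a 2-morphism `x ↦ f · x` of orbit
morphisms. Linearity of `F` expresses its image through `F f`, so equal images give equal whiskered
2-morphisms; faithfulness removes `F`, and evaluation at the unit recovers `f`. -/
theorem injective_of_isFaithfulMor {M N : RightModule R} (F : M ⟶ N) (hF : IsFaithfulMor F)
    {m m' : M.add} (f g : m ⟶ m')
    (h : (Hom.hom F).fn.map f = (Hom.hom F).fn.map g) : f = g := by
  have e : Bicategory.whiskerRight (M.orbitMap f) F = Bicategory.whiskerRight (M.orbitMap g) F :=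
    hom₂_ext (SCGr.hom₂_ext fun x => by
      have h₁ := Hom.naturality F f (𝟙 x)
      have h₂ := Hom.naturality F g (𝟙 x)
      rw [h, h₂, Iso.cancel_iso_hom_left, BiaddFunctor.map_id_right,
        BiaddFunctor.map_id_right] at h₁
      exact h₁.symm)
  have e' := hF _ _ _ _ _ e
  refine M.map_id_one_injective ?_
  rw [BiaddFunctor.map_id_right, BiaddFunctor.map_id_right]
  exact congrArg (fun η => (SCGr.Hom₂.nt (Hom₂.hom η)).app R.one) e'

theorem isFaithfulMor_of_injective {M N : RightModule R} (F : M ⟶ N)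
    (hF : ∀ (m m' : M.add) (f g : m ⟶ m'),
      (Hom.hom F).fn.map f = (Hom.hom F).fn.map g → f = g) : IsFaithfulMor F :=
  fun _ _ _ _ _ e => hom₂_ext (SCGr.isFaithfulMor_of_injective (Hom.hom F) hF _ _ _ _ _
    (congrArg Hom₂.hom e))

end RightModule

/-! ## Coinduced modules -/

namespace Character

variable {A B : Type u} [AddCommGroup A] [AddCommGroup B]
variable {S T : SCGr.{u}} {φ : BraidingForm A B}

instance (F : S ⟶ SCGr.characters T φ) :
    Functor.LaxBraided (C := S) (D := Character T φ) (SCGr.Hom.fn F) :=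
  SCGr.Hom.braided F

/-- The character `x ↦ F x y` for a morphism `F` to a symmetric categorical group of characters. -/
def eval (F : S ⟶ SCGr.characters T φ) (y : T) : Character S φ where
  val x := Character.val ((SCGr.Hom.fn F).obj x) y
  deg f := t ((SCGr.Hom.fn F).map f) y
  m x x' := t (Functor.LaxMonoidal.μ (SCGr.Hom.fn F) x x' :) y
  val_eq f := hom_val ((SCGr.Hom.fn F).map f) y
  val_tensor x x' := (hom_val (Functor.LaxMonoidal.μ (SCGr.Hom.fn F) x x' :) y).symm
  deg_comp f g := congrArg (t · y) ((SCGr.Hom.fn F).map_comp f g)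
  m_left f z := (congrArg (t · y) (Functor.LaxMonoidal.μ_natural_left (SCGr.Hom.fn F) f z :)).symm
  m_right z _ _ f :=
    (congrArg (t · y) (Functor.LaxMonoidal.μ_natural_right (SCGr.Hom.fn F) z f :)).symm
  m_assoc x x' x'' := by
    have h := congrArg (t · y) (Functor.LaxMonoidal.associativity (SCGr.Hom.fn F) x x' x'' :)
    exact (add_assoc _ _ _).trans (h.trans (zero_add _))
  m_symm x x' := congrArg (t · y) (Functor.LaxBraided.braided (F := SCGr.Hom.fn F) x x' :)

theorem e_eval (F : S ⟶ SCGr.characters T φ) (y : T) :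
    (eval F y).e = t (Functor.LaxMonoidal.ε (SCGr.Hom.fn F) :) y := by
  have h : (0 : B) = t (Functor.LaxMonoidal.ε (SCGr.Hom.fn F) :) y +
      ((eval F y).m (𝟙_ S) (𝟙_ S) + (eval F y).deg (λ_ (𝟙_ S)).hom) :=
    congrArg (t · y) (Functor.LaxMonoidal.left_unitality (SCGr.Hom.fn F) (𝟙_ S) :)
  exact neg_eq_of_add_eq_zero_left h.symm

/-- Morphisms to a symmetric categorical group of characters are isomorphic if they are so in each
variable. -/
def evalIso {F G : S ⟶ SCGr.characters T φ}
    (τ : ∀ x, Trans ((SCGr.Hom.fn F).obj x) ((SCGr.Hom.fn G).obj x))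
    (η : ∀ y, Trans (eval F y) (eval G y)) (h : ∀ x y, (τ x).t y = (η y).t x) : F ≅ G :=
  SCGr.mkIso₂ F G
    (NatIso.ofComponents (fun x => (τ x).iso) fun {x x'} f => hom_ext fun y => by
      have e := (η y).nat f
      rw [← h, ← h] at e
      exact e)
    { unit := hom_ext fun y => by
        have e := (η y).unit
        rw [e_eval, e_eval, ← h] at e
        exact e
      tensor := fun x x' => hom_ext fun y => by
        have e := (η y).mul x x'
        rw [← h, ← h, ← h] at e
        exact e }

end Character

namespace RightModule

open Character Functor.LaxMonoidal

variable {A B : Type u} [AddCommGroup A] [AddCommGroup B] {R : TwoRing.{u}} {φ : BraidingForm A B}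

/-- Morphisms to a module of characters are isomorphic if they are so in each variable,
compatibly with the actions. -/
def isoOfTrans {M : RightModule R} {F G : M ⟶ characters R φ}
    (τ : ∀ m, Trans ((Hom.hom F).fn.obj m) ((Hom.hom G).fn.obj m))
    (η : ∀ y, Trans (eval (Hom.hom F) y) (eval (Hom.hom G) y))
    (h : ∀ m y, (τ m).t y = (η y).t m)
    (hlin : ∀ (m : M.add) (x y : R.add), (τ m).t (R.mul.obj x y) + t (Hom.lin G m x).hom y =
      t (Hom.lin F m x).hom y + (τ (M.act.obj m x)).t y) : F ≅ G :=
  mkIso₂ F G (evalIso τ η h) fun m x => hom_ext fun y => by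
    refine Eq.trans ?_ (hlin m x y)
    have e : Character.deg ((Hom.hom G).fn.obj m) ((R.mul.fn.map (𝟙 x)).app y) = 0 := by
      rw [CategoryTheory.Functor.map_id, NatTrans.id_app]
      exact Character.deg_id _ _
    exact congrArg (· + t (Hom.lin G m x).hom y) ((congrArg (_ + ·) e).trans (add_zero _))

/-- Coinduced morphisms of isomorphic characters are isomorphic. -/
def coindIso {M : RightModule R} {h h' : Character M.add φ} (θ : Trans h h') :
    coind h ≅ coind h' :=
  isoOfTrans (fun m => θ.comap (M.act.fn.obj m)) (fun y => θ.comap (M.act.fn.flip.obj y))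
    (fun _ _ => rfl) fun m x y => by
      have e := θ.nat (M.assoc.iso m x y).hom
      change θ.t (M.act.obj m (R.mul.obj x y)) + -h'.deg (M.assoc.iso m x y).hom =
        -h.deg (M.assoc.iso m x y).hom + θ.t (M.act.obj (M.act.obj m x) y)
      linear_combination (norm := abel) e

/-- Coinduction is natural. -/
def compCoindIso {M N : RightModule R} (F : M ⟶ N) (h : Character N.add φ) :
    F ≫ coind h ≅ coind (h.comap (Hom.hom F).fn) :=
  isoOfTrans
    (fun m =>
      -- The comparison is `h` applied to the linearity constraint `F m · x ≅ F (m · x)`; its two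
      -- additivities give monoidality in `x` and in `m`.
      { t := fun x => h.deg (Hom.lin F m x).hom
        val_eq := fun x => h.val_eq (Hom.lin F m x).hom
        nat := fun {x x'} f => by
          have e := congrArg h.deg (Hom.naturality F (𝟙 m) f)
          rw [h.deg_comp, h.deg_comp, CategoryTheory.Functor.map_id, BiaddFunctor.map_id_left,
            BiaddFunctor.map_id_left] at e
          exact e
        mul := fun x x' => by
          have e := congrArg h.deg (Hom.additive₂ F m x x')
          have e' := h.deg_tensorHom (Hom.lin F m x).hom (Hom.lin F m x').hom
          rw [h.deg_comp, h.deg_comp, h.deg_comp] at e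
          change h.m _ _ + h.deg (N.act.distR ((Hom.hom F).fn.obj m) x x') + _ = _ + _ +
            (h.m _ _ + h.deg (μ (Hom.hom F).fn _ _) +
              h.deg ((Hom.hom F).fn.map (M.act.distR m x x')))
          linear_combination (norm := abel) e + e' })
    (fun x =>
      { t := fun m => h.deg (Hom.lin F m x).hom
        val_eq := fun m => h.val_eq (Hom.lin F m x).hom
        nat := fun {m m'} f => by
          have e := congrArg h.deg (Hom.naturality F f (𝟙 x))
          rw [h.deg_comp, h.deg_comp, BiaddFunctor.map_id_right,
            BiaddFunctor.map_id_right] at e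
          exact e
        mul := fun m m' => by
          have e := congrArg h.deg (Hom.additive₁ F m m' x)
          have e' := h.deg_tensorHom (Hom.lin F m x).hom (Hom.lin F m' x).hom
          rw [h.deg_comp, h.deg_comp, h.deg_comp, h.deg_comp, BiaddFunctor.map_id_right] at e
          change h.m _ _ + h.deg (N.act.distL _ _ x) +
            h.deg ((N.act.fn.map (μ (Hom.hom F).fn m m')).app x) + _ = _ + _ +
            (h.m _ _ + h.deg (μ (Hom.hom F).fn _ _) +
              h.deg ((Hom.hom F).fn.map (M.act.distL m m' x)))
          linear_combination (norm := abel) e + e' })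
    (fun _ _ => rfl) fun m x y => by
      have e := congrArg h.deg (Hom.assoc F m x y)
      rw [h.deg_comp, h.deg_comp, h.deg_comp, BiaddFunctor.map_id_right] at e
      change h.deg (Hom.lin F m (R.mul.obj x y)).hom +
        -h.deg ((Hom.hom F).fn.map (M.assoc.iso m x y).hom) =
        -h.deg (N.assoc.iso ((Hom.hom F).fn.obj m) x y).hom +
          h.deg ((N.act.fn.map (Hom.lin F m x).hom).app y) + h.deg (Hom.lin F (M.act.obj m x) y).hom
      linear_combination (norm := abel) -e

end RightModule

/-! ### Evaluation at the unit inverts coinduction -/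

namespace RightModule

open Character Functor.LaxMonoidal

variable {A B : Type u} [AddCommGroup A] [AddCommGroup B] {R : TwoRing.{u}} {φ : BraidingForm A B}

theorem rightUnit_mul (R : TwoRing.{u}) (x y : R.add) :
    (R.assoc.iso x y R.one).hom ≫ R.mul.map (𝟙 x) (R.rightUnit.iso y).hom =
      (R.rightUnit.iso (R.mul.obj x y)).hom :=
  (regular R).assoc_rightUnit x y

section

variable {M : RightModule R} (F : M ⟶ characters R φ)

/-- The value of a morphism to the module of characters. -/
abbrev valueAt (m : M.add) : Character R.add φ := (Hom.hom F).fn.obj m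

/-- The value of a morphism to the module of characters on a morphism. -/
def mapTrans {m m' : M.add} (f : m ⟶ m') : Trans (valueAt F m) (valueAt F m') :=
  (Hom.hom F).fn.map f

/-- The additivity constraint of a morphism to the module of characters. -/
def μTrans (m m' : M.add) : Trans (valueAt F m ⊗ valueAt F m') (valueAt F (m ⊗ m')) :=
  (μ (Hom.hom F).fn m m' :)

/-- The linearity constraint of a morphism to the module of characters. -/
def linTrans (m : M.add) (x : R.add) :
    Trans ((valueAt F m).comap (R.mul.fn.obj x)) (valueAt F (M.act.obj m x)) :=
  (Hom.lin F m x).hom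

theorem linTrans_naturality {m m' : M.add} {x x' : R.add} (f : m ⟶ m') (g : x ⟶ x') (y : R.add) :
    (mapTrans F f).t (R.mul.obj x y) + (valueAt F m').deg ((R.mul.fn.map g).app y) +
      (linTrans F m' x').t y = (linTrans F m x).t y + (mapTrans F (M.act.map f g)).t y :=
  congrArg (fun η => Trans.t η y) (Hom.naturality F f g)

theorem linTrans_additive₁ (m m' : M.add) (x y : R.add) :
    (μTrans F m m').t (R.mul.obj x y) + (linTrans F (m ⊗ m') x).t y =
      (linTrans F m x).t y + (linTrans F m' x).t y +
        ((μTrans F (M.act.obj m x) (M.act.obj m' x)).t y +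
          (mapTrans F (M.act.distL m m' x)).t y) := by
  have h : (0 : B) + ((μTrans F m m').t (R.mul.obj x y) +
      (valueAt F (m ⊗ m')).deg ((R.mul.fn.map (𝟙 x)).app y) + (linTrans F (m ⊗ m') x).t y) =
      (linTrans F m x).t y + (linTrans F m' x).t y +
        ((μTrans F (M.act.obj m x) (M.act.obj m' x)).t y +
          (mapTrans F (M.act.distL m m' x)).t y) :=
    congrArg (fun η => Trans.t η y) (Hom.additive₁ F m m' x)
  rw [CategoryTheory.Functor.map_id, NatTrans.id_app, deg_id, add_zero, zero_add] at h
  exact h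

theorem linTrans_additive₂ (m : M.add) (x x' y : R.add) :
    (valueAt F m).m (R.mul.obj x y) (R.mul.obj x' y) + (valueAt F m).deg (R.mul.distL x x' y) +
      (linTrans F m (x ⊗ x')).t y =
      (linTrans F m x).t y + (linTrans F m x').t y +
        ((μTrans F (M.act.obj m x) (M.act.obj m x')).t y +
          (mapTrans F (M.act.distR m x x')).t y) :=
  congrArg (fun η => Trans.t η y) (Hom.additive₂ F m x x')

theorem linTrans_assoc (m : M.add) (x y z : R.add) :
    (linTrans F m x).t (R.mul.obj y z) + ((linTrans F (M.act.obj m x) y).t z +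
      (mapTrans F (M.assoc.iso m x y).hom).t z) =
      -(valueAt F m).deg (R.assoc.iso x y z).hom + (linTrans F m (R.mul.obj x y)).t z := by
  have h : (linTrans F m x).t (R.mul.obj y z) +
      (valueAt F (M.act.obj m x)).deg ((R.mul.fn.map (𝟙 y)).app z) +
      ((linTrans F (M.act.obj m x) y).t z + (mapTrans F (M.assoc.iso m x y).hom).t z) =
      -(valueAt F m).deg (R.assoc.iso x y z).hom + (linTrans F m (R.mul.obj x y)).t z :=
    congrArg (fun η => Trans.t η z) (Hom.assoc F m x y)
  rw [CategoryTheory.Functor.map_id, NatTrans.id_app, deg_id, add_zero] at h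
  exact h

/-- A morphism to the module of characters is coinduced by its evaluation at the unit. -/
def coindEvalIso : coind (eval (Hom.hom F) R.one) ≅ F :=
  isoOfTrans
    (fun m =>
      -- The path `F (m · x) (1) → F m (x · 1) → F m (x)`: the inverse linearity constraint at the
      -- unit, followed by the right unit constraint.
      { t := fun x => -(linTrans F m x).t R.one + (valueAt F m).deg (R.rightUnit.iso x).hom
        val_eq := fun x => ((linTrans F m x).val_eq R.one).symm.trans
          ((valueAt F m).val_eq (R.rightUnit.iso x).hom)
        nat := fun {x x'} f => by
          have h₁ := linTrans_naturality F (𝟙 m) f R.one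
          have h₂ := congrArg (valueAt F m).deg (R.rightUnit.naturality f)
          rw [Character.deg_comp, Character.deg_comp, BiaddFunctor.map_id_right] at h₂
          have h₃ : (mapTrans F (𝟙 m)).t (R.mul.obj x R.one) = 0 :=
            congrArg (fun η => Trans.t η (R.mul.obj x R.one)) ((Hom.hom F).fn.map_id m)
          rw [h₃, BiaddFunctor.map_id_left] at h₁
          change (mapTrans F ((M.act.fn.obj m).map f)).t R.one + _ = _
          linear_combination (norm := abel) h₂ - h₁
        mul := fun x x' => by
          have h₁ := linTrans_additive₂ F m x x' R.one
          have h₂ := congrArg (valueAt F m).deg (R.rightUnit.additive x x')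
          have h₃ := (valueAt F m).deg_tensorHom (R.rightUnit.iso x).hom (R.rightUnit.iso x').hom
          rw [Character.deg_comp] at h₂
          change (μTrans F (M.act.obj m x) (M.act.obj m x')).t R.one +
            (mapTrans F (M.act.distR m x x')).t R.one + _ = _
          linear_combination (norm := abel) h₂ - h₁ + h₃ })
    (fun x =>
      { t := fun m => -(linTrans F m x).t R.one + (valueAt F m).deg (R.rightUnit.iso x).hom
        val_eq := fun m => ((linTrans F m x).val_eq R.one).symm.trans
          ((valueAt F m).val_eq (R.rightUnit.iso x).hom)
        nat := fun {m m'} f => by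
          have h₁ := linTrans_naturality F f (𝟙 x) R.one
          have h₂ := (mapTrans F f).nat (R.rightUnit.iso x).hom
          rw [CategoryTheory.Functor.map_id, NatTrans.id_app, deg_id,
            BiaddFunctor.map_id_right] at h₁
          change (mapTrans F ((M.act.fn.map f).app x)).t R.one + _ = _ + (mapTrans F f).t x
          linear_combination (norm := abel) -h₂ - h₁
        mul := fun m m' => by
          have h₁ := linTrans_additive₁ F m m' x R.one
          have h₂ := (μTrans F m m').nat (R.rightUnit.iso x).hom
          rw [tensor_deg] at h₂
          change (μTrans F (M.act.obj m x) (M.act.obj m' x)).t R.one +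
            (mapTrans F (M.act.distL m m' x)).t R.one + _ = _ + _ + (μTrans F m m').t x
          linear_combination (norm := abel) -h₂ - h₁ })
    (fun _ _ => rfl) fun m x y => by
      have h₁ := linTrans_assoc F m x y R.one
      have h₂ := (linTrans F m x).nat (R.rightUnit.iso y).hom
      have h₃ := congrArg (valueAt F m).deg (rightUnit_mul R x y)
      rw [Character.deg_comp, BiaddFunctor.map_id_left] at h₃
      change (valueAt F m).deg ((R.mul.fn.obj x).map (R.rightUnit.iso y).hom) + _ = _ at h₂
      change -(linTrans F m (R.mul.obj x y)).t R.one +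
        (valueAt F m).deg (R.rightUnit.iso (R.mul.obj x y)).hom + (linTrans F m x).t y =
        -(mapTrans F (M.assoc.iso m x y).hom).t R.one +
          (-(linTrans F (M.act.obj m x) y).t R.one +
            (valueAt F (M.act.obj m x)).deg (R.rightUnit.iso y).hom)
      linear_combination (norm := abel) h₁ + h₂ - h₃

end

/-! ## Injective modules -/

/-- Evaluation at the unit replaces `G` by a character of the underlying object, where the extension
problem is solved by divisibility; coinduction carries the solution back. -/
theorem isInjectiveObj_characters (hB : IsDivisibleGroup B) (hφ : φ.IsTorsionForm) :
    IsInjectiveObj (characters R φ) := fun M N F hF G => by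
  obtain ⟨h, ⟨θ⟩⟩ := Character.exists_extension hB hφ (Hom.hom F)
    (fun a ha => injective_of_isFaithfulMor F hF a (𝟙 _)
      (ha.trans ((Hom.hom F).fn.map_id _).symm)) (eval (Hom.hom G) R.one)
  exact ⟨coind h, ⟨compCoindIso F h ≪≫ coindIso θ ≪≫ coindEvalIso G⟩⟩

/-- At the unit, the image of `f` has degree `h (f · 1)`, and `f · 1` determines `f`. -/
theorem isFaithfulMor_coind {M : RightModule R} (h : Character M.add φ)
    (hh : ∀ (x y : M.add) (f g : x ⟶ y), h.deg f = h.deg g → f = g) :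
    IsFaithfulMor (coind h) :=
  isFaithfulMor_of_injective _ fun m m' f g e => by
    refine M.map_id_one_injective ?_
    rw [BiaddFunctor.map_id_right, BiaddFunctor.map_id_right]
    exact hh _ _ _ _ (congrArg (fun η => Trans.t η R.one) e)

theorem hasEnoughInjectives (R : TwoRing.{u}) : HasEnoughInjectives (RightModule R) := fun M => by
  obtain ⟨A, B, _, _, φ, hB, hφ, h, hh⟩ := SCGr.exists_faithful_character M.add
  exact ⟨characters R φ, coind h, isInjectiveObj_characters hB hφ, isFaithfulMor_coind h hh⟩

end RightModule

theorem theorem8p1 :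
    -- enough injective objects
    HasEnoughInjectives SCGr.{u} ∧
    (∀ R : TwoRing.{u}, HasEnoughInjectives (RightModule R)) ∧
    -- classification of the injective symmetric categorical groups
    (∀ S : SCGr.{u}, IsInjectiveObj S ↔
      ∃ (Q : Type u) (_ : AddCommGroup Q), IsDivisibleGroup Q ∧
        Nonempty (Bicategory.Equivalence S (Ty.K (Ty.r Q)))) ∧
    (∀ S : SCGr.{u}, IsInjectiveObj S →
      IsDivisibleGroup (SCGr.Pi1 S) ∧
        Nonempty (Bicategory.Equivalence S (Ty.K (Ty.r (SCGr.Pi1 S))))) :=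
  ⟨SCGr.hasEnoughInjectives, RightModule.hasEnoughInjectives, fun S =>
    ⟨fun hS => ⟨SCGr.Pi1 S, inferInstance, SCGr.isDivisibleGroup_pi1 S hS,
      SCGr.nonempty_equivalence S hS⟩,
    fun ⟨Q, _, hQ, ⟨e⟩⟩ => IsInjectiveObj.of_equivalence e (SCGr.isInjectiveObj_K_r Q hQ)⟩,
    fun S hS => ⟨SCGr.isDivisibleGroup_pi1 S hS, SCGr.nonempty_equivalence S hS⟩⟩
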